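/- Let $\alpha,\beta,\gamma>0$ and put $\sigma=\frac1{2\beta}\big[(1-\gamma-\beta)+\sqrt{(1-\gamma-\beta)^2+4\beta(1+\gamma)}\big]$. Consider, with control parameter $\delta>0$, the stirred Oregonator centred at its positive equilibrium $(\sigma,\frac{\gamma\sigma}{1+\sigma},\sigma)$: $$\begin{aligned} u_1'&=-\alpha\big(\tfrac12(\gamma+3\beta\sigma-1)u_1+(\sigma-1)u_2+u_1u_2+\beta u_1^2\big),\\ u_2'&=-\tfrac1\alpha\big(\tfrac12(1+\gamma-\beta\sigma)u_1+(\sigma+1)u_2-\gamma u_3+u_1u_2\big),\\ u_3'&=\delta(u_1-u_3).\end{aligned}\tag{1}$$ Let $a_0=\frac\alpha2(3\beta\sigma+\gamma-1)+\frac1\alpha(\sigma+1)$, $b_0=(1-\beta)\sigma-2\beta\sigma^2-\gamma$, $c_0=\sigma(2\beta\sigma+\beta+\gamma-1)$, $$\delta_0=\frac{c_0+b_0-a_0^2+\sqrt{(c_0+b_0-a_0^2)^2+4a_0^2b_0}}{2a_0},$$ and assume $\delta_0>0$. Put $A=a_0+\delta_0$, $\rho=\sqrt{a_0\delta_0-b_0}$,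 $s=\delta_0^2+\rho^2$. Let $\beta_{11}(\delta)$ denote the eigenvalue with positive imaginary part of the linearization of (1) at $0$ (and $0$ if there is none; there is at most one). *The number $b$.* In $\mathbb R^3$ with the Euclidean inner product $(\cdot,\cdot)$ let $$\xi=\Big(1,-\tfrac{\gamma+3\beta\sigma-1}{2(\sigma-1)},\tfrac{\delta_0^2}{s}\Big),\quad \eta=\Big(0,\tfrac{\rho}{\alpha(\sigma-1)},\tfrac{\rho\delta_0}{s}\Big),\quad \zeta=\Big(1,\tfrac{A-\frac\alpha2(\gamma+3\beta\sigma-1)}{\alpha(\sigma-1)},-\tfrac{\delta_0}{a_0}\Big),$$ $$\xi^*=\Big(-\tfrac{\sigma+1}{\alpha^2(\sigma-1)},1,\tfrac{\gamma\delta_0}{\alpha s}\Big),\quad \eta^*=\Big(-\tfrac{\rho}{\alpha(\sigma-1)},0,-\tfrac{\gamma\rho}{\alpha s}\Big),\quad \zeta^*=\Big(\tfrac{A-\frac1\alpha(\sigma+1)}{\alpha(\sigma-1)},1,-\tfrac{\gamma}{\alpha a_0}\Big),$$ $G(u,v)=(-\alpha u_1v_2-\alpha\beta u_1v_1,\,-\frac1\alpha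 u_1v_2,\,0)$, $D_0=(\zeta,\zeta^*)$, $D_1=(G(\xi,\xi),\zeta^*)$, $D_2=(G(\xi,\eta),\zeta^*)$, $D^2=(\xi,\xi^*)^2+(\xi,\eta^*)^2$, $$F_1=\tfrac{D_1}{A}-\tfrac{2\rho^2D_1}{A(A^2+4\rho^2)}-\tfrac{\rho D_2}{A^2+4\rho^2},\quad F_2=\tfrac{D_2}{A}-\tfrac{4\rho^2D_2}{A(A^2+4\rho^2)}+\tfrac{2\rho D_1}{A^2+4\rho^2},\quad F_3=\tfrac{2\rho^2D_1}{A(A^2+4\rho^2)}+\tfrac{\rho D_2}{A^2+4\rho^2},$$ $p(v)=D^{-2}[(\xi,\xi^*)(v,\xi^*)+(\xi,\eta^*)(v,\eta^*)]$, $q(v)=D^{-2}[(\eta,\xi^*)(v,\xi^*)+(\eta,\eta^*)(v,\eta^*)]$, $K=G(\xi,\zeta)+G(\zeta,\xi)$, $$a_{20}=p(G(\xi,\xi)),\quad a_{11}=p(G(\xi,\eta)),\quad b_{20}=q(G(\xi,\xi)),\quad b_{11}=q(G(\xi,\eta)),$$ $$a_{30}=\tfrac{F_1p(K)}{D_0},\quad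 a_{12}=\tfrac{F_3p(K)+F_2p(G(\zeta,\eta))}{D_0},\quad b_{03}=\tfrac{F_3q(G(\zeta,\eta))}{D_0},\quad b_{21}=\tfrac{F_2q(K)+F_1q(G(\zeta,\eta))}{D_0},$$ $$b=\tfrac18\Big[3(a_{30}+b_{03})+(a_{12}+b_{21})-\tfrac2\rho a_{20}b_{20}+\tfrac1\rho(a_{11}a_{20}-b_{11}b_{20})\Big].$$ **Theorem.** At $\delta=\delta_0$ the system (1) undergoes a dynamic transition to periodic solutions: 1. $\rho>0$, $\beta_{11}(\delta_0)=i\rho$, $\beta_{11}$ is continuous at $\delta_0$, and for $\delta$ near $\delta_0$ the number $\beta_{11}(\delta)$ is an eigenvalue with positive imaginary part, with $\mathrm{Re}\,\beta_{11}(\delta)<0$ if $\delta>\delta_0$ and $\mathrm{Re}\,\beta_{11}(\delta)>0$ if $\delta<\delta_0$. 2. For $\delta>\delta_0$ the equilibrium $0$ is locally asymptotically stable. There is a neighbourhood $U$ of $0$, independent of $\delta$, such that for every $0<\delta<\delta_0$ the stable manifold $\Gamma_\delta$ of $0$ (the set of initial values of solutions tending to $0$) has codimension at least one (Hausdorff dimension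 at most $2$), and, for some $d(\delta)>0$, every solution with initial value in $U\setminus\Gamma_\delta$ exists for all $t\ge0$ and satisfies $\limsup_{t\to\infty}|u(t)|\ge d(\delta)$. 3. Periodic solutions bifurcate from $(u,\delta)=(0,\delta_0)$: for every $\varepsilon>0$ there are a $\delta$ with $|\delta-\delta_0|<\varepsilon$ and a nonconstant periodic solution of (1) with $\sup_t|u(t)|<\varepsilon$ whose least period differs from $2\pi/\rho$ by less than $\varepsilon$. 4. If $b>0$, the system bifurcates from $0$ to an unstable periodic orbit on $\delta>\delta_0$; if $b<0$, it bifurcates from $0$ to an (orbitally asymptotically) stable periodic orbit on $\delta<\delta_0$. That is, for all $\delta$ on the indicated side and close to $\delta_0$ there is a nonconstant periodic solution $u_\delta$ with such an orbit and with least period $T_\delta$, and $\sup_t|u_\delta(t)|\to0$, $T_\delta\to2\pi/\rho$ as $\delta\to\delta_0$. Moreover $$u_\delta(t)=\big[-b^{-1}\,\mathrm{Re}\,\beta_{11}(\delta)\big]^{1/2}(\xi\cos\rho t+\eta\sin\rho t)+o\big(|\mathrm{Re}\,\beta_{11}(\delta)|^{1/2}\big)\qquad(\delta\to\delta_0),$$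 uniformly for $t$ in bounded intervals. -/

import Mathlib

open Set Filter Topology

noncomputable section

/-! ## Autonomous differential equations in a Euclidean space -/

namespace Flow3

/-- Concentration space `ℝ³` with the Euclidean norm. -/
abbrev E3 := EuclideanSpace ℝ (Fin 3)

/-- `u` solves `u' = f u` on `[0, ∞)` (with the one-sided derivative at `0`). -/
def IsForwardSolution (f : E3 → E3) (u : ℝ → E3) : Prop :=
  ∀ t, 0 ≤ t → HasDerivWithinAt u (f (u t)) (Ici 0) t

/-- Lyapunov stability of a set `S`: solutions starting close to `S` exist for all `t ≥ 0` and
stay close to `S`. For `S` the range of a periodic solution this is orbital stability. (The vector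
fields below are smooth, so the solution with given initial value is unique.) -/
def IsStable (f : E3 → E3) (S : Set E3) : Prop :=
  ∀ ε > 0, ∃ r > 0, ∀ φ : E3, Metric.infDist φ S < r →
    ∃ u, IsForwardSolution f u ∧ u 0 = φ ∧ ∀ t, 0 ≤ t → Metric.infDist (u t) S < ε

/-- Asymptotic stability of a set `S`: Lyapunov stable and locally attracting. -/
def IsAsymptoticallyStable (f : E3 → E3) (S : Set E3) : Prop :=
  IsStable f S ∧
    ∃ r > 0, ∀ φ : E3, Metric.infDist φ S < r →
      ∃ u, IsForwardSolution f u ∧ u 0 = φ ∧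
        Tendsto (fun t => Metric.infDist (u t) S) atTop (𝓝 0)

/-- `u : ℝ → ℝ³` is a periodic solution of `u' = f u` with least period `T > 0`; in particular
`u` is not constant. Its orbit is `Set.range u`. -/
def IsPeriodicSolution (f : E3 → E3) (T : ℝ) (u : ℝ → E3) : Prop :=
  (∀ t, HasDerivAt u (f (u t)) t) ∧ 0 < T ∧ Function.Periodic u T ∧
    ∀ S, 0 < S → S < T → ¬ Function.Periodic u S

/-- The stable manifold of the equilibrium `0`: initial values of the solutions that tend
to `0`. -/
def stableManifold (f : E3 → E3) : Set E3 :=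
  {φ | ∃ u, IsForwardSolution f u ∧ u 0 = φ ∧ Tendsto u atTop (𝓝 0)}

/-- The equilibrium `0` of `u' = f δ u`, `δ > 0`, undergoes a dynamic transition as the control
parameter decreases through `δc`. Above `δc` the state `0` is locally asymptotically stable. Below
`δc` its stable manifold `Γ` has codimension at least one, and, for a neighbourhood `U` of `0`
independent of `δ`, every solution starting in `U \ Γ` satisfies
`limsup ‖u t‖ ≥ d δ > 0` as `t → ∞`. -/
def HasDynamicTransition (f : ℝ → E3 → E3) (δc : ℝ) : Prop :=
  (∀ δ, δc < δ → IsAsymptoticallyStable (f δ) {0}) ∧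
  ∃ U ∈ 𝓝 (0 : E3), ∀ δ, 0 < δ → δ < δc →
    dimH (stableManifold (f δ)) + 1 ≤ 3 ∧
    ∃ d > 0, ∀ φ ∈ U \ stableManifold (f δ),
      ∃ u, IsForwardSolution (f δ) u ∧ u 0 = φ ∧ ∃ᶠ t in atTop, d ≤ ‖u t‖

/-- Periodic solutions of `u' = f δ u` bifurcate from `(u, δ) = (0, δc)`: there are arbitrarily
small periodic solutions at parameters arbitrarily close to `δc`, with periods close to
`2π/ω`. -/
def HasPeriodicBifurcation (f : ℝ → E3 → E3) (δc ω : ℝ) : Prop :=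
  ∀ ε > 0, ∃ δ, |δ - δc| < ε ∧ ∃ T u, IsPeriodicSolution (f δ) T u ∧
    |T - 2 * Real.pi / ω| < ε ∧ ∀ t, ‖u t‖ < ε

end Flow3

/-! ## The stirred Oregonator -/

namespace Oregonator

open Flow3

/-- The fixed parameters `α, β, γ` of the nondimensional Oregonator (`δ` is the control
parameter). -/
structure Params where
  α : ℝ
  β : ℝ
  γ : ℝ

namespace Params

variable (p : Params)

/-- The first (and third) component of the positive equilibrium
`U₁ = (σ, γσ/(1+σ), σ)`. -/
def σ : ℝ :=
  1 / (2 * p.β) * ((1 - p.γ - p.β) + √((1 - p.γ - p.β) ^ 2 + 4 * p.β * (1 + p.γ)))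

/-- The stirred Oregonator in the coordinates centred at `U₁`. -/
def field (δ : ℝ) (u : E3) : E3 :=
  !₂[-p.α * (1 / 2 * (p.γ + 3 * p.β * p.σ - 1) * u 0 + (p.σ - 1) * u 1
        + u 0 * u 1 + p.β * u 0 ^ 2),
     -(1 / p.α) * (1 / 2 * (1 + p.γ - p.β * p.σ) * u 0 + (p.σ + 1) * u 1 - p.γ * u 2
        + u 0 * u 1),
     δ * (u 0 - u 2)]

/-- The linearization of `field δ` at `0`. -/
def linMatrix (δ : ℝ) : Matrix (Fin 3) (Fin 3) ℝ :=
  !![-(p.α / 2) * (p.γ + 3 * p.β * p.σ - 1), -p.α * (p.σ - 1), 0;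
     -(1 / (2 * p.α)) * (1 + p.γ - p.β * p.σ), -(1 / p.α) * (p.σ + 1), p.γ / p.α;
     δ, 0, -δ]

/-- `z` is a (complex) eigenvalue of the linearization. -/
def IsEigenvalue (δ : ℝ) (z : ℂ) : Prop :=
  Module.End.HasEigenvalue (Matrix.toLin' ((p.linMatrix δ).map Complex.ofReal)) z

open Classical in
/-- The first complex eigenvalue `β₁₁(δ)`: the eigenvalue of the linearization in the open upper
half plane (a real `3 × 3` matrix has at most one), and `0` if there is none. The second one is
its complex conjugate. -/
def β₁₁ (δ : ℝ) : ℂ :=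
  if h : ∃ z : ℂ, 0 < z.im ∧ p.IsEigenvalue δ z then h.choose else 0

/-! ### The critical number -/

def aCoef : ℝ := p.α / 2 * (3 * p.β * p.σ + p.γ - 1) + 1 / p.α * (p.σ + 1)

def bCoef : ℝ := (1 - p.β) * p.σ - 2 * p.β * p.σ ^ 2 - p.γ

def cCoef : ℝ := p.σ * (2 * p.β * p.σ + p.β + p.γ - 1)

/-- The critical value of the control parameter. -/
def δ₀ : ℝ :=
  (p.cCoef + p.bCoef - p.aCoef ^ 2
    + √((p.cCoef + p.bCoef - p.aCoef ^ 2) ^ 2 + 4 * p.aCoef ^ 2 * p.bCoef)) / (2 * p.aCoef)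

/-- The coefficient `A` of `λ²` in the characteristic polynomial at `δ = δ₀`. -/
def A : ℝ := p.aCoef + p.δ₀

/-- The coefficient `B` of `λ` in the characteristic polynomial at `δ = δ₀`. -/
def B : ℝ := p.aCoef * p.δ₀ - p.bCoef

/-- The critical frequency: at `δ = δ₀` the eigenvalues are `iρ`, `-iρ` and `-A`. -/
def ρ : ℝ := √p.B

/-! ### Eigenvectors at `δ = δ₀`

With `M = linMatrix δ₀`: `M ξ = ρ η`, `M η = -ρ ξ`, `M ζ = -A ζ`, and
`Mᵀ ξs = -ρ ηs`, `Mᵀ ηs = ρ ξs`, `Mᵀ ζs = -A ζs`. -/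

def ξ : E3 :=
  !₂[1, -(p.γ + 3 * p.β * p.σ - 1) / (2 * (p.σ - 1)), p.δ₀ ^ 2 / (p.δ₀ ^ 2 + p.ρ ^ 2)]

def η : E3 :=
  !₂[0, p.ρ / (p.α * (p.σ - 1)), p.ρ * p.δ₀ / (p.δ₀ ^ 2 + p.ρ ^ 2)]

def ξs : E3 :=
  !₂[-(p.σ + 1) / (p.α ^ 2 * (p.σ - 1)), 1, p.γ * p.δ₀ / (p.α * (p.δ₀ ^ 2 + p.ρ ^ 2))]

def ηs : E3 :=
  !₂[-p.ρ / (p.α * (p.σ - 1)), 0, -(p.γ * p.ρ) / (p.α * (p.δ₀ ^ 2 + p.ρ ^ 2))]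

def ζ : E3 :=
  !₂[1, (p.A - p.α / 2 * (p.γ + 3 * p.β * p.σ - 1)) / (p.α * (p.σ - 1)), -p.δ₀ / p.aCoef]

def ζs : E3 :=
  !₂[(p.A - 1 / p.α * (p.σ + 1)) / (p.α * (p.σ - 1)), 1, -p.γ / (p.α * p.aCoef)]

/-! ### The transition number -/

/-- The bilinear map whose diagonal is the quadratic part of `field δ`. -/
def G (u v : E3) : E3 :=
  !₂[-p.α * u 0 * v 1 - p.α * p.β * u 0 * v 0, -(1 / p.α) * u 0 * v 1, 0]

def D₀ : ℝ := inner ℝ p.ζ p.ζs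

def D₁ : ℝ := inner ℝ (p.G p.ξ p.ξ) p.ζs

def D₂ : ℝ := inner ℝ (p.G p.ξ p.η) p.ζs

/-! On the center manifold at `δ = δ₀`,
`u = x ξ + y η + D₀⁻¹ (F₁ x² + F₂ x y + F₃ y²) ζ + o(x² + y²)`. -/

def F₁ : ℝ := p.D₁ / p.A - 2 * p.ρ ^ 2 * p.D₁ / (p.A * (p.A ^ 2 + 4 * p.ρ ^ 2))
  - p.ρ * p.D₂ / (p.A ^ 2 + 4 * p.ρ ^ 2)

def F₂ : ℝ := p.D₂ / p.A - 4 * p.ρ ^ 2 * p.D₂ / (p.A * (p.A ^ 2 + 4 * p.ρ ^ 2))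
  + 2 * p.ρ * p.D₁ / (p.A ^ 2 + 4 * p.ρ ^ 2)

def F₃ : ℝ := 2 * p.ρ ^ 2 * p.D₁ / (p.A * (p.A ^ 2 + 4 * p.ρ ^ 2))
  + p.ρ * p.D₂ / (p.A ^ 2 + 4 * p.ρ ^ 2)

def Dsq : ℝ := (inner ℝ p.ξ p.ξs : ℝ) ^ 2 + (inner ℝ p.ξ p.ηs : ℝ) ^ 2

/-- The `ξ`-coordinate of the spectral projection of `v` to `span {ξ, η}`. -/
def projX (v : E3) : ℝ :=
  1 / p.Dsq * (inner ℝ p.ξ p.ξs * inner ℝ v p.ξs + inner ℝ p.ξ p.ηs * inner ℝ v p.ηs)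

/-- The `η`-coordinate of the spectral projection of `v` to `span {ξ, η}`. -/
def projY (v : E3) : ℝ :=
  1 / p.Dsq * (inner ℝ p.η p.ξs * inner ℝ v p.ξs + inner ℝ p.η p.ηs * inner ℝ v p.ηs)

/-! Coefficients of the reduced equations
`x' = -ρ y + a₂₀ x² + a₁₁ x y + a₃₀ x³ + a₂₁ x² y + a₁₂ x y² + a₀₃ y³ + o(3)`,
`y' =  ρ x + b₂₀ x² + b₁₁ x y + b₃₀ x³ + b₂₁ x² y + b₁₂ x y² + b₀₃ y³ + o(3)`
(the `y²` terms vanish since `G η η = 0`). -/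

def a₂₀ : ℝ := p.projX (p.G p.ξ p.ξ)

def a₁₁ : ℝ := p.projX (p.G p.ξ p.η)

def b₂₀ : ℝ := p.projY (p.G p.ξ p.ξ)

def b₁₁ : ℝ := p.projY (p.G p.ξ p.η)

def a₃₀ : ℝ := 1 / p.D₀ * (p.F₁ * p.projX (p.G p.ξ p.ζ + p.G p.ζ p.ξ))

def a₁₂ : ℝ := 1 / p.D₀ *
  (p.F₃ * p.projX (p.G p.ξ p.ζ + p.G p.ζ p.ξ) + p.F₂ * p.projX (p.G p.ζ p.η))

def b₀₃ : ℝ := 1 / p.D₀ * (p.F₃ * p.projY (p.G p.ζ p.η))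

def b₂₁ : ℝ := 1 / p.D₀ *
  (p.F₂ * p.projY (p.G p.ξ p.ζ + p.G p.ζ p.ξ) + p.F₁ * p.projY (p.G p.ζ p.η))

/-- The first Lyapunov number of the reduced equations, not yet normalized. -/
def b₁ : ℝ :=
  3 * (p.a₃₀ + p.b₀₃) + (p.a₁₂ + p.b₂₁) - 2 / p.ρ * (p.a₂₀ * p.b₂₀)
    + 1 / p.ρ * (p.a₁₁ * p.a₂₀ - p.b₁₁ * p.b₂₀)

/-- The transition number `b`, normalized such that the amplitude equation of the reduced system
is `Re β₁₁(δ) + b a² + o(a²) = 0`. -/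
def b : ℝ := p.b₁ / 8

/-- `(T δ, u δ)` is a family of periodic solutions, with least periods `T δ`, that bifurcates from
`u = 0` as `δ → δ₀` along the one-sided filter `l` and has the leading-order form
`u δ t = (-b⁻¹ Re β₁₁(δ))^{1/2} (cos (ρ t) ξ + sin (ρ t) η) + o(|Re β₁₁(δ)|^{1/2})`,
uniformly for `t` in bounded intervals; moreover `T δ → 2π/ρ`. -/
def IsBifurcatingFamily (l : Filter ℝ) (T : ℝ → ℝ) (u : ℝ → ℝ → E3) : Prop :=
  (∀ᶠ δ in l, IsPeriodicSolution (p.field δ) (T δ) (u δ)) ∧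
  (∀ ε > 0, ∀ᶠ δ in l, ∀ t, ‖u δ t‖ < ε) ∧
  Tendsto T l (𝓝 (2 * Real.pi / p.ρ)) ∧
  ∀ R > 0, ∀ ε > 0, ∀ᶠ δ in l, ∀ t, |t| ≤ R →
    ‖u δ t - √(-(p.b)⁻¹ * (p.β₁₁ δ).re) •
        (Real.cos (p.ρ * t) • p.ξ + Real.sin (p.ρ * t) • p.η)‖
      ≤ ε * √|(p.β₁₁ δ).re|

end Params

end Oregonator

end

/-!
The linearization at the equilibrium has the characteristic polynomial
`z³ + (a₀ + δ) z² + (a₀ δ - b₀) z + c₀ δ`, and `δ₀` is the positive zero of its Routh–Hurwitz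
determinant. Positivity of `δ₀` forces `b₀ > 0` and `1 < σ < 1/β` (`bCoef_pos`, `one_lt_sigma`), so all
coefficients have the signs needed. Factoring the polynomial as `(z + l)(z² + s z + q)` over the reals
shows that `s` has the sign of `δ - δ₀`; since `l` depends differentiably on `δ`, a pair of complex
eigenvalues crosses the imaginary axis at `δ₀` with the nonzero speed `k` (`crossing`).

The same factorization gives, for every `δ ≠ δ₀`, an explicit quadratic form that decreases strictly
along the linearized flow (`exists_lyapunov`): the energy of the oscillator `x'' + s x' + q x`, with the
sign of `s`, plus a multiple of the square of the stable coordinate. If `δ > δ₀` it is positive definite,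
and Lyapunov's theorem applies. If `δ < δ₀` it is indefinite; as it also decreases along the difference
of two nonlinear solutions near `0`, it is nonnegative on differences of points of the local stable
manifold, which is therefore a Lipschitz graph over a plane (`dimH_stableManifold_le`). Solutions that
remain small converge to `0`, and an invariant box of concentrations, the same for all `δ`, provides
global solutions (`hasDynamicTransition`).

The Hopf bifurcation is obtained without a centre manifold theorem. In the eigenbasis `ξ, η, ζ` the
system is a quadratic normal form (`nf`, `field_comb`). The scaling `x = ε X`, `y = ε Y`, `z = ε² Z`,
`δ - δ₀ = ε² ν`, the coordinate `w = Z - h(X, Y)`, where `z = h(x, y)` approximates the centre manifold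
to second order, and polar coordinates in the plane of `X` and `Y`, with the angle as independent
variable, turn it into a `2π`-periodic system `r' = ε f`, `w' = -(A/ρ) w + ε g`. A near-identity change
of the squared radius, `V = r² + ε V₁`, removes the oscillating terms up to second order: `V` changes at
the rate `ε² (m + w q + ε v)`, where `m = (2/ρ) (b r⁴ + k ν r²)` with exactly the `b` of the theorem
(`expansion`, `exists_polarSystem`, `nf_b`). Everything else is proved for such `PolarSystem`s, by
elementary estimates that are uniform in `ε`.

* Existence (`exists_isPeriodicOrbit`). Over one period `w` is contracted, so it has a unique fixed
  point for given `r` and `ν`. The increment of `V` is then `2π ε² m` up to `O(ε³)`, and along a path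
  of initial data on which `m` changes sign it vanishes somewhere, by the intermediate value theorem.
  Moving `ν` at fixed `r = 1` gives periodic solutions whatever `b` is; moving `r` at the fixed value
  `ν = -b/k` gives one for every `δ` close to `δ₀` on the side where `b` and `δ - δ₀` have the same sign.
* Stability (`quadratic_rate_le`, `eventually_attracting`, `eventually_repelling`). For the differences
  `x` of `V` and `y` of `w` between a solution and the periodic orbit, and `s` the sign of `b`, the form
  `s x² - κ y²` with a suitable constant `κ` increases exponentially. Hence the orbit attracts if
  `b < 0` and repels if `b > 0`.

Solving `dθ/dt = Θ` recovers the time variable (`exists_time_change`); periods, amplitudes and the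
profile `ε (ξ cos ρt + η sin ρt)` follow, with `ε² ~ -b⁻¹ Re β₁₁(δ)`.
-/

open scoped NNReal

noncomputable section

/-! ### Ordinary differential equations -/

namespace ODEAux

variable {E : Type*} [NormedAddCommGroup E] [NormedSpace ℝ E]

/-- A bounded vector field that is globally Lipschitz in space has global solutions: the
Picard–Lindelöf theorem applies on every interval `[t₀ - n, t₀ + n]`. -/
theorem exists_global_solution [CompleteSpace E] {f : ℝ → E → E} {K : ℝ≥0} {M : ℝ}
    (hK : ∀ t, LipschitzWith K (f t)) (hc : ∀ x, Continuous fun t => f t x)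
    (hM : ∀ t x, ‖f t x‖ ≤ M) (t₀ : ℝ) (x₀ : E) :
    ∃ u : ℝ → E, u t₀ = x₀ ∧ ∀ t, HasDerivAt u (f t (u t)) t := by
  have hM0 : 0 ≤ M := (norm_nonneg _).trans (hM t₀ x₀)
  have hloc : ∀ n : ℕ, ∃ u : ℝ → E, u t₀ = x₀ ∧
      ∀ t ∈ Ioo (t₀ - (n + 1)) (t₀ + (n + 1)), HasDerivAt u (f t (u t)) t := by
    intro n
    have hn : (0 : ℝ) < n + 1 := by positivity
    have hmem : t₀ ∈ Icc (t₀ - ((n : ℝ) + 1)) (t₀ + ((n : ℝ) + 1)) := by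
      constructor <;> linarith
    have hPL : IsPicardLindelof f ⟨t₀, hmem⟩ x₀ (⟨M, hM0⟩ * ⟨(n : ℝ) + 1, hn.le⟩) 0 ⟨M, hM0⟩ K :=
      { lipschitzOnWith := fun t _ => (hK t).lipschitzOnWith
        continuousOn := fun x _ => (hc x).continuousOn
        norm_le := fun t _ x _ => hM t x
        mul_max_le := by
          simp only [add_sub_cancel_left, sub_sub_cancel, max_self, NNReal.coe_zero, sub_zero]
          exact le_rfl }
    obtain ⟨u, hu0, hu⟩ := hPL.exists_eq_forall_mem_Icc_hasDerivWithinAt₀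
    exact ⟨u, hu0, fun t ht => (hu t (Ioo_subset_Icc_self ht)).hasDerivAt (Icc_mem_nhds ht.1 ht.2)⟩
  choose v hv0 hv using hloc
  have huniq : ∀ m n : ℕ, m ≤ n → EqOn (v m) (v n) (Ioo (t₀ - (m + 1)) (t₀ + (m + 1))) := by
    intro m n hmn
    have hmn' : (m : ℝ) ≤ n := by exact_mod_cast hmn
    refine ODE_solution_unique_of_mem_Ioo (v := f) (s := fun _ => univ)
      (fun t _ => (hK t).lipschitzOnWith) (t₀ := t₀) ⟨by linarith, by linarith⟩
      (fun t ht => ⟨hv m t ht, trivial⟩)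
      (fun t ht => ⟨hv n t ⟨by linarith [ht.1], by linarith [ht.2]⟩, trivial⟩)
      (by rw [hv0, hv0])
  refine ⟨fun t => v ⌈|t - t₀|⌉₊ t, by simp [hv0], fun t => ?_⟩
  set N := ⌈|t - t₀|⌉₊ + 1 with hN
  have hmemN : ∀ s, |s - t₀| < ⌈|s - t₀|⌉₊ + 1 := fun s =>
    (Nat.le_ceil _).trans_lt (lt_add_one _)
  have hev : ∀ᶠ s in 𝓝 t, (fun t => v ⌈|t - t₀|⌉₊ t) s = v N s := by
    have hlt : |t - t₀| < N := by
      rw [hN]; push_cast; exact hmemN t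
    have : ∀ᶠ s in 𝓝 t, |s - t₀| < N :=
      (continuous_abs.comp (continuous_id.sub continuous_const)).continuousAt.eventually
        (gt_mem_nhds hlt)
    filter_upwards [this] with s hs
    have h1 : ⌈|s - t₀|⌉₊ ≤ N := Nat.ceil_le.2 hs.le
    have h2 := abs_lt.1 (hmemN s)
    exact huniq _ _ h1 ⟨by linarith [h2.1], by linarith [h2.2]⟩
  have h3 := abs_lt.1 (hmemN t)
  have h4 : HasDerivAt (v N) (f t (v N t)) t := by
    refine hv N t ⟨?_, ?_⟩ <;> rw [hN] <;> push_cast <;> linarith [h3.1, h3.2]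
  have := h4.congr_of_eventuallyEq hev
  rwa [← hev.self_of_nhds] at this

/-- First-exit argument: a continuous function cannot cross a level on `[a, ∞)` if it lies strictly
below the level as soon as it has not exceeded it in the past. -/
theorem lt_of_forall_le_imp_lt {h : ℝ → ℝ} {a c : ℝ} (hc : ContinuousOn h (Ici a))
    (H : ∀ T, a ≤ T → (∀ t ∈ Ico a T, h t < c) → h T < c) : ∀ t, a ≤ t → h t < c := by
  by_contra! hcon
  obtain ⟨t₁, ht₁, hct₁⟩ := hcon
  set S := Ici a ∩ h ⁻¹' Ici c
  have hS : IsClosed S := hc.preimage_isClosed_of_isClosed isClosed_Ici isClosed_Ici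
  have hne : S.Nonempty := ⟨t₁, ht₁, hct₁⟩
  have hbdd : BddBelow S := ⟨a, fun t ht => ht.1⟩
  have hmem := hS.csInf_mem hne hbdd
  refine absurd (H (sInf S) hmem.1 fun t ht => ?_) (not_lt.2 hmem.2)
  by_contra hge
  exact absurd (csInf_le hbdd (⟨ht.1, not_lt.1 hge⟩ : t ∈ S)) (not_le.2 ht.2)

/-- If `h` does not increase where it exceeds `c`, it never exceeds `c`. -/
theorem le_of_deriv_nonpos_of_lt {h h' : ℝ → ℝ} {a c : ℝ}
    (hd : ∀ t, a ≤ t → HasDerivWithinAt h (h' t) (Ici a) t) (ha : h a ≤ c)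
    (H : ∀ t, a ≤ t → c < h t → h' t ≤ 0) : ∀ t, a ≤ t → h t ≤ c := by
  intro t₁ ht₁
  by_contra! hlt
  have hcont : ContinuousOn h (Ici a) := fun t ht => (hd t ht).continuousWithinAt
  set S := Icc a t₁ ∩ h ⁻¹' Iic c
  have hS : IsClosed S :=
    (hcont.mono Icc_subset_Ici_self).preimage_isClosed_of_isClosed isClosed_Icc isClosed_Iic
  have hne : S.Nonempty := ⟨a, ⟨le_rfl, ht₁⟩, ha⟩
  have hbdd : BddAbove S := ⟨t₁, fun t ht => ht.1.2⟩
  obtain ⟨⟨has, hst⟩, hcs⟩ := hS.csSup_mem hne hbdd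
  set s := sSup S
  have hlt' : s < t₁ := lt_of_le_of_ne hst fun h => by rw [h] at hcs; exact absurd hcs (not_le.2 hlt)
  have habove : ∀ t ∈ Ioo s t₁, c < h t := fun t ht => by
    by_contra hge
    exact absurd (le_csSup hbdd (⟨⟨has.trans ht.1.le, ht.2.le⟩, not_lt.1 hge⟩ : t ∈ S))
      (not_le.2 ht.1)
  have hanti : AntitoneOn h (Icc s t₁) := by
    refine antitoneOn_of_hasDerivWithinAt_nonpos (f' := h') (convex_Icc s t₁)
      (hcont.mono fun t ht => has.trans ht.1) ?_ ?_
    · intro t ht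
      rw [interior_Icc] at ht
      exact (hd t (has.trans ht.1.le)).mono (by
        rw [interior_Icc]; exact fun x hx => has.trans hx.1.le)
    · intro t ht
      rw [interior_Icc] at ht
      exact H t (has.trans ht.1.le) (habove t ht)
  have := hanti (left_mem_Icc.2 hlt'.le) (right_mem_Icc.2 hlt'.le) hlt'.le
  exact absurd (this.trans hcs) (not_le.2 hlt)

/-- Grönwall's inequality for a scalar function on a half line. -/
theorem le_mul_exp_of_deriv_le {h h' : ℝ → ℝ} {a b K : ℝ}
    (hd : ∀ t ∈ Icc a b, HasDerivWithinAt h (h' t) (Icc a b) t)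
    (H : ∀ t ∈ Icc a b, h' t ≤ K * h t) : ∀ t ∈ Icc a b, h t ≤ h a * Real.exp (K * (t - a)) := by
  have hg : ∀ t ∈ Icc a b, HasDerivWithinAt (fun t => h t * Real.exp (-K * (t - a)))
      (h' t * Real.exp (-K * (t - a)) + h t * (Real.exp (-K * (t - a)) * (-K))) (Icc a b) t := by
    intro t ht
    have h1 : HasDerivAt (fun t => Real.exp (-K * (t - a))) (Real.exp (-K * (t - a)) * (-K)) t := by
      have := (((hasDerivAt_id t).sub_const a).const_mul (-K)).exp
      simpa using this
    exact (hd t ht).mul h1.hasDerivWithinAt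
  have hanti : AntitoneOn (fun t => h t * Real.exp (-K * (t - a))) (Icc a b) := by
    refine antitoneOn_of_hasDerivWithinAt_nonpos (convex_Icc a b)
      (fun t ht => (hg t ht).continuousWithinAt)
      (fun t ht => (hg t (interior_subset ht)).mono interior_subset) fun t ht => ?_
    have := H t (interior_subset ht)
    have he := Real.exp_pos (-K * (t - a))
    nlinarith
  intro t ht
  have h1 := hanti (left_mem_Icc.2 (ht.1.trans ht.2)) ht ht.1
  simp only [sub_self, mul_zero, Real.exp_zero, mul_one] at h1
  have h2 : Real.exp (-K * (t - a)) * Real.exp (K * (t - a)) = 1 := by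
    rw [← Real.exp_add]; simp
  calc h t = h t * Real.exp (-K * (t - a)) * Real.exp (K * (t - a)) := by rw [mul_assoc, h2, mul_one]
    _ ≤ h a * Real.exp (K * (t - a)) := by gcongr

/-- The reverse of Grönwall's inequality. -/
theorem mul_exp_le_of_le_deriv {h h' : ℝ → ℝ} {a b K : ℝ}
    (hd : ∀ t ∈ Icc a b, HasDerivWithinAt h (h' t) (Icc a b) t)
    (H : ∀ t ∈ Icc a b, K * h t ≤ h' t) : ∀ t ∈ Icc a b, h a * Real.exp (K * (t - a)) ≤ h t := by
  intro t ht
  have := le_mul_exp_of_deriv_le (h := fun t => -h t) (h' := fun t => -h' t) (K := K)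
    (fun t ht => (hd t ht).neg) (fun t ht => by linarith [H t ht]) t ht
  linarith

end ODEAux

namespace Flow3

/-- Clamping each coordinate to an interval. -/
def clampBox (lo hi : E3) (x : E3) : E3 :=
  WithLp.toLp 2 fun i => max (lo i) (min (x i) (hi i))

theorem clampBox_eq_self {lo hi x : E3} (h : ∀ i, lo i ≤ x i ∧ x i ≤ hi i) :
    clampBox lo hi x = x := by
  ext i
  simp [clampBox, (h i).1, (h i).2]

theorem clampBox_mem {lo hi : E3} (hle : ∀ i, lo i ≤ hi i) (x : E3) (i : Fin 3) :
    lo i ≤ clampBox lo hi x i ∧ clampBox lo hi x i ≤ hi i := by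
  simp [clampBox, hle i]

theorem lipschitzWith_clampBox (lo hi : E3) : LipschitzWith 1 (clampBox lo hi) := by
  refine LipschitzWith.of_dist_le_mul fun x y => ?_
  rw [NNReal.coe_one, one_mul, EuclideanSpace.dist_eq, EuclideanSpace.dist_eq]
  refine Real.sqrt_le_sqrt (Finset.sum_le_sum fun i _ => ?_)
  refine pow_le_pow_left₀ dist_nonneg ?_ 2
  have h1 : LipschitzWith 1 fun z : ℝ => max (lo i) (min z (hi i)) :=
    (LipschitzWith.id.min_const _).const_max _
  have h2 := h1.dist_le_mul (x i) (y i)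
  rw [NNReal.coe_one, one_mul] at h2
  exact h2

/-- A smooth vector field agrees on a compact box with a bounded vector field that is globally
Lipschitz, namely its composition with the clamping map. The latter has global solutions. -/
theorem exists_solution_clampBox {f : E3 → E3} (hf : ContDiff ℝ 1 f) {lo hi : E3}
    (hle : ∀ i, lo i ≤ hi i) (φ : E3) :
    ∃ u : ℝ → E3, u 0 = φ ∧ ∀ t, HasDerivAt u (f (clampBox lo hi (u t))) t := by
  set B : Set E3 := {x | ∀ i, lo i ≤ x i ∧ x i ≤ hi i} with hB
  have hBeq : B = (EuclideanSpace.equiv (Fin 3) ℝ) ⁻¹' Icc (fun i => lo i) (fun i => hi i) := by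
    ext x
    simp [hB, Pi.le_def, forall_and]
  have hBcpt : IsCompact B := by
    rw [hBeq]
    exact (EuclideanSpace.equiv (Fin 3) ℝ).toHomeomorph.isCompact_preimage.2 isCompact_Icc
  have hBconv : Convex ℝ B := by
    rw [hBeq]
    exact (convex_Icc _ _).linear_preimage (EuclideanSpace.equiv (Fin 3) ℝ).toLinearMap
  obtain ⟨K, hK⟩ := hf.contDiffOn.exists_lipschitzOnWith one_ne_zero hBconv hBcpt
  obtain ⟨M, hM⟩ := hBcpt.exists_bound_of_continuousOn hf.continuous.continuousOn
  have hmaps : ∀ x, clampBox lo hi x ∈ B := fun x i => clampBox_mem hle x i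
  have hLip : LipschitzWith (K * 1) fun x => f (clampBox lo hi x) := by
    rw [← lipschitzOnWith_univ]
    exact hK.comp (lipschitzWith_clampBox lo hi).lipschitzOnWith fun x _ => hmaps x
  exact ODEAux.exists_global_solution (f := fun _ x => f (clampBox lo hi x)) (fun _ => hLip)
    (fun _ => continuous_const) (fun _ x => hM _ (hmaps x)) 0 φ

theorem _root_.ContDiff.exists_lipschitzOnWith_closedBall {f : E3 → E3} (hf : ContDiff ℝ 1 f)
    (R : ℝ) : ∃ K, LipschitzOnWith K f (Metric.closedBall 0 R) :=
  hf.contDiffOn.exists_lipschitzOnWith one_ne_zero (convex_closedBall _ _)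
    (isCompact_closedBall _ _)

theorem IsForwardSolution.continuousOn {f : E3 → E3} {u : ℝ → E3} (hu : IsForwardSolution f u) :
    ContinuousOn u (Ici 0) := fun t ht => (hu t ht).continuousWithinAt

/-- A solution on `ℝ` is a forward solution. -/
theorem isForwardSolution_of_hasDerivAt {f : E3 → E3} {u : ℝ → E3}
    (hu : ∀ t, 0 ≤ t → HasDerivAt u (f (u t)) t) : IsForwardSolution f u :=
  fun t ht => (hu t ht).hasDerivWithinAt

theorem IsForwardSolution.exists_bound {f : E3 → E3} {u : ℝ → E3} (hu : IsForwardSolution f u)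
    (T : ℝ) : ∃ R, ∀ t ∈ Icc 0 T, ‖u t‖ ≤ R :=
  isCompact_Icc.exists_bound_of_continuousOn (hu.continuousOn.mono Icc_subset_Ici_self)

theorem eqOn_Icc_of_isSolution {f : E3 → E3} (hf : ContDiff ℝ 1 f) {u v : ℝ → E3} {T : ℝ}
    (hu : ∀ t ∈ Icc 0 T, HasDerivWithinAt u (f (u t)) (Ici 0) t)
    (hv : ∀ t ∈ Icc 0 T, HasDerivWithinAt v (f (v t)) (Ici 0) t) (h0 : u 0 = v 0) :
    EqOn u v (Icc 0 T) := by
  have hcu : ContinuousOn u (Icc 0 T) := fun t ht =>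
    ((hu t ht).mono Icc_subset_Ici_self).continuousWithinAt
  have hcv : ContinuousOn v (Icc 0 T) := fun t ht =>
    ((hv t ht).mono Icc_subset_Ici_self).continuousWithinAt
  obtain ⟨R₁, hR₁⟩ := isCompact_Icc.exists_bound_of_continuousOn hcu
  obtain ⟨R₂, hR₂⟩ := isCompact_Icc.exists_bound_of_continuousOn hcv
  obtain ⟨K, hK⟩ := hf.exists_lipschitzOnWith_closedBall (max R₁ R₂)
  refine ODE_solution_unique_of_mem_Icc_right (v := fun _ => f)
    (s := fun _ => Metric.closedBall 0 (max R₁ R₂)) (fun _ _ => hK) hcu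
    (fun t ht => (hu t (Ico_subset_Icc_self ht)).mono (Ici_subset_Ici.2 ht.1)) ?_ hcv
    (fun t ht => (hv t (Ico_subset_Icc_self ht)).mono (Ici_subset_Ici.2 ht.1)) ?_ h0
  · intro t ht
    simpa using Or.inl (hR₁ t (Ico_subset_Icc_self ht))
  · intro t ht
    simpa using Or.inr (hR₂ t (Ico_subset_Icc_self ht))

end Flow3


/-! ### Algebra of the Oregonator parameters -/

namespace Oregonator

open Flow3

namespace Params

variable (p : Params)

/-- The sign conditions on the parameters of the Oregonator under which the theorem is stated. -/
structure Admissible : Prop where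
  α_pos : 0 < p.α
  β_pos : 0 < p.β
  γ_pos : 0 < p.γ
  δ₀_pos : 0 < p.δ₀

/-- The first diagonal entry of the linearization is `-e`. -/
def e : ℝ := p.α / 2 * (p.γ + 3 * p.β * p.σ - 1)

/-- The second diagonal entry of the linearization is `-g`. -/
def g : ℝ := (p.σ + 1) / p.α

/-- The coupling coefficient `α (σ - 1)` of the first equation. -/
def κ : ℝ := p.α * (p.σ - 1)

/-- The common denominator `δ₀² + ρ²` of the eigenvectors. -/
def s : ℝ := p.δ₀ ^ 2 + p.ρ ^ 2

variable {p}

namespace Admissible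

variable (h : p.Admissible)
include h

theorem sigma_eq : p.β * p.σ ^ 2 + (p.γ + p.β - 1) * p.σ = 1 + p.γ := by
  have hβ := h.β_pos
  have hγ := h.γ_pos
  have h0 : 0 ≤ (1 - p.γ - p.β) ^ 2 + 4 * p.β * (1 + p.γ) := by positivity
  have h1 := Real.sq_sqrt h0
  rw [σ]
  set q := √((1 - p.γ - p.β) ^ 2 + 4 * p.β * (1 + p.γ))
  field_simp
  linear_combination h1

theorem sigma_pos : 0 < p.σ := by
  have hβ := h.β_pos
  have hγ := h.γ_pos
  rw [σ]
  have : |1 - p.γ - p.β| < √((1 - p.γ - p.β) ^ 2 + 4 * p.β * (1 + p.γ)) := by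
    rw [← Real.sqrt_sq_eq_abs]
    exact Real.sqrt_lt_sqrt (sq_nonneg _) (by have : 0 < 4 * p.β * (1 + p.γ) := by positivity
                                              linarith)
  have := (abs_lt.1 this).1
  have h2 : 0 < 1 - p.γ - p.β + √((1 - p.γ - p.β) ^ 2 + 4 * p.β * (1 + p.γ)) := by linarith
  positivity

theorem gamma_mul : p.γ * (p.σ - 1) = (1 + p.σ) * (1 - p.β * p.σ) := by
  linear_combination h.sigma_eq

omit h in
theorem aCoef_eq : p.aCoef = p.e + p.g := by
  rw [aCoef, e, g]; ring

omit h in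
theorem cCoef_add_bCoef : p.cCoef + p.bCoef = p.γ * (p.σ - 1) := by
  rw [cCoef, bCoef]; ring

theorem e_pos : 0 < p.e := by
  have hα := h.α_pos
  have hβ := h.β_pos
  have hγ := h.γ_pos
  have hσ := h.sigma_pos
  have hm : 0 < p.β * p.σ := by positivity
  have h1 := h.gamma_mul
  have : 0 < p.γ + 3 * p.β * p.σ - 1 := by
    rcases lt_or_ge 1 p.σ with h2 | h2
    · nlinarith
    · have h3 : 1 ≤ p.β * p.σ := by
        by_contra! h3
        nlinarith
      linarith
  rw [e]; positivity

theorem g_pos : 0 < p.g := by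
  have hα := h.α_pos
  have hσ := h.sigma_pos
  rw [g]; positivity

theorem aCoef_pos : 0 < p.aCoef := by
  rw [aCoef_eq]; exact add_pos h.e_pos h.g_pos

theorem e_mul_g : p.e * p.g = (p.γ + 3 * p.β * p.σ - 1) * (p.σ + 1) / 2 := by
  have := h.α_pos.ne'
  rw [e, g]; field_simp

/-- The control parameter has a positive critical value only if `b₀ > 0`: if `b₀ ≤ 0`, then `δ₀ > 0`
requires `a₀² < c₀ + b₀ = γ (σ - 1)`, which forces `σ > 5` and `5 β σ < 1`, whence `b₀ > 0`. -/
theorem bCoef_pos : 0 < p.bCoef := by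
  by_contra! hb
  have ha := h.aCoef_pos
  have hγ := h.γ_pos
  have hσ := h.sigma_pos
  have hδ := h.δ₀_pos
  have hm : 0 < p.β * p.σ := mul_pos h.β_pos hσ
  have hN : 0 < p.cCoef + p.bCoef - p.aCoef ^ 2 := by
    by_contra! hN
    have h1 : √((p.cCoef + p.bCoef - p.aCoef ^ 2) ^ 2 + 4 * p.aCoef ^ 2 * p.bCoef)
        ≤ |p.cCoef + p.bCoef - p.aCoef ^ 2| := by
      rw [← Real.sqrt_sq_eq_abs]
      refine Real.sqrt_le_sqrt ?_
      have : p.aCoef ^ 2 * p.bCoef ≤ 0 := mul_nonpos_of_nonneg_of_nonpos (sq_nonneg _) hb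
      linarith
    rw [abs_of_nonpos hN] at h1
    have : p.δ₀ ≤ 0 := by
      rw [δ₀]
      exact div_nonpos_of_nonpos_of_nonneg (by linarith) (by positivity)
    linarith
  have h1 := h.gamma_mul
  rw [cCoef_add_bCoef] at hN
  have hbe : p.bCoef = p.σ - p.β * p.σ - 2 * (p.β * p.σ) * p.σ - p.γ := by rw [bCoef]; ring
  have hae : 2 * ((p.γ + 3 * (p.β * p.σ) - 1) * (p.σ + 1)) ≤ p.aCoef ^ 2 := by
    have := h.e_mul_g
    rw [aCoef_eq]
    nlinarith [sq_nonneg (p.e - p.g)]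
  rw [hbe] at hb
  generalize p.β * p.σ = m at *
  have hσ1 : 1 < p.σ := by
    by_contra! h2
    nlinarith [sq_nonneg p.aCoef]
  -- divide `4 e g ≤ a₀² < γ (σ - 1) = (1 + σ) (1 - m)`, where `m = β σ`, by `1 + σ`
  have h2 : 2 * (p.γ + 3 * m - 1) < 1 - m := by nlinarith
  have h3 : 1 - m < p.γ := by nlinarith
  have h4 : 5 - 9 * m < p.σ * (1 - 5 * m) := by nlinarith
  have h5 : 5 < p.σ := by nlinarith
  nlinarith

theorem one_lt_sigma : 1 < p.σ := by
  by_contra! h2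
  have hb := h.bCoef_pos
  have hγ := h.γ_pos
  have hσ := h.sigma_pos
  have h1 := h.gamma_mul
  have hbe : p.bCoef = p.σ - p.β * p.σ - 2 * (p.β * p.σ) * p.σ - p.γ := by rw [bCoef]; ring
  have h3 : 1 ≤ p.β * p.σ := by
    by_contra! h3
    nlinarith
  nlinarith

theorem beta_sigma_lt : p.β * p.σ < 1 := by
  have h1 := h.gamma_mul
  have hσ := h.one_lt_sigma
  have := mul_pos h.γ_pos (sub_pos.2 hσ)
  by_contra! h3
  nlinarith

theorem κ_pos : 0 < p.κ := mul_pos h.α_pos (sub_pos.2 h.one_lt_sigma)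

theorem cCoef_pos : 0 < p.cCoef := by
  have h1 := h.gamma_mul
  have hσ := h.one_lt_sigma
  have hβ := h.β_pos
  have hm : 0 < p.β * p.σ := mul_pos hβ h.sigma_pos
  have h2 := h.beta_sigma_lt
  have h3 : 1 - p.β * p.σ < p.γ := by nlinarith
  rw [cCoef]
  exact mul_pos h.sigma_pos (by linarith)

/-- `δ₀` is a zero of the Routh–Hurwitz determinant `(a₀ + δ)(a₀ δ - b₀) - c₀ δ`. -/
theorem A_mul_B : p.A * p.B = p.cCoef * p.δ₀ := by
  have ha := h.aCoef_pos
  have h0 : 0 ≤ (p.cCoef + p.bCoef - p.aCoef ^ 2) ^ 2 + 4 * p.aCoef ^ 2 * p.bCoef := by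
    have := h.bCoef_pos
    positivity
  have h1 := Real.sq_sqrt h0
  have hd : 2 * p.aCoef * p.δ₀ = p.cCoef + p.bCoef - p.aCoef ^ 2
      + √((p.cCoef + p.bCoef - p.aCoef ^ 2) ^ 2 + 4 * p.aCoef ^ 2 * p.bCoef) := by
    rw [δ₀]; field_simp
  rw [← sub_eq_iff_eq_add'] at hd
  rw [← hd] at h1
  have : 4 * p.aCoef * (p.A * p.B - p.cCoef * p.δ₀) = 0 := by
    rw [A, B]
    linear_combination h1
  have h4 : 4 * p.aCoef ≠ 0 := by positivity
  linarith [(mul_eq_zero.1 this).resolve_left h4]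

theorem A_pos : 0 < p.A := add_pos h.aCoef_pos h.δ₀_pos

theorem B_pos : 0 < p.B := by
  have h1 : 0 < p.A * p.B := h.A_mul_B ▸ mul_pos h.cCoef_pos h.δ₀_pos
  exact (mul_pos_iff_of_pos_left h.A_pos).1 h1

theorem ρ_pos : 0 < p.ρ := Real.sqrt_pos.2 h.B_pos

theorem ρ_sq : p.ρ ^ 2 = p.aCoef * p.δ₀ - p.bCoef := Real.sq_sqrt h.B_pos.le

theorem s_pos : 0 < p.s := by
  have := h.δ₀_pos
  have := h.ρ_pos
  rw [s]; positivity

theorem bc_mul : p.γ * (p.σ - 1) * p.δ₀ = p.aCoef * p.s := by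
  have h1 := h.A_mul_B
  have h2 := h.ρ_sq
  have h3 : p.ρ ^ 2 = p.B := h2
  rw [← h3, A] at h1
  rw [← cCoef_add_bCoef, s]
  linear_combination (-1) * h1 + p.δ₀ * h2

theorem gamma_div : p.γ / p.α = p.aCoef * p.s / (p.δ₀ * p.κ) := by
  have h1 := h.bc_mul
  have h2 := h.α_pos
  have h3 := h.δ₀_pos
  have h4 := h.κ_pos
  rw [div_eq_div_iff (by positivity) (by positivity), κ]
  linear_combination p.α * h1

theorem cCoef_eq : p.cCoef * p.δ₀ = (p.e + p.g + p.δ₀) * p.ρ ^ 2 := by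
  have h3 : p.ρ ^ 2 = p.B := h.ρ_sq
  rw [h3, ← h.A_mul_B, A, aCoef_eq]

theorem bCoef_eq : p.bCoef = (p.e + p.g) * p.δ₀ - p.ρ ^ 2 := by
  have h3 := h.ρ_sq
  rw [aCoef_eq] at h3
  linarith

theorem coupling : 1 / (2 * p.α) * (1 + p.γ - p.β * p.σ) = (p.e * p.g + p.bCoef) / p.κ := by
  have h1 := h.α_pos
  have h4 : p.σ - 1 ≠ 0 := (sub_pos.2 h.one_lt_sigma).ne'
  rw [h.e_mul_g, bCoef, κ]
  field_simp
  ring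

theorem ξ_eq : p.ξ = !₂[1, -p.e / p.κ, p.δ₀ ^ 2 / p.s] := by
  have h1 := h.α_pos.ne'
  have h4 : p.σ - 1 ≠ 0 := (sub_pos.2 h.one_lt_sigma).ne'
  ext i
  fin_cases i <;> simp [ξ, s, e, κ]
  field_simp
  ring

omit h in
theorem η_eq : p.η = !₂[0, p.ρ / p.κ, p.ρ * p.δ₀ / p.s] := rfl

omit h in
theorem ζ_eq : p.ζ = !₂[1, (p.g + p.δ₀) / p.κ, -p.δ₀ / (p.e + p.g)] := by
  have h1 : p.A - p.α / 2 * (p.γ + 3 * p.β * p.σ - 1) = p.g + p.δ₀ := by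
    rw [A, aCoef, g]; ring
  rw [ζ, h1, aCoef_eq, κ]

theorem ξs_eq : p.ξs = !₂[-p.g / p.κ, 1, (p.e + p.g) / p.κ] := by
  have h1 := h.α_pos.ne'
  have h4 : p.σ - 1 ≠ 0 := (sub_pos.2 h.one_lt_sigma).ne'
  have h5 : p.γ * p.δ₀ / (p.α * (p.δ₀ ^ 2 + p.ρ ^ 2)) = (p.e + p.g) / p.κ := by
    have := h.bc_mul
    have hs := h.s_pos.ne'
    rw [← aCoef_eq, κ]
    rw [s] at this hs
    field_simp
    linear_combination this
  rw [ξs, h5]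
  ext i
  fin_cases i <;> simp [g, κ]
  field_simp
  ring

theorem ηs_eq : p.ηs = !₂[-p.ρ / p.κ, 0, -(p.ρ * (p.e + p.g)) / (p.δ₀ * p.κ)] := by
  have h1 := h.α_pos.ne'
  have h4 : p.σ - 1 ≠ 0 := (sub_pos.2 h.one_lt_sigma).ne'
  have h3 := h.δ₀_pos.ne'
  have h5 : -(p.γ * p.ρ) / (p.α * (p.δ₀ ^ 2 + p.ρ ^ 2)) = -(p.ρ * (p.e + p.g)) / (p.δ₀ * p.κ) := by
    have := h.bc_mul
    have hs := h.s_pos.ne'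
    rw [← aCoef_eq, κ]
    rw [s] at this hs
    field_simp
    linear_combination (-p.ρ) * this
  rw [ηs, h5, κ]

theorem ζs_eq : p.ζs = !₂[(p.e + p.δ₀) / p.κ, 1, -p.s / (p.δ₀ * p.κ)] := by
  have h1 : p.A - 1 / p.α * (p.σ + 1) = p.e + p.δ₀ := by
    rw [A, aCoef, e]; ring
  have h2 := h.α_pos.ne'
  have h4 : p.σ - 1 ≠ 0 := (sub_pos.2 h.one_lt_sigma).ne'
  have h3 := h.δ₀_pos.ne'
  have ha := h.aCoef_pos.ne'
  have h5 : -p.γ / (p.α * p.aCoef) = -p.s / (p.δ₀ * p.κ) := by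
    have := h.bc_mul
    rw [κ]
    field_simp
    linear_combination -this
  rw [ζs, h1, h5, κ]

end Admissible

/-! ### The characteristic polynomial -/

variable (p) in
/-- The linearization of `field δ` at `0`, as a vector field. -/
def lin (δ : ℝ) (u : E3) : E3 :=
  !₂[-p.e * u 0 - p.κ * u 1,
     -((p.e * p.g + p.bCoef) / p.κ) * u 0 - p.g * u 1 + p.γ / p.α * u 2,
     δ * (u 0 - u 2)]

theorem Admissible.field_eq (h : p.Admissible) (δ : ℝ) (u : E3) :
    p.field δ u = p.lin δ u + p.G u u := by
  have h1 := h.coupling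
  have h2 := h.α_pos.ne'
  ext i
  fin_cases i
  · simp [field, lin, G, e, κ]; ring
  · rw [lin, ← h1]
    simp [field, G, g]
    ring
  · simp [field, lin, G]

theorem Admissible.isEigenvalue_iff (h : p.Admissible) (δ : ℝ) (z : ℂ) :
    p.IsEigenvalue δ z ↔
      z ^ 3 + (p.aCoef + δ) * z ^ 2 + (p.aCoef * δ - p.bCoef) * z + p.cCoef * δ = 0 := by
  have h1 : p.α / 2 * (p.γ + 3 * p.β * p.σ - 1) = p.e := rfl
  have h2 : 1 / p.α * (p.σ + 1) = p.g := by rw [g]; ring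
  have h3 := h.coupling
  have hκ : (p.κ : ℂ) ≠ 0 := by exact_mod_cast h.κ_pos.ne'
  have h4 : -p.α * (p.σ - 1) = - p.κ := by rw [κ]; ring
  have h5 : p.κ * (p.γ / p.α) = p.cCoef + p.bCoef := by
    have := h.α_pos.ne'
    rw [cCoef_add_bCoef, κ]; field_simp
  have h5' : (p.κ : ℂ) * ((p.γ / p.α : ℝ) : ℂ) = p.cCoef + p.bCoef := by exact_mod_cast h5
  rw [IsEigenvalue, Module.End.hasEigenvalue_iff_isRoot_charpoly, Matrix.charpoly_toLin',
    Polynomial.IsRoot, Matrix.eval_charpoly, Matrix.det_fin_three]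
  have hM : p.linMatrix δ = !![-p.e, -p.κ, 0;
      -((p.e * p.g + p.bCoef) / p.κ), -p.g, p.γ / p.α; δ, 0, -δ] := by
    rw [linMatrix, neg_mul (p.α / 2), h1, neg_mul (1 / (2 * p.α)), h3, neg_mul (1 / p.α), h2, h4]
  rw [hM, Admissible.aCoef_eq]
  generalize p.γ / p.α = m at *
  simp [Matrix.scalar_apply]
  constructor <;> intro H
  · field_simp at H
    linear_combination H - (δ : ℂ) * h5'
  · field_simp
    linear_combination H + (δ : ℂ) * h5'

end Params

end Oregonator


namespace Oregonator

open Flow3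

namespace Params

variable {p : Params}

/-! ### The eigenvalues near the critical parameter -/

variable (p) in
/-- A real factorization `(z + l) (z² + s z + q)` of the characteristic polynomial at `δ`, in which
`-l` is a negative root and the roots of the quadratic factor have a positive product, so that their
real parts have the sign of `-s`. -/
structure IsFactorization (δ l s q : ℝ) : Prop where
  l_pos : 0 < l
  q_pos : 0 < q
  coeff_two : l + s = p.aCoef + δ
  coeff_one : l * s + q = p.aCoef * δ - p.bCoef
  coeff_zero : l * q = p.cCoef * δ

namespace Admissible

variable (h : p.Admissible)
include h

theorem isFactorization_of_root {δ l : ℝ} (hδ : 0 < δ) (hl : 0 < l)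
    (hr : -l ^ 3 + (p.aCoef + δ) * l ^ 2 - (p.aCoef * δ - p.bCoef) * l + p.cCoef * δ = 0) :
    p.IsFactorization δ l (p.aCoef + δ - l) (p.cCoef * δ / l) where
  l_pos := hl
  q_pos := div_pos (mul_pos h.cCoef_pos hδ) hl
  coeff_two := by ring
  coeff_one := by
    field_simp
    linear_combination hr
  coeff_zero := by field_simp

theorem exists_isFactorization {δ : ℝ} (hδ : 0 < δ) : ∃ l s q, p.IsFactorization δ l s q := by
  set P : ℝ → ℝ := fun l => -l ^ 3 + (p.aCoef + δ) * l ^ 2 - (p.aCoef * δ - p.bCoef) * l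
    + p.cCoef * δ with hP
  have hc := h.cCoef_pos
  have hb := h.bCoef_pos
  have ha := h.aCoef_pos
  set R := p.aCoef + δ + p.bCoef + p.cCoef * δ + 1 with hR
  have hcδ : 0 < p.cCoef * δ := mul_pos hc hδ
  have hR1 : 1 ≤ R := by linarith
  have h0 : 0 ≤ P 0 := by simpa [hP] using hcδ.le
  have h1 : P R ≤ 0 := by
    have e1 : P R = R ^ 2 * (p.aCoef + δ - R) - p.aCoef * δ * R + p.bCoef * R + p.cCoef * δ := by
      simp only [hP]; ring
    have e2 : p.aCoef + δ - R = -(p.bCoef + p.cCoef * δ + 1) := by rw [hR]; ring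
    rw [e1, e2]
    have h2 : 0 ≤ p.aCoef * δ * R := by positivity
    nlinarith [mul_nonneg hb.le (mul_nonneg (by linarith : (0 : ℝ) ≤ R) (sub_nonneg.2 hR1)),
      mul_nonneg hcδ.le (by nlinarith : (0 : ℝ) ≤ R ^ 2 - 1)]
  obtain ⟨l, hl, hPl⟩ : (0 : ℝ) ∈ P '' Icc 0 R :=
    intermediate_value_Icc' (by linarith) (by fun_prop) ⟨h1, h0⟩
  have hl0 : 0 < l := lt_of_le_of_ne hl.1 fun h2 => by
    rw [← h2] at hPl
    simp [hP] at hPl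
    rcases hPl with h3 | h3 <;> linarith
  exact ⟨l, _, _, h.isFactorization_of_root hδ hl0 hPl⟩

/-- The sign of `s` is that of the Routh–Hurwitz determinant, which changes sign at `δ₀` only. -/
theorem mul_s_eq {δ l s q : ℝ} (hf : p.IsFactorization δ l s q) :
    s * (l * (p.aCoef + δ) + q) * p.δ₀ = p.aCoef * (δ - p.δ₀) * (δ * p.δ₀ + p.bCoef) := by
  have h1 := h.A_mul_B
  rw [A, B] at h1
  have h2 := hf.coeff_two
  have h3 := hf.coeff_one
  have h4 := hf.coeff_zero
  have h5 : s * (l * (p.aCoef + δ) + q)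
      = (p.aCoef + δ) * (p.aCoef * δ - p.bCoef) - p.cCoef * δ := by
    rw [← h2, ← h3, ← h4]; ring
  rw [h5]
  linear_combination δ * h1

theorem s_pos_of_lt {δ l s q : ℝ} (hf : p.IsFactorization δ l s q) (hδ : p.δ₀ < δ) : 0 < s := by
  have h1 := h.mul_s_eq hf
  have h0 := h.δ₀_pos
  have hb := h.bCoef_pos
  have ha := h.aCoef_pos
  have hl := hf.l_pos
  have hq := hf.q_pos
  have h2 : 0 < δ := h0.trans hδ
  have h3 : 0 < p.aCoef * (δ - p.δ₀) * (δ * p.δ₀ + p.bCoef) := by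
    have := sub_pos.2 hδ
    positivity
  rw [← h1] at h3
  have h4 : 0 < l * (p.aCoef + δ) + q := by positivity
  exact pos_of_mul_pos_left (pos_of_mul_pos_left h3 h0.le) h4.le

theorem s_neg_of_lt {δ l s q : ℝ} (hf : p.IsFactorization δ l s q) (h2 : 0 < δ)
    (hδ : δ < p.δ₀) : s < 0 := by
  have h1 := h.mul_s_eq hf
  have h0 := h.δ₀_pos
  have hb := h.bCoef_pos
  have ha := h.aCoef_pos
  have hl := hf.l_pos
  have hq := hf.q_pos
  have h3 : 0 < p.aCoef * (p.δ₀ - δ) * (δ * p.δ₀ + p.bCoef) := by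
    have := sub_pos.2 hδ
    positivity
  have h5 : -s * (l * (p.aCoef + δ) + q) * p.δ₀
      = p.aCoef * (p.δ₀ - δ) * (δ * p.δ₀ + p.bCoef) := by linear_combination (-1) * h1
  rw [← h5] at h3
  have h4 : 0 < l * (p.aCoef + δ) + q := by positivity
  linarith [pos_of_mul_pos_left (pos_of_mul_pos_left h3 h0.le) h4.le]

theorem isEigenvalue_iff_factor {δ l s q : ℝ} (hf : p.IsFactorization δ l s q) (z : ℂ) :
    p.IsEigenvalue δ z ↔ (z + l) * (z ^ 2 + s * z + q) = 0 := by
  rw [h.isEigenvalue_iff]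
  have h2 : (l : ℂ) + s = p.aCoef + δ := by exact_mod_cast hf.coeff_two
  have h3 : (l : ℂ) * s + q = p.aCoef * δ - p.bCoef := by exact_mod_cast hf.coeff_one
  have h4 : (l : ℂ) * q = p.cCoef * δ := by exact_mod_cast hf.coeff_zero
  rw [← h2, ← h3, ← h4]
  constructor <;> intro H <;> linear_combination H

/-- If the quadratic factor has complex roots, `β₁₁` is the one in the upper half plane. -/
theorem β₁₁_eq {δ l s q : ℝ} (hf : p.IsFactorization δ l s q) (hd : s ^ 2 / 4 < q) :
    p.IsEigenvalue δ (p.β₁₁ δ) ∧ p.β₁₁ δ = ⟨-s / 2, √(q - s ^ 2 / 4)⟩ := by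
  have hpos : 0 < √(q - s ^ 2 / 4) := Real.sqrt_pos.2 (sub_pos.2 hd)
  have hsq : √(q - s ^ 2 / 4) ^ 2 = q - s ^ 2 / 4 := Real.sq_sqrt (sub_pos.2 hd).le
  set r := √(q - s ^ 2 / 4) with hr
  have hfac : ∀ z : ℂ, z ^ 2 + s * z + q = (z - ⟨-s / 2, r⟩) * (z - ⟨-s / 2, -r⟩) := by
    intro z
    have hq : q = r ^ 2 + s ^ 2 / 4 := by linarith
    rw [hq]
    apply Complex.ext
    · simp [pow_two, Complex.add_re, Complex.mul_re]; ring
    · simp [pow_two, Complex.add_im, Complex.mul_im]; ring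
  have hex : ∃ z : ℂ, 0 < z.im ∧ p.IsEigenvalue δ z := by
    refine ⟨⟨-s / 2, r⟩, hpos, ?_⟩
    rw [h.isEigenvalue_iff_factor hf, hfac]
    simp
  have huniq : ∀ z : ℂ, 0 < z.im → p.IsEigenvalue δ z → z = ⟨-s / 2, r⟩ := by
    intro z hz he
    rw [h.isEigenvalue_iff_factor hf, hfac, mul_eq_zero, mul_eq_zero] at he
    rcases he with he | he | he
    · have := congrArg Complex.im he
      simp at this
      linarith
    · exact sub_eq_zero.1 he
    · have := congrArg Complex.im (sub_eq_zero.1 he)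
      simp at this
      linarith
  have hβ : p.β₁₁ δ = hex.choose := by rw [β₁₁, dif_pos hex]
  rw [hβ]
  exact ⟨hex.choose_spec.2, huniq _ hex.choose_spec.1 hex.choose_spec.2⟩

end Admissible

variable (p) in
/-- The speed `d Re β₁₁ / dδ` at which the eigenvalues cross the imaginary axis. -/
def k : ℝ := (p.cCoef - p.ρ ^ 2 - p.aCoef * p.A) / (2 * (p.A ^ 2 + p.ρ ^ 2))

namespace Admissible

variable (h : p.Admissible)
include h

theorem k_neg : p.k < 0 := by
  have h1 := h.A_mul_B
  have hB : p.ρ ^ 2 = p.B := h.ρ_sq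
  have hA := h.A_pos
  have h0 := h.δ₀_pos
  have ha := h.aCoef_pos
  have hb := h.bCoef_pos
  have h2 : (p.cCoef - p.ρ ^ 2 - p.aCoef * p.A) * p.δ₀ = -(p.aCoef * (p.bCoef + p.δ₀ ^ 2)) := by
    rw [hB]
    rw [A, B] at *
    linear_combination (-1) * h1
  have h3 : p.cCoef - p.ρ ^ 2 - p.aCoef * p.A < 0 := by
    by_contra! h4
    have h5 := mul_nonneg h4 h0.le
    have : 0 < p.aCoef * (p.bCoef + p.δ₀ ^ 2) := by positivity
    linarith
  rw [k]
  exact div_neg_of_neg_of_pos h3 (by positivity)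

/-- Near `δ₀` the real root `-l` of the characteristic polynomial depends differentiably on `δ`.
The polynomial is affine in `δ`, so `δ` is a rational function of `l`, which is inverted. -/
theorem exists_root_function : ∃ l : ℝ → ℝ, l p.δ₀ = p.A ∧
    HasDerivAt l ((p.A * p.δ₀ + p.cCoef) / (p.A ^ 2 + p.ρ ^ 2)) p.δ₀ ∧
    ∀ᶠ δ in 𝓝 p.δ₀, p.IsFactorization δ (l δ) (p.aCoef + δ - l δ) (p.cCoef * δ / l δ) := by
  have hA := h.A_pos
  have h0 := h.δ₀_pos
  have hc := h.cCoef_pos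
  have hρ := h.ρ_sq
  have hAB := h.A_mul_B
  have hAdef : p.A = p.aCoef + p.δ₀ := rfl
  have hBρ : p.B = p.ρ ^ 2 := hρ.symm
  set N : ℝ → ℝ := fun l => l ^ 3 - p.aCoef * l ^ 2 - p.bCoef * l with hN
  set D : ℝ → ℝ := fun l => l ^ 2 - p.aCoef * l + p.cCoef with hD
  have hDA : D p.A = p.A * p.δ₀ + p.cCoef := by simp only [hD, hAdef]; ring
  have hDpos : 0 < D p.A := by rw [hDA]; positivity
  have hNA : N p.A = p.δ₀ * D p.A := by
    rw [hBρ, hρ] at hAB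
    simp only [hN, hD]
    rw [hAdef] at hAB ⊢
    linear_combination hAB
  have hN' : HasStrictDerivAt N (3 * p.A ^ 2 - p.aCoef * (2 * p.A) - p.bCoef) p.A := by
    have := (((hasStrictDerivAt_pow 3 p.A).sub ((hasStrictDerivAt_pow 2 p.A).const_mul p.aCoef)).sub
      ((hasStrictDerivAt_id p.A).const_mul p.bCoef))
    exact this.congr_deriv (by norm_num)
  have hD' : HasStrictDerivAt D (2 * p.A - p.aCoef) p.A := by
    have := (((hasStrictDerivAt_pow 2 p.A).sub ((hasStrictDerivAt_id p.A).const_mul p.aCoef)).add_const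
      p.cCoef)
    exact this.congr_deriv (by norm_num)
  -- `-l` is a root at `δ = N l / D l`
  have hF := hN'.div hD' hDpos.ne'
  have hFd : ((3 * p.A ^ 2 - p.aCoef * (2 * p.A) - p.bCoef) * D p.A
      - N p.A * (2 * p.A - p.aCoef)) / D p.A ^ 2
      = ((p.A * p.δ₀ + p.cCoef) / (p.A ^ 2 + p.ρ ^ 2))⁻¹ := by
    rw [hNA, inv_div, ← hDA, hρ]
    field_simp
    rw [hAdef]; ring
  rw [hFd] at hF
  have hne : ((p.A * p.δ₀ + p.cCoef) / (p.A ^ 2 + p.ρ ^ 2))⁻¹ ≠ 0 := by positivity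
  have hFA : (N / D) p.A = p.δ₀ := by
    simp only [Pi.div_apply, hNA]; field_simp
  have hinv := hF.to_localInverse hne
  rw [hFA, inv_inv] at hinv
  have hright := HasStrictDerivAt.eventually_right_inverse hF hne
  have hlA := (hF.hasStrictFDerivAt_equiv hne).localInverse_apply_image
  rw [hFA] at hright hlA
  change HasStrictDerivAt.localInverse (N / D) _ p.A hF hne p.δ₀ = p.A at hlA
  set l := HasStrictDerivAt.localInverse (N / D)
    ((p.A * p.δ₀ + p.cCoef) / (p.A ^ 2 + p.ρ ^ 2))⁻¹ p.A hF hne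
  refine ⟨l, hlA, hinv.hasDerivAt, ?_⟩
  have hcont : ContinuousAt l p.δ₀ := hinv.hasDerivAt.continuousAt
  have hpos : ∀ᶠ δ in 𝓝 p.δ₀, 0 < l δ := hcont.eventually (lt_mem_nhds (by rw [hlA]; exact hA))
  have hDc : ContinuousAt (fun δ => D (l δ)) p.δ₀ := by
    simp only [hD]
    fun_prop
  have hDp : ∀ᶠ δ in 𝓝 p.δ₀, 0 < D (l δ) := hDc.eventually (lt_mem_nhds (by simpa only [hlA] using hDpos))
  filter_upwards [hright, hpos, hDp, lt_mem_nhds h0] with δ h1 h2 h3 h4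
  refine h.isFactorization_of_root h4 h2 ?_
  rw [Pi.div_apply, div_eq_iff h3.ne'] at h1
  simp only [hN, hD] at h1
  linear_combination (-1) * h1

/-- The behaviour of the critical eigenvalue at `δ₀`. -/
theorem crossing : p.β₁₁ p.δ₀ = p.ρ * Complex.I ∧ ContinuousAt p.β₁₁ p.δ₀ ∧
    HasDerivAt (fun δ => (p.β₁₁ δ).re) p.k p.δ₀ ∧
      ∀ᶠ δ in 𝓝 p.δ₀, p.IsEigenvalue δ (p.β₁₁ δ) ∧ 0 < (p.β₁₁ δ).im ∧
        (p.δ₀ < δ → (p.β₁₁ δ).re < 0) ∧ (δ < p.δ₀ → 0 < (p.β₁₁ δ).re) := by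
  obtain ⟨l, hlA, hl, hfac⟩ := h.exists_root_function
  have hρ := h.ρ_pos
  have hA := h.A_pos
  have hAdef : p.A = p.aCoef + p.δ₀ := rfl
  have hc : p.cCoef * p.δ₀ / p.A = p.ρ ^ 2 := by
    rw [← h.A_mul_B, show p.ρ ^ 2 = p.B from h.ρ_sq]; field_simp
  have hlc := hl.continuousAt
  set s : ℝ → ℝ := fun δ => p.aCoef + δ - l δ with hs
  set q : ℝ → ℝ := fun δ => p.cCoef * δ / l δ with hq
  have hs0 : s p.δ₀ = 0 := by simp only [hs, hlA, hAdef]; ring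
  have hq0 : q p.δ₀ = p.ρ ^ 2 := by simp only [hq, hlA, hc]
  have hl0 : l p.δ₀ ≠ 0 := by rw [hlA]; exact hA.ne'
  have hsc : ContinuousAt s p.δ₀ := by fun_prop
  have hqc : ContinuousAt q p.δ₀ := by fun_prop (disch := exact hl0)
  have hd : ∀ᶠ δ in 𝓝 p.δ₀, s δ ^ 2 / 4 < q δ := by
    refine ContinuousAt.eventually_lt (by fun_prop) hqc ?_
    rw [hs0, hq0]
    simp only [ne_eq, OfNat.ofNat_ne_zero, not_false_eq_true, zero_pow, zero_div]
    positivity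
  have hev : ∀ᶠ δ in 𝓝 p.δ₀, p.IsFactorization δ (l δ) (s δ) (q δ) ∧ p.IsEigenvalue δ (p.β₁₁ δ) ∧
      p.β₁₁ δ = ⟨-s δ / 2, √(q δ - s δ ^ 2 / 4)⟩ := by
    filter_upwards [hfac, hd] with δ h1 h2
    exact ⟨h1, h.β₁₁_eq h1 h2⟩
  refine ⟨?_, ?_, ?_, ?_⟩
  · rw [hev.self_of_nhds.2.2, hs0, hq0]
    apply Complex.ext <;> simp [Real.sqrt_sq hρ.le]
  · have h1 : ContinuousAt (fun δ => ((-s δ / 2 : ℝ) : ℂ)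
        + ((√(q δ - s δ ^ 2 / 4) : ℝ) : ℂ) * Complex.I) p.δ₀ := by
      fun_prop
    refine h1.congr ?_
    filter_upwards [hev] with δ hδ
    rw [hδ.2.2]
    apply Complex.ext <;> simp
  · have h1 : HasDerivAt (fun δ => -s δ / 2) p.k p.δ₀ := by
      have h2 := ((((hasDerivAt_id p.δ₀).const_add p.aCoef).sub hl).neg.div_const 2)
      refine h2.congr_deriv ?_
      rw [k, hAdef]
      have : (p.aCoef + p.δ₀) ^ 2 + p.ρ ^ 2 ≠ 0 := by positivity
      field_simp
      ring
    refine h1.congr_of_eventuallyEq ?_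
    filter_upwards [hev] with δ hδ
    rw [hδ.2.2]
  · filter_upwards [hev, hd, lt_mem_nhds h.δ₀_pos] with δ hδ h2 h3
    refine ⟨hδ.2.1, ?_, fun h4 => ?_, fun h4 => ?_⟩ <;> rw [hδ.2.2]
    · exact Real.sqrt_pos.2 (sub_pos.2 h2)
    · have := h.s_pos_of_lt hδ.1 h4
      simp only
      linarith
    · have := h.s_neg_of_lt hδ.1 h3 h4
      simp only
      linarith

end Admissible

end Params

end Oregonator


/-! ### Quadratic Lyapunov functions -/

namespace Flow3

/-- A continuous function that is homogeneous of degree two and positive off the origin is bounded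
below by a multiple of the squared norm. -/
theorem exists_pos_mul_norm_sq_le {F : E3 → ℝ} (hF : Continuous F)
    (hom : ∀ (t : ℝ) w, F (t • w) = t ^ 2 * F w) (hpos : ∀ w, w ≠ 0 → 0 < F w) :
    ∃ c > 0, ∀ w, c * ‖w‖ ^ 2 ≤ F w := by
  obtain ⟨w₀, hw₀, hmin⟩ := (isCompact_sphere (0 : E3) 1).exists_isMinOn
    (NormedSpace.sphere_nonempty.2 zero_le_one) hF.continuousOn
  have hne : w₀ ≠ 0 := ne_zero_of_mem_unit_sphere ⟨w₀, hw₀⟩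
  refine ⟨F w₀, hpos w₀ hne, fun w => ?_⟩
  rcases eq_or_ne w 0 with rfl | hw
  · have := hom 0 0
    simp at this
    simp [this]
  · have hn : ‖w‖ ≠ 0 := norm_ne_zero_iff.2 hw
    have h1 : F w₀ ≤ F (‖w‖⁻¹ • w) := hmin (by simp [norm_smul, hn])
    have h2 : F w = ‖w‖ ^ 2 * F (‖w‖⁻¹ • w) := by
      rw [← hom, smul_smul, mul_inv_cancel₀ hn, one_smul]
    rw [h2, mul_comm]
    gcongr

/-- A quadratic form `w ↦ Q w w` that decreases strictly along the linear vector field `L`. -/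
structure IsStrictLyapunov (L : E3 → E3) (Q : E3 →L[ℝ] E3 →L[ℝ] ℝ) : Prop where
  symm : ∀ v w, Q v w = Q w v
  decreasing : ∃ c > 0, ∀ w, 2 * Q w (L w) ≤ -c * ‖w‖ ^ 2

/-- The form of a quadratic vector field: linear part `L`, quadratic part `v ↦ N v v`. -/
structure IsQuadraticField (f L : E3 → E3) (N : E3 →L[ℝ] E3 →L[ℝ] E3) : Prop where
  eq : ∀ v, f v = L v + N v v
  sub : ∀ v w, L (v - w) = L v - L w

theorem hasDerivWithinAt_quadratic (Q : E3 →L[ℝ] E3 →L[ℝ] ℝ) (hs : ∀ v w, Q v w = Q w v)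
    {w w' : ℝ → E3} {S : Set ℝ} {t : ℝ} (hw : HasDerivWithinAt w (w' t) S t) :
    HasDerivWithinAt (fun t => Q (w t) (w t)) (2 * Q (w t) (w' t)) S t := by
  have h1 : HasDerivWithinAt (fun t => Q (w t)) (Q (w' t)) S t :=
    Q.hasFDerivAt.comp_hasDerivWithinAt t hw
  have h2 := h1.clm_apply hw
  refine h2.congr_deriv ?_
  rw [hs (w' t) (w t)]; ring

section Lyapunov

variable {f L : E3 → E3} {N : E3 →L[ℝ] E3 →L[ℝ] E3} {Q : E3 →L[ℝ] E3 →L[ℝ] ℝ}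

/-- In a small ball, a strict Lyapunov function of the linear part decreases along the difference
of any two solutions of the nonlinear equation. -/
theorem IsStrictLyapunov.exists_radius (hQ : IsStrictLyapunov L Q) (hf : IsQuadraticField f L N) :
    ∃ c > 0, ∃ r > 0, r ≤ 1 ∧ ∀ v w, ‖v‖ ≤ r → ‖w‖ ≤ r →
      2 * Q (v - w) (f v - f w) ≤ -c * ‖v - w‖ ^ 2 := by
  obtain ⟨c, hc, hdec⟩ := hQ.decreasing
  set M := 4 * ‖Q‖ * ‖N‖ with hM
  have hM0 : 0 ≤ M := by positivity
  refine ⟨c / 2, by positivity, min 1 (c / (2 * (M + 1))), by positivity, min_le_left _ _,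
    fun v w hv hw => ?_⟩
  set r := min 1 (c / (2 * (M + 1)))
  have hr : M * r ≤ c / 2 := by
    have h1 : r ≤ c / (2 * (M + 1)) := min_le_right _ _
    have h2 : 0 ≤ r := (norm_nonneg v).trans hv
    calc M * r ≤ (M + 1) * (c / (2 * (M + 1))) := by gcongr; linarith
      _ = c / 2 := by field_simp
  have h1 : f v - f w = L (v - w) + (N v (v - w) + N (v - w) w) := by
    rw [hf.eq, hf.eq, hf.sub]
    simp only [map_sub, sub_apply]
    abel
  have h2 : ‖N v (v - w) + N (v - w) w‖ ≤ 2 * ‖N‖ * r * ‖v - w‖ := by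
    calc ‖N v (v - w) + N (v - w) w‖ ≤ ‖N v (v - w)‖ + ‖N (v - w) w‖ := norm_add_le _ _
      _ ≤ ‖N‖ * ‖v‖ * ‖v - w‖ + ‖N‖ * ‖v - w‖ * ‖w‖ := add_le_add (N.le_opNorm₂ _ _) (N.le_opNorm₂ _ _)
      _ ≤ ‖N‖ * r * ‖v - w‖ + ‖N‖ * ‖v - w‖ * r := by gcongr
      _ = 2 * ‖N‖ * r * ‖v - w‖ := by ring
  have h3 : |Q (v - w) (N v (v - w) + N (v - w) w)| ≤ ‖Q‖ * ‖v - w‖ * (2 * ‖N‖ * r * ‖v - w‖) :=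
    (Q.le_opNorm₂ _ _).trans (by gcongr)
  have h4 := (abs_le.1 h3).2
  have h5 := hdec (v - w)
  rw [h1, map_add]
  have h6 : 2 * (‖Q‖ * ‖v - w‖ * (2 * ‖N‖ * r * ‖v - w‖)) = M * r * ‖v - w‖ ^ 2 := by
    rw [hM]; ring
  have h7 : M * r * ‖v - w‖ ^ 2 ≤ c / 2 * ‖v - w‖ ^ 2 := by gcongr
  linarith

theorem IsQuadraticField.map_zero (hf : IsQuadraticField f L N) : f 0 = 0 := by
  have := hf.sub 0 0
  simp at this
  rw [hf.eq, this]; simp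

/-- A solution that stays in a small ball from some time on tends to the equilibrium: the Lyapunov
function has a limit, so it cannot drop by a fixed amount again and again. -/
theorem IsStrictLyapunov.exists_radius_tendsto (hQ : IsStrictLyapunov L Q)
    (hf : IsQuadraticField f L N) (hcont : Continuous f) :
    ∃ r > 0, ∀ u, IsForwardSolution f u → (∀ᶠ t in atTop, ‖u t‖ ≤ r) →
      Tendsto u atTop (𝓝 0) := by
  obtain ⟨c, hc, r, hr, hr1, hdec⟩ := hQ.exists_radius hf
  refine ⟨r, hr, fun u hu hev => ?_⟩
  obtain ⟨t₀, ht₀⟩ := eventually_atTop.1 (hev.and (eventually_ge_atTop 0))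
  have hdec' : ∀ v, ‖v‖ ≤ r → 2 * Q v (f v) ≤ -c * ‖v‖ ^ 2 := fun v hv => by
    simpa [hf.map_zero] using hdec v 0 hv (by simpa using hr.le)
  obtain ⟨M, hM⟩ := (isCompact_closedBall (0 : E3) r).exists_bound_of_continuousOn hcont.continuousOn
  have hM0 : 0 ≤ M := (norm_nonneg _).trans (hM 0 (by simpa using hr.le))
  have ht₀0 : 0 ≤ t₀ := (ht₀ t₀ le_rfl).2
  have hball : ∀ t, t₀ ≤ t → ‖u t‖ ≤ r := fun t ht => (ht₀ t ht).1
  have hder : ∀ t, t₀ ≤ t → HasDerivWithinAt u (f (u t)) (Ici t₀) t := fun t ht =>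
    (hu t (ht₀0.trans ht)).mono (Ici_subset_Ici.2 ht₀0)
  have hLip : ∀ t, t₀ ≤ t → ∀ s, t₀ ≤ s → ‖u t - u s‖ ≤ M * ‖t - s‖ := fun t ht s hs =>
    (convex_Ici t₀).norm_image_sub_le_of_norm_hasDerivWithin_le (f' := fun t => f (u t))
      (fun x hx => hder x hx)
      (fun x hx => hM _ (by simpa using hball x hx)) hs ht
  set V : ℝ → ℝ := fun t => Q (u t) (u t) with hV
  have hVd : ∀ t, t₀ ≤ t → HasDerivWithinAt V (2 * Q (u t) (f (u t))) (Ici t₀) t := fun t ht =>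
    hasDerivWithinAt_quadratic Q hQ.symm (w' := fun t => f (u t)) (hder t ht)
  have hVanti : AntitoneOn V (Ici t₀) := by
    refine antitoneOn_of_hasDerivWithinAt_nonpos (convex_Ici t₀)
      (fun t ht => (hVd t ht).continuousWithinAt)
      (fun t ht => (hVd t (interior_subset ht)).mono interior_subset) fun t ht => ?_
    have := hdec' (u t) (hball t (interior_subset ht))
    nlinarith [sq_nonneg ‖u t‖]
  have hVbdd : ∀ t, t₀ ≤ t → -(‖Q‖ * r * r) ≤ V t := fun t ht => by
    have h1 := Q.le_opNorm₂ (u t) (u t)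
    have h2 : ‖Q‖ * ‖u t‖ * ‖u t‖ ≤ ‖Q‖ * r * r := by
      have := hball t ht
      gcongr
    exact (abs_le.1 (h1.trans h2)).1
  have hlim : ∃ ℓ, Tendsto (fun t => V (max t t₀)) atTop (𝓝 ℓ) := by
    have hanti : Antitone fun t => V (max t t₀) := fun a b hab =>
      hVanti (mem_Ici.2 (le_max_right _ _)) (mem_Ici.2 (le_max_right _ _)) (max_le_max_right _ hab)
    rcases tendsto_atTop_of_antitone hanti with h | h
    · exfalso
      obtain ⟨t, ht⟩ := (h.eventually (eventually_lt_atBot (-(‖Q‖ * r * r)))).exists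
      exact absurd (hVbdd _ (le_max_right t t₀)) (not_le.2 ht)
    · exact h
  obtain ⟨ℓ, hℓ⟩ := hlim
  rw [Metric.tendsto_atTop]
  intro η hη
  -- the speed is at most `M`, so `‖u‖` stays above `η / 2` for a time `τ` after exceeding `η`
  set τ := η / (2 * (M + 1)) with hτ
  have hτ0 : 0 < τ := by positivity
  have hdiff : Tendsto (fun t => V (max t t₀) - V (max (t + τ) t₀)) atTop (𝓝 0) := by
    simpa using hℓ.sub (hℓ.comp (tendsto_atTop_add_const_right _ τ tendsto_id))
  have hpos : 0 < c * (η / 2) ^ 2 * τ := by positivity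
  obtain ⟨t₁, ht₁⟩ := eventually_atTop.1 (hdiff.eventually (gt_mem_nhds hpos))
  refine ⟨max t₀ t₁, fun t ht => ?_⟩
  have hta : t₀ ≤ t := (le_max_left _ _).trans ht
  have htb := ht₁ t ((le_max_right _ _).trans ht)
  rw [max_eq_left hta, max_eq_left (by linarith)] at htb
  rw [dist_zero_right]
  by_contra! hge
  have hlow : ∀ s ∈ Icc t (t + τ), η / 2 ≤ ‖u s‖ := fun s hs => by
    have h1 := hLip t hta s (hta.trans hs.1)
    have h2 : ‖t - s‖ ≤ τ := by
      rw [Real.norm_eq_abs, abs_le]; constructor <;> linarith [hs.1, hs.2]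
    have h3 : M * ‖t - s‖ ≤ η / 2 := by
      calc M * ‖t - s‖ ≤ (M + 1) * τ := by gcongr; linarith
        _ = η / 2 := by rw [hτ]; field_simp
    have h4 := norm_sub_norm_le (u t) (u s)
    linarith
  have hdrop : V (t + τ) - V t ≤ -(c * (η / 2) ^ 2) * (t + τ - t) := by
    refine (convex_Icc t (t + τ)).image_sub_le_mul_sub_of_deriv_le
      (f := V) (C := -(c * (η / 2) ^ 2)) ?_ ?_ ?_ t ?_ (t + τ) ?_ ?_
    · exact fun s hs => ((hVd s (hta.trans hs.1)).mono fun x hx => hta.trans hx.1).continuousWithinAt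
    · intro s hs
      rw [interior_Icc] at hs
      exact ((hVd s (hta.trans hs.1.le)).hasDerivAt
        (Ici_mem_nhds (hta.trans_lt hs.1))).differentiableAt.differentiableWithinAt
    · intro s hs
      rw [interior_Icc] at hs
      rw [((hVd s (hta.trans hs.1.le)).hasDerivAt (Ici_mem_nhds (hta.trans_lt hs.1))).deriv]
      have h1 := hdec' (u s) (hball s (hta.trans hs.1.le))
      have h2 := hlow s (Ioo_subset_Icc_self hs)
      have h3 : (η / 2) ^ 2 ≤ ‖u s‖ ^ 2 := by gcongr
      nlinarith
    · exact ⟨le_rfl, by linarith⟩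
    · exact ⟨by linarith, le_rfl⟩
    · linarith
  rw [add_sub_cancel_left] at hdrop
  linarith

/-- Lyapunov's theorem: a positive definite strict Lyapunov function of the linearization makes the
equilibrium asymptotically stable. -/
theorem IsStrictLyapunov.isAsymptoticallyStable (hQ : IsStrictLyapunov L Q)
    (hf : IsQuadraticField f L N) (hcont : ContDiff ℝ 1 f)
    (hpos : ∃ c > 0, ∀ w, c * ‖w‖ ^ 2 ≤ Q w w) : IsAsymptoticallyStable f {0} := by
  obtain ⟨c, hc, r, hr, hr1, hdec⟩ := hQ.exists_radius hf
  obtain ⟨r', hr', htend⟩ := hQ.exists_radius_tendsto hf hcont.continuous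
  obtain ⟨b, hb, hlow⟩ := hpos
  have hdec' : ∀ v, ‖v‖ ≤ r → 2 * Q v (f v) ≤ -c * ‖v‖ ^ 2 := fun v hv => by
    simpa [hf.map_zero] using hdec v 0 hv (by simpa using hr.le)
  have hstab : ∀ ε > 0, ε ≤ r → ∃ d > 0, ∀ φ : E3, ‖φ‖ < d →
      ∃ u, IsForwardSolution f u ∧ u 0 = φ ∧ ∀ t, 0 ≤ t → ‖u t‖ < ε := by
    intro ε hε hεr
    -- `‖φ‖ < d` ensures `Q φ φ < b ε²`, and `Q w w < b ε²` ensures `‖w‖ < ε`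
    set d := ε * √(b / (‖Q‖ + b)) with hd
    have hd0 : 0 < d := by positivity
    refine ⟨d, hd0, fun φ hφ => ?_⟩
    set lo : E3 := WithLp.toLp 2 fun _ => -1
    set hi : E3 := WithLp.toLp 2 fun _ => 1
    obtain ⟨u, hu0, hu⟩ := exists_solution_clampBox hcont (lo := lo) (hi := hi)
      (fun i => by simp [lo, hi]) φ
    have hclamp : ∀ v : E3, ‖v‖ ≤ 1 → clampBox lo hi v = v := fun v hv =>
      clampBox_eq_self fun i => by
        have h1 := (EuclideanSpace.norm_eq v) ▸ hv
        have h2 : |v i| ≤ 1 := (PiLp.norm_apply_le v i).trans hv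
        exact abs_le.1 h2
    have hQφ : Q φ φ < b * ε ^ 2 := by
      have h1 := (le_abs_self _).trans (Q.le_opNorm₂ φ φ)
      have h2 : ‖φ‖ * ‖φ‖ < d * d := mul_self_lt_mul_self (norm_nonneg _) hφ
      have h3 : d * d = ε ^ 2 * (b / (‖Q‖ + b)) := by
        rw [hd, ← pow_two, mul_pow, Real.sq_sqrt (by positivity)]
      have h4 : (‖Q‖ + b) * (d * d) = b * ε ^ 2 := by rw [h3]; field_simp
      have h5 : ‖Q‖ * (‖φ‖ * ‖φ‖) ≤ (‖Q‖ + b) * (‖φ‖ * ‖φ‖) := by gcongr; linarith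
      have h6 : (‖Q‖ + b) * (‖φ‖ * ‖φ‖) < (‖Q‖ + b) * (d * d) := by gcongr
      linarith
    set V : ℝ → ℝ := fun t => Q (u t) (u t) with hV
    have hVd : ∀ t S, HasDerivWithinAt V (2 * Q (u t) (f (clampBox lo hi (u t)))) S t := fun t S =>
      hasDerivWithinAt_quadratic Q hQ.symm (w' := fun t => f (clampBox lo hi (u t)))
        (hu t).hasDerivWithinAt
    have hsmall : ∀ t, V t < b * ε ^ 2 → ‖u t‖ < ε := fun t ht => by
      have h1 := (hlow (u t)).trans_lt ht
      exact lt_of_pow_lt_pow_left₀ 2 hε.le ((mul_lt_mul_iff_right₀ hb).1 h1)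
    have hVlt : ∀ t, 0 ≤ t → V t < b * ε ^ 2 := by
      refine ODEAux.lt_of_forall_le_imp_lt (fun t _ => (hVd t _).continuousWithinAt) fun T hT hlt => ?_
      have hanti : AntitoneOn V (Icc 0 T) := by
        refine antitoneOn_of_hasDerivWithinAt_nonpos (convex_Icc 0 T)
          (fun t _ => (hVd t _).continuousWithinAt) (fun t _ => hVd t _) fun t ht => ?_
        rw [interior_Icc] at ht
        have h1 := (hsmall t (hlt t ⟨ht.1.le, ht.2⟩)).le.trans hεr
        rw [hclamp _ (h1.trans hr1)]
        have := hdec' _ h1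
        nlinarith [sq_nonneg ‖u t‖]
      refine (hanti (left_mem_Icc.2 hT) (right_mem_Icc.2 hT) hT).trans_lt ?_
      simpa only [hV, hu0] using hQφ
    refine ⟨u, isForwardSolution_of_hasDerivAt fun t ht => ?_, hu0, fun t ht => hsmall t (hVlt t ht)⟩
    have h1 := ((hsmall t (hVlt t ht)).le.trans hεr).trans hr1
    have h2 := hu t
    rwa [hclamp _ h1] at h2
  simp only [IsAsymptoticallyStable, IsStable, Metric.infDist_singleton, dist_zero_right]
  constructor
  · intro ε hε
    obtain ⟨d, hd, H⟩ := hstab (min ε r) (lt_min hε hr) (min_le_right _ _)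
    refine ⟨d, hd, fun φ hφ => ?_⟩
    obtain ⟨u, hu, hu0, hlt⟩ := H φ hφ
    exact ⟨u, hu, hu0, fun t ht => (hlt t ht).trans_le (min_le_left _ _)⟩
  · obtain ⟨d, hd, H⟩ := hstab (min r' r) (lt_min hr' hr) (min_le_right _ _)
    refine ⟨d, hd, fun φ hφ => ?_⟩
    obtain ⟨u, hu, hu0, hlt⟩ := H φ hφ
    refine ⟨u, hu, hu0, ?_⟩
    have h1 := htend u hu ((eventually_ge_atTop 0).mono fun t ht =>
      (hlt t ht).le.trans (min_le_left _ _))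
    simpa using h1.norm

/-- Solutions depend on their final value in a Lipschitz way, as long as they are bounded. -/
theorem norm_sub_le_of_isForwardSolution {K : ℝ≥0} {R T : ℝ} (hT : 0 ≤ T)
    (hK : LipschitzOnWith K f (Metric.closedBall 0 R)) {u v : ℝ → E3}
    (hu : IsForwardSolution f u) (hv : IsForwardSolution f v)
    (hub : ∀ t ∈ Icc 0 T, ‖u t‖ ≤ R) (hvb : ∀ t ∈ Icc 0 T, ‖v t‖ ≤ R) :
    ‖u 0 - v 0‖ ≤ Real.exp (K * T) * ‖u T - v T‖ := by
  have hd : ∀ t ∈ Icc 0 T, HasDerivWithinAt (fun t => ‖u t - v t‖ ^ 2)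
      (2 * inner ℝ (u t - v t) (f (u t) - f (v t))) (Icc 0 T) t := fun t ht =>
    (((hu t ht.1).sub (hv t ht.1)).mono Icc_subset_Ici_self).norm_sq
  have h1 := ODEAux.mul_exp_le_of_le_deriv hd (K := -2 * K) (fun t ht => by
    have h2 := hK.dist_le_mul _ (by simpa using hub t ht) _ (by simpa using hvb t ht)
    rw [dist_eq_norm, dist_eq_norm] at h2
    have h3 := abs_real_inner_le_norm (u t - v t) (f (u t) - f (v t))
    have h4 := (abs_le.1 h3).1
    have h5 : ‖u t - v t‖ * ‖f (u t) - f (v t)‖ ≤ ‖u t - v t‖ * (K * ‖u t - v t‖) := by gcongr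
    nlinarith) T (right_mem_Icc.2 hT)
  have h2 : ‖u 0 - v 0‖ ^ 2 ≤ (Real.exp (K * T) * ‖u T - v T‖) ^ 2 := by
    have h3 : Real.exp (-2 * K * (T - 0)) * Real.exp (K * T) ^ 2 = 1 := by
      rw [← Real.exp_nat_mul, ← Real.exp_add, Real.exp_eq_one_iff]; push_cast; ring
    calc ‖u 0 - v 0‖ ^ 2
        = ‖u 0 - v 0‖ ^ 2 * Real.exp (-2 * K * (T - 0)) * Real.exp (K * T) ^ 2 := by
          rw [mul_assoc, h3, mul_one]
      _ ≤ ‖u T - v T‖ ^ 2 * Real.exp (K * T) ^ 2 := by gcongr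
      _ = _ := by ring
  exact le_of_sq_le_sq h2 (by positivity)

/-- A cone on which a quadratic form is nonnegative projects injectively, with a Lipschitz inverse,
along a direction in which the form is negative. -/
theorem exists_norm_le_orthogonalProjection {e : E3} (he : Q e e < 0) :
    ∃ C : ℝ≥0, ∀ w, 0 ≤ Q w w → ‖w‖ ≤ C * ‖(ℝ ∙ e)ᗮ.orthogonalProjectionOnto w‖ := by
  set P := (ℝ ∙ e)ᗮ.orthogonalProjectionOnto with hP
  set S : Set E3 := Metric.sphere 0 1 ∩ {w | 0 ≤ Q w w} with hS
  have hScpt : IsCompact S := (isCompact_sphere _ _).inter_right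
    (isClosed_le continuous_const (by fun_prop))
  have hpos : ∀ w ∈ S, 0 < ‖P w‖ := fun w hw => by
    rw [norm_pos_iff]
    intro h0
    have h1 : w ∈ ℝ ∙ e := by
      rw [hP, Submodule.orthogonalProjectionOnto_eq_zero_iff, Submodule.orthogonal_orthogonal] at h0
      exact h0
    obtain ⟨a, rfl⟩ := Submodule.mem_span_singleton.1 h1
    have h2 : 0 ≤ Q (a • e) (a • e) := hw.2
    have h3 : Q (a • e) (a • e) = a ^ 2 * Q e e := by simp; ring
    have h4 : a = 0 := by
      by_contra h4
      have : 0 < a ^ 2 := by positivity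
      nlinarith
    have h5 : ‖a • e‖ = 1 := by simpa using hw.1
    simp [h4] at h5
  have hb : ∃ m > 0, ∀ w ∈ S, m ≤ ‖P w‖ := by
    rcases S.eq_empty_or_nonempty with h | h
    · exact ⟨1, one_pos, fun w hw => by simp [h] at hw⟩
    · obtain ⟨w₀, hw₀, hmin⟩ := hScpt.exists_isMinOn h (f := fun w => ‖P w‖) (by fun_prop)
      exact ⟨_, hpos w₀ hw₀, fun w hw => hmin hw⟩
  obtain ⟨m, hm, hmS⟩ := hb
  refine ⟨⟨m⁻¹, by positivity⟩, fun w hw => ?_⟩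
  rcases eq_or_ne w 0 with rfl | h0
  · simp
  have hn : 0 < ‖w‖ := norm_pos_iff.2 h0
  have h1 : ‖w‖⁻¹ • w ∈ S := by
    refine ⟨by simp [norm_smul, hn.ne'], ?_⟩
    simp only [mem_ofPred_eq, map_smul, smul_apply, smul_eq_mul]
    positivity
  have h2 := hmS _ h1
  rw [map_smul, norm_smul, norm_inv, norm_norm, inv_mul_eq_div, le_div_iff₀ hn] at h2
  change ‖w‖ ≤ m⁻¹ * ‖P w‖
  rw [inv_mul_eq_div, le_div_iff₀ hm]
  linarith

/-- If a strict Lyapunov function takes a negative value, the stable manifold has codimension at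
least one: locally it is a Lipschitz graph over a plane, because the Lyapunov function is nonnegative
on the difference of any two of its points, and globally it is a countable union of preimages of the
local one under the solution maps. -/
theorem IsStrictLyapunov.dimH_stableManifold_le (hQ : IsStrictLyapunov L Q)
    (hf : IsQuadraticField f L N) (hcont : ContDiff ℝ 1 f) (hneg : ∃ e, Q e e < 0) :
    dimH (stableManifold f) ≤ 2 := by
  obtain ⟨c, hc, r, hr, hr1, hdec⟩ := hQ.exists_radius hf
  obtain ⟨e, he⟩ := hneg
  obtain ⟨C, hC⟩ := exists_norm_le_orthogonalProjection he
  have he0 : e ≠ 0 := by rintro rfl; simp at he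
  set P := (ℝ ∙ e)ᗮ.orthogonalProjectionOnto with hP
  have hex : ∀ φ : E3, ∃ u : ℝ → E3, φ ∈ stableManifold f →
      IsForwardSolution f u ∧ u 0 = φ ∧ Tendsto u atTop (𝓝 0) := fun φ => by
    by_cases hφ : φ ∈ stableManifold f
    · obtain ⟨u, hu⟩ := hφ
      exact ⟨u, fun _ => hu⟩
    · exact ⟨0, fun h => absurd h hφ⟩
  choose U hU using hex
  -- the points whose solutions are bounded by `R` and stay in the small ball from time `n` on
  set S : ℕ → ℕ → Set E3 := fun n R => {φ ∈ stableManifold f |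
    (∀ t ∈ Icc (0 : ℝ) n, ‖U φ t‖ ≤ R) ∧ ∀ t, (n : ℝ) ≤ t → ‖U φ t‖ ≤ r} with hS
  have hcover : stableManifold f ⊆ ⋃ n, ⋃ R, S n R := fun φ hφ => by
    obtain ⟨hu, hu0, hlim⟩ := hU φ hφ
    have h1 : ∀ᶠ t in atTop, ‖U φ t‖ ≤ r := by
      have := hlim.norm
      rw [norm_zero] at this
      exact (this.eventually (gt_mem_nhds hr)).mono fun t ht => le_of_lt ht
    obtain ⟨t₁, ht₁⟩ := eventually_atTop.1 h1
    obtain ⟨n, hn⟩ := exists_nat_ge t₁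
    obtain ⟨R, hR⟩ := hu.exists_bound n
    obtain ⟨R', hR'⟩ := exists_nat_ge R
    exact mem_iUnion₂.2 ⟨n, R', hφ, fun t ht => (hR t ht).trans hR', fun t ht => ht₁ t (hn.trans ht)⟩
  refine (dimH_mono hcover).trans ?_
  rw [dimH_iUnion]
  refine iSup_le fun n => ?_
  rw [dimH_iUnion]
  refine iSup_le fun R => ?_
  obtain ⟨K, hK⟩ := hcont.exists_lipschitzOnWith_closedBall R
  set F : E3 → (ℝ ∙ e)ᗮ := fun φ => P (U φ n) with hF
  have hanti : ∀ φ ∈ S n R, ∀ ψ ∈ S n R,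
      ‖φ - ψ‖ ≤ Real.exp (K * n) * C * ‖F φ - F ψ‖ := by
    intro φ hφ ψ hψ
    obtain ⟨hu, hu0, hul⟩ := hU φ hφ.1
    obtain ⟨hv, hv0, hvl⟩ := hU ψ hψ.1
    have hn : (0 : ℝ) ≤ n := n.cast_nonneg
    have h1 := norm_sub_le_of_isForwardSolution hn hK hu hv hφ.2.1 hψ.2.1
    rw [hu0, hv0] at h1
    set w : ℝ → E3 := fun t => U φ t - U ψ t with hw
    have hVd : ∀ t, (n : ℝ) ≤ t → HasDerivWithinAt (fun t => Q (w t) (w t))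
        (2 * Q (w t) (f (U φ t) - f (U ψ t))) (Ici (n : ℝ)) t := fun t ht =>
      hasDerivWithinAt_quadratic Q hQ.symm (w' := fun t => f (U φ t) - f (U ψ t))
        (((hu t (hn.trans ht)).sub (hv t (hn.trans ht))).mono (Ici_subset_Ici.2 hn))
    have hVanti : AntitoneOn (fun t => Q (w t) (w t)) (Ici (n : ℝ)) := by
      refine antitoneOn_of_hasDerivWithinAt_nonpos (convex_Ici _)
        (fun t ht => (hVd t ht).continuousWithinAt)
        (fun t ht => (hVd t (interior_subset ht)).mono interior_subset) fun t ht => ?_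
      have := hdec _ _ (hφ.2.2 t (interior_subset ht)) (hψ.2.2 t (interior_subset ht))
      nlinarith [sq_nonneg ‖U φ t - U ψ t‖]
    have hwlim : Tendsto w atTop (𝓝 0) := by simpa using hul.sub hvl
    have hVlim : Tendsto (fun t => Q (w t) (w t)) atTop (𝓝 0) := by
      have h2 : Continuous fun v : E3 => Q v v := by fun_prop
      have h3 := (h2.tendsto 0).comp hwlim
      rw [map_zero] at h3
      exact h3
    -- the Lyapunov function of the difference decreases to zero
    have hV0 : 0 ≤ Q (w n) (w n) := by
      refine le_of_tendsto hVlim ((eventually_ge_atTop (n : ℝ)).mono fun t ht => ?_)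
      exact hVanti self_mem_Ici ht ht
    have h2 := hC _ hV0
    have h3 : P (w n) = F φ - F ψ := by simp only [hF, hw, map_sub]
    rw [h3] at h2
    calc ‖φ - ψ‖ ≤ Real.exp (K * n) * ‖w n‖ := h1
      _ ≤ Real.exp (K * n) * (C * ‖F φ - F ψ‖) := by gcongr
      _ = _ := by ring
  have hinj : InjOn F (S n R) := fun φ hφ ψ hψ hEq => by
    have := hanti φ hφ ψ hψ
    rw [hEq, sub_self, norm_zero, mul_zero] at this
    exact sub_eq_zero.1 (norm_le_zero_iff.1 this)
  set g := Function.invFunOn F (S n R) with hg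
  have hgF : ∀ φ ∈ S n R, g (F φ) = φ := fun φ hφ => hinj.leftInvOn_invFunOn hφ
  have hglip : LipschitzOnWith (⟨Real.exp (K * n), (Real.exp_pos _).le⟩ * C) g (F '' S n R) := by
    refine LipschitzOnWith.of_dist_le_mul ?_
    rintro _ ⟨φ, hφ, rfl⟩ _ ⟨ψ, hψ, rfl⟩
    rw [hgF φ hφ, hgF ψ hψ, dist_eq_norm, dist_eq_norm]
    exact hanti φ hφ ψ hψ
  have himg : S n R = g '' (F '' S n R) := by
    rw [image_image]
    ext φ
    constructor
    · exact fun hφ => ⟨φ, hφ, hgF φ hφ⟩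
    · rintro ⟨ψ, hψ, rfl⟩
      change g (F ψ) ∈ S n R
      rw [hgF ψ hψ]; exact hψ
  rw [himg]
  refine hglip.dimH_image_le.trans ((dimH_mono (subset_univ _)).trans ?_)
  rw [Real.dimH_univ_eq_finrank]
  have : Fact (Module.finrank ℝ E3 = 2 + 1) := ⟨by simp⟩
  have hfin : Module.finrank ℝ (ℝ ∙ e)ᗮ = 2 := Submodule.finrank_orthogonal_span_singleton he0
  rw [hfin]
  norm_num

end Lyapunov

end Flow3


/-! ### Loss of stability of the equilibrium of the Oregonator -/

namespace Oregonator

open Flow3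

namespace Params

variable {p : Params}

theorem contDiff_field (δ : ℝ) : ContDiff ℝ 1 (p.field δ) := by
  rw [contDiff_euclidean]
  intro i
  fin_cases i <;> simp [field] <;> fun_prop

variable (p) in
/-- The linear factor of the quadratic part: `G u v = u₀ • Glin v`. -/
def Glin : E3 →L[ℝ] E3 := LinearMap.toContinuousLinearMap
  { toFun := fun v => !₂[-p.α * v 1 - p.α * p.β * v 0, -(1 / p.α) * v 1, 0]
    map_add' := fun v w => by ext i; fin_cases i <;> simp <;> ring
    map_smul' := fun a v => by ext i; fin_cases i <;> simp <;> ring }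

theorem G_eq (u v : E3) : p.G u v = u 0 • p.Glin v := by
  ext i; fin_cases i <;> simp [G, Glin] <;> ring

variable (p) in
/-- The quadratic part as a continuous bilinear map. -/
def Gbil : E3 →L[ℝ] E3 →L[ℝ] E3 :=
  (EuclideanSpace.proj (0 : Fin 3) : E3 →L[ℝ] ℝ).smulRight p.Glin

theorem Gbil_apply (u v : E3) : p.Gbil u v = p.G u v := by
  rw [G_eq]; simp [Gbil]

theorem lin_sub (δ : ℝ) (v w : E3) : p.lin δ (v - w) = p.lin δ v - p.lin δ w := by
  ext i; fin_cases i <;> simp [lin] <;> ring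

theorem Admissible.isQuadraticField (h : p.Admissible) (δ : ℝ) :
    IsQuadraticField (p.field δ) (p.lin δ) p.Gbil where
  eq v := by rw [Gbil_apply, h.field_eq]
  sub := lin_sub δ

theorem continuous_lin (δ : ℝ) : Continuous (p.lin δ) := by
  refine (PiLp.continuous_toLp 2 _).comp ?_
  refine continuous_pi fun i => ?_
  fin_cases i <;> simp <;> fun_prop

/-- The linear functional with the given coefficients. -/
def functional (a b c : ℝ) : E3 →L[ℝ] ℝ :=
  a • EuclideanSpace.proj 0 + b • EuclideanSpace.proj 1 + c • EuclideanSpace.proj 2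

theorem functional_apply (a b c : ℝ) (u : E3) : functional a b c u = a * u 0 + b * u 1 + c * u 2 := by
  simp [functional]

/-- The symmetric bilinear form `τ (Y² + s X Y + m X²) + K Z²`. -/
def oscillatorForm (X Y Z : E3 →L[ℝ] ℝ) (τ s m K : ℝ) : E3 →L[ℝ] E3 →L[ℝ] ℝ :=
  (Y.smulRight (τ • (Y + (s / 2) • X)) + X.smulRight (τ • ((s / 2) • Y + m • X))
    + Z.smulRight (K • Z) : E3 →L[ℝ] (E3 →L[ℝ] ℝ))

set_option synthInstance.maxHeartbeats 200000 in
theorem oscillatorForm_apply (X Y Z : E3 →L[ℝ] ℝ) (τ s m K : ℝ) (v w : E3) :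
    oscillatorForm X Y Z τ s m K v w
      = τ * (Y v * Y w + s / 2 * (X v * Y w + Y v * X w) + m * (X v * X w)) + K * (Z v * Z w) := by
  simp only [oscillatorForm, add_apply, ContinuousLinearMap.smulRight_apply, smul_apply, smul_eq_mul]
  ring

theorem eq_zero_of_weighted_sq_sum {a b c x y z : ℝ} (ha : 0 < a) (hb : 0 < b) (hc : 0 < c)
    (hle : a * x ^ 2 + b * y ^ 2 + c * z ^ 2 ≤ 0) : x = 0 ∧ y = 0 ∧ z = 0 := by
  have h1 := mul_nonneg ha.le (sq_nonneg x)
  have h2 := mul_nonneg hb.le (sq_nonneg y)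
  have h3 := mul_nonneg hc.le (sq_nonneg z)
  refine ⟨?_, ?_, ?_⟩
  · have : a * x ^ 2 = 0 := by linarith
    simpa [ha.ne'] using this
  · have : b * y ^ 2 = 0 := by linarith
    simpa [hb.ne'] using this
  · have : c * z ^ 2 = 0 := by linarith
    simpa [hc.ne'] using this

/-- In the coordinates `x = u₃`, `y = x'` and `z = (d/dt)² x + s x' + q x` the linearization becomes
`x' = y`, `y' = -s y - q x + z`, `z' = -l z`. The energy `y² + s x y + (q + s²/2) x²` of the
oscillator, taken with the sign of its damping `s`, plus a multiple of `z²`, is a strict Lyapunov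
function. -/
theorem Admissible.exists_lyapunov (h : p.Admissible) {δ : ℝ} (hδ : 0 < δ) (hne : δ ≠ p.δ₀) :
    ∃ Q, IsStrictLyapunov (p.lin δ) Q ∧
      (p.δ₀ < δ → ∃ c > 0, ∀ w, c * ‖w‖ ^ 2 ≤ Q w w) ∧ (δ < p.δ₀ → ∃ e, Q e e < 0) := by
  obtain ⟨l, s, q, hf⟩ := h.exists_isFactorization hδ
  have hl := hf.l_pos
  have hq := hf.q_pos
  have hκ := h.κ_pos
  have hγ : p.κ * (p.γ / p.α) = p.cCoef + p.bCoef := by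
    have := h.α_pos.ne'
    rw [Admissible.cCoef_add_bCoef, κ]; field_simp
  have h2 := hf.coeff_two
  have h1 := hf.coeff_one
  have h0 := hf.coeff_zero
  rw [Admissible.aCoef_eq] at h1 h2
  have hs : s ≠ 0 := by
    rcases lt_or_gt_of_ne hne with h3 | h3
    · exact (h.s_neg_of_lt hf hδ h3).ne
    · exact (h.s_pos_of_lt hf h3).ne'
  obtain ⟨τ, hτs, hτ1⟩ : ∃ τ : ℝ, τ * s = |s| ∧ (0 < s → τ = 1) ∧ (s < 0 → τ = -1) := by
    rcases lt_or_gt_of_ne hs with h3 | h3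
    · exact ⟨-1, by rw [abs_of_neg h3]; ring, fun h4 => absurd h4 (not_lt.2 h3.le), fun _ => rfl⟩
    · exact ⟨1, by rw [abs_of_pos h3]; ring, fun _ => rfl, fun h4 => absurd h4 (not_lt.2 h3.le)⟩
  have hτsq : τ ^ 2 = 1 := by
    rcases lt_or_gt_of_ne hs with h3 | h3
    · rw [hτ1.2 h3]; norm_num
    · rw [hτ1.1 h3]; norm_num
  have habs : 0 < |s| := abs_pos.2 hs
  set X := functional 0 0 1 with hX
  set Y := functional δ 0 (-δ) with hY
  set Z := functional (-δ * p.e - δ ^ 2 + s * δ) (-δ * p.κ) (δ ^ 2 - s * δ + q) with hZ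
  have hXL : ∀ w, X (p.lin δ w) = Y w := fun w => by
    simp only [hX, hY, functional_apply, lin]; simp; ring
  have hYL : ∀ w, Y (p.lin δ w) = -s * Y w - q * X w + Z w := fun w => by
    simp only [hX, hY, hZ, functional_apply, lin]; simp; ring
  have hZL : ∀ w, Z (p.lin δ w) = -l * Z w := fun w => by
    have e1 : p.κ * ((p.e * p.g + p.bCoef) / p.κ) = p.e * p.g + p.bCoef := by field_simp
    have hm' : δ * (p.κ * (p.γ / p.α)) = l * q + δ * p.bCoef := by
      rw [hγ, h0]; ring
    simp only [hZ, functional_apply, lin]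
    simp
    generalize (p.e * p.g + p.bCoef) / p.κ = m₁ at *
    generalize p.γ / p.α = m₂ at *
    generalize p.bCoef = b at *
    generalize p.g = g at *
    obtain rfl : g = l + s - p.e - δ := by linarith
    obtain rfl : b = (l + s - δ) * δ - l * s - q := by linarith
    linear_combination (δ * w 0) * e1 - w 2 * hm'
  -- the weight of `z²` that absorbs the products `y z` and `x z`
  set M := 2 / |s| + |s| / (2 * q) with hM
  have hM0 : 0 < M := by positivity
  set K := (M + 1) / (2 * l) with hK
  have hK0 : 0 < K := by positivity
  set Q : E3 →L[ℝ] E3 →L[ℝ] ℝ := oscillatorForm X Y Z τ s (q + s ^ 2 / 2) K with hQ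
  have hQa : ∀ v w, Q v w = τ * (Y v * Y w + s / 2 * (X v * Y w + Y v * X w)
      + (q + s ^ 2 / 2) * (X v * X w)) + K * (Z v * Z w) := fun v w =>
    oscillatorForm_apply ..
  have hXYZ : ∀ w : E3, w ≠ 0 → ¬ (Y w = 0 ∧ X w = 0 ∧ Z w = 0) := by
    rintro w hw ⟨hY0, hX0, hZ0⟩
    have w2 : w 2 = 0 := by simpa [hX, functional_apply] using hX0
    have w0 : w 0 = 0 := by simpa [hY, functional_apply, w2, hδ.ne'] using hY0
    have w1 : w 1 = 0 := by simpa [hZ, functional_apply, w2, w0, hδ.ne', hκ.ne'] using hZ0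
    refine hw ?_
    ext i
    fin_cases i
    · exact w0
    · exact w1
    · exact w2
  have hdec : ∀ w, 2 * Q w (p.lin δ w) ≤ -(|s| / 2 * Y w ^ 2 + |s| * q / 2 * X w ^ 2 + Z w ^ 2) := by
    intro w
    rw [hQa, hXL, hYL, hZL]
    have e1 : 2 * (τ * (Y w * (-s * Y w - q * X w + Z w) + s / 2 * (X w * (-s * Y w - q * X w + Z w)
        + Y w * Y w) + (q + s ^ 2 / 2) * (X w * Y w)) + K * (Z w * (-l * Z w)))
        = -|s| * (Y w ^ 2 + q * X w ^ 2) + (2 * τ * (Y w * Z w) + |s| * (X w * Z w))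
          - (M + 1) * Z w ^ 2 := by
      have : 2 * K * l = M + 1 := by rw [hK]; field_simp
      rw [← hτs, ← this]; ring
    rw [e1]
    have e2 : 2 * τ * (Y w * Z w) ≤ |s| / 2 * Y w ^ 2 + 2 / |s| * Z w ^ 2 := by
      have h4 : |s| / 2 * Y w ^ 2 + 2 / |s| * Z w ^ 2 - 2 * τ * (Y w * Z w)
          = (|s| * Y w - 2 * τ * Z w) ^ 2 / (2 * |s|) := by
        field_simp
        linear_combination (-4 * Z w ^ 2) * hτsq
      have : 0 ≤ (|s| * Y w - 2 * τ * Z w) ^ 2 / (2 * |s|) := by positivity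
      linarith
    have e3 : |s| * (X w * Z w) ≤ |s| * q / 2 * X w ^ 2 + |s| / (2 * q) * Z w ^ 2 := by
      have h4 : |s| * q / 2 * X w ^ 2 + |s| / (2 * q) * Z w ^ 2 - |s| * (X w * Z w)
          = |s| * (q * X w - Z w) ^ 2 / (2 * q) := by
        field_simp
        ring
      have : 0 ≤ |s| * (q * X w - Z w) ^ 2 / (2 * q) := by positivity
      linarith
    rw [hM]
    linarith
  refine ⟨Q, ⟨fun v w => by rw [hQa, hQa]; ring, ?_⟩, fun h3 => ?_, fun h3 => ?_⟩
  · have hL := continuous_lin (p := p) δ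
    obtain ⟨c, hc, hlow⟩ := exists_pos_mul_norm_sq_le
      (F := fun w => |s| / 2 * Y w ^ 2 + |s| * q / 2 * X w ^ 2 + Z w ^ 2) (by fun_prop)
      (fun t w => by simp only [map_smul, smul_eq_mul]; ring) (fun w hw => by
        by_contra! h6
        exact hXYZ w hw (eq_zero_of_weighted_sq_sum (a := |s| / 2) (b := |s| * q / 2)
          (by positivity) (by positivity) one_pos (by linarith)))
    exact ⟨c, hc, fun w => by linarith [hdec w, hlow w]⟩
  · have hsp := h.s_pos_of_lt hf h3
    have hτ := hτ1.1 hsp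
    refine exists_pos_mul_norm_sq_le (F := fun w => Q w w) (by fun_prop)
      (fun t w => by simp; ring) fun w hw => ?_
    rw [hQa, hτ]
    by_contra! h6
    obtain ⟨hY0, hX0, hZ0⟩ := eq_zero_of_weighted_sq_sum (x := Y w + s / 2 * X w) (y := X w)
      (z := Z w) one_pos (by positivity : 0 < q + s ^ 2 / 4) hK0 (by linarith)
    exact hXYZ w hw ⟨by simpa [hX0] using hY0, hX0, hZ0⟩
  · have hsn := h.s_neg_of_lt hf hδ h3
    have hτ := hτ1.2 hsn
    -- the vector with `x = 1`, `y = 0`, `z = 0`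
    refine ⟨!₂[1, (q / δ - p.e) / p.κ, 1], ?_⟩
    have hX1 : X !₂[1, (q / δ - p.e) / p.κ, 1] = 1 := by simp [hX, functional_apply]
    have hY0 : Y !₂[1, (q / δ - p.e) / p.κ, 1] = 0 := by simp [hY, functional_apply]
    have hZ0 : Z !₂[1, (q / δ - p.e) / p.κ, 1] = 0 := by
      simp [hZ, functional_apply]
      field_simp
      ring
    rw [hQa, hX1, hY0, hZ0, hτ]
    have : 0 < q + s ^ 2 / 2 := by positivity
    linarith

/-! ### An invariant box -/

variable (p) in
/-- The lower corner, in coordinates centred at the equilibrium, of the invariant box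
`[1, 1/β] × [γβ/(1+β), γ/(2β)] × [1, 1/β]`. -/
def boxLo : E3 := !₂[1 - p.σ, p.γ * p.β / (1 + p.β) - p.γ * p.σ / (1 + p.σ), 1 - p.σ]

variable (p) in
/-- The upper corner of the invariant box. -/
def boxHi : E3 := !₂[1 / p.β - p.σ, p.γ / (2 * p.β) - p.γ * p.σ / (1 + p.σ), 1 / p.β - p.σ]

namespace Admissible

variable (h : p.Admissible)
include h

theorem sigma_lt : p.σ < 1 / p.β := by
  rw [lt_div_iff₀ h.β_pos]
  linarith [h.beta_sigma_lt]

theorem beta_lt_one : p.β < 1 := by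
  have := h.one_lt_sigma
  have := h.beta_sigma_lt
  have := h.β_pos
  nlinarith

theorem boxLo_neg (i : Fin 3) : p.boxLo i < 0 := by
  have h1 := h.one_lt_sigma
  have h2 := h.beta_lt_one
  have h3 := h.β_pos
  have h4 := h.γ_pos
  fin_cases i
  · simp [boxLo]; linarith
  · simp only [boxLo]
    simp
    rw [div_lt_div_iff₀ (by linarith) (by linarith)]
    nlinarith [mul_pos h4 (sub_pos.2 (h2.trans h1))]
  · simp [boxLo]; linarith

theorem boxHi_pos (i : Fin 3) : 0 < p.boxHi i := by
  have h1 := h.one_lt_sigma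
  have h2 := h.beta_lt_one
  have h3 := h.β_pos
  have h4 := h.γ_pos
  have h5 := h.sigma_lt
  have h6 := h.beta_sigma_lt
  fin_cases i
  · simp only [boxHi]; simpa using h5
  · simp only [boxHi]
    simp
    rw [div_lt_div_iff₀ (by linarith) (by linarith)]
    nlinarith
  · simp only [boxHi]; simpa using h5

/-- The vector field in the original concentrations. -/
theorem field_original (δ : ℝ) (u : E3) :
    p.field δ u 0 = p.α * ((u 0 + p.σ) + (u 1 + p.γ * p.σ / (1 + p.σ))
        - (u 0 + p.σ) * (u 1 + p.γ * p.σ / (1 + p.σ)) - p.β * (u 0 + p.σ) ^ 2) ∧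
    p.field δ u 1 = 1 / p.α * (-(u 1 + p.γ * p.σ / (1 + p.σ)) * (1 + (u 0 + p.σ))
        + p.γ * (u 2 + p.σ)) := by
  have hσ : 1 + p.σ ≠ 0 := by linarith [h.one_lt_sigma]
  have hα := h.α_pos.ne'
  have h1 : 2 * (p.γ * p.σ / (1 + p.σ)) = 1 + p.γ - p.β * p.σ := by
    have := h.gamma_mul
    field_simp
    linear_combination this
  set m := p.γ * p.σ / (1 + p.σ) with hm
  have h2 : m * (1 + p.σ) = p.γ * p.σ := by rw [hm]; field_simp
  constructor
  · simp [field]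
    linear_combination (p.α / 2 * u 0) * h1 + p.α * (p.σ - 1) / 2 * h1 + p.α / 2 * h.gamma_mul
  · simp [field]
    linear_combination (-1 / p.α) * (-u 0 / 2 * h1 - h2)

/-- Solutions that start in the box exist for all times: on each face the vector field does not
point outwards, so the global solutions of the clamped equation stay in the box. -/
theorem exists_forwardSolution_box {δ : ℝ} (hδ : 0 < δ) {φ : E3}
    (hφ : ∀ i, p.boxLo i ≤ φ i ∧ φ i ≤ p.boxHi i) :
    ∃ u, IsForwardSolution (p.field δ) u ∧ u 0 = φ := by
  have h1 := h.one_lt_sigma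
  have h2 := h.beta_lt_one
  have h3 := h.β_pos
  have h4 := h.γ_pos
  have hα := h.α_pos
  set K := clampBox p.boxLo p.boxHi with hK
  have hle : ∀ i, p.boxLo i ≤ p.boxHi i := fun i => ((h.boxLo_neg i).trans (h.boxHi_pos i)).le
  obtain ⟨u, hu0, hu⟩ := exists_solution_clampBox (contDiff_field (p := p) δ) hle φ
  set m := p.γ * p.σ / (1 + p.σ) with hm
  have hlo0 : p.boxLo 0 = 1 - p.σ := rfl
  have hlo1 : p.boxLo 1 = p.γ * p.β / (1 + p.β) - m := rfl
  have hlo2 : p.boxLo 2 = 1 - p.σ := rfl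
  have hhi0 : p.boxHi 0 = 1 / p.β - p.σ := rfl
  have hhi1 : p.boxHi 1 = p.γ / (2 * p.β) - m := rfl
  have hhi2 : p.boxHi 2 = 1 / p.β - p.σ := rfl
  have hβ1 : 1 < 1 / p.β := by rw [lt_div_iff₀ h3]; linarith
  have hface : ∀ v : E3, (∀ i, p.boxLo i ≤ v i ∧ v i ≤ p.boxHi i) → ∀ i,
      (v i = p.boxHi i → p.field δ v i ≤ 0) ∧ (v i = p.boxLo i → 0 ≤ p.field δ v i) := by
    intro v hv i
    obtain ⟨f0, f1⟩ := h.field_original δ v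
    have f2 : p.field δ v 2 = δ * (v 0 - v 2) := rfl
    have b0 := hv 0
    have b1 := hv 1
    have b2 := hv 2
    rw [hlo0, hhi0] at b0
    rw [hlo1, hhi1] at b1
    rw [hlo2, hhi2] at b2
    rw [← hm] at f0 f1
    have hl1 : 0 < p.γ * p.β / (1 + p.β) := by positivity
    fin_cases i
    · constructor <;> intro he
      · change p.field δ v 0 ≤ 0
        change v 0 = p.boxHi 0 at he
        rw [hhi0] at he
        have e : v 0 + p.σ = 1 / p.β := by linarith
        rw [f0, e]
        have : 1 / p.β + (v 1 + m) - 1 / p.β * (v 1 + m) - p.β * (1 / p.β) ^ 2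
            = (v 1 + m) * (1 - 1 / p.β) := by field_simp; ring
        rw [this]
        exact mul_nonpos_of_nonneg_of_nonpos hα.le
          (mul_nonpos_of_nonneg_of_nonpos (by linarith [b1.1]) (by linarith))
      · change 0 ≤ p.field δ v 0
        change v 0 = p.boxLo 0 at he
        rw [hlo0] at he
        have e : v 0 + p.σ = 1 := by linarith
        rw [f0, e]
        have : 1 + (v 1 + m) - 1 * (v 1 + m) - p.β * 1 ^ 2 = 1 - p.β := by ring
        rw [this]
        exact mul_nonneg hα.le (by linarith)
    · constructor <;> intro he
      · change p.field δ v 1 ≤ 0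
        change v 1 = p.boxHi 1 at he
        rw [hhi1] at he
        have e : v 1 + m = p.γ / (2 * p.β) := by linarith
        rw [f1, e]
        refine mul_nonpos_of_nonneg_of_nonpos (by positivity) ?_
        have e1 : 2 ≤ 1 + (v 0 + p.σ) := by linarith [b0.1]
        have e2 : v 2 + p.σ ≤ 1 / p.β := by linarith [b2.2]
        have e3 : p.γ / (2 * p.β) * 2 ≤ p.γ / (2 * p.β) * (1 + (v 0 + p.σ)) := by gcongr
        have e4 : p.γ * (v 2 + p.σ) ≤ p.γ * (1 / p.β) := by gcongr
        have e5 : p.γ / (2 * p.β) * 2 = p.γ * (1 / p.β) := by field_simp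
        linarith
      · change 0 ≤ p.field δ v 1
        change v 1 = p.boxLo 1 at he
        rw [hlo1] at he
        have e : v 1 + m = p.γ * p.β / (1 + p.β) := by linarith
        rw [f1, e]
        refine mul_nonneg (by positivity) ?_
        have e1 : 1 + (v 0 + p.σ) ≤ 1 + 1 / p.β := by linarith [b0.2]
        have e2 : 1 ≤ v 2 + p.σ := by linarith [b2.1]
        have e3 : p.γ * p.β / (1 + p.β) * (1 + (v 0 + p.σ))
            ≤ p.γ * p.β / (1 + p.β) * (1 + 1 / p.β) := by gcongr
        have e4 : p.γ * 1 ≤ p.γ * (v 2 + p.σ) := by gcongr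
        have e5 : p.γ * p.β / (1 + p.β) * (1 + 1 / p.β) = p.γ * 1 := by field_simp; ring
        linarith
    · constructor <;> intro he
      · change p.field δ v 2 ≤ 0
        change v 2 = p.boxHi 2 at he
        rw [hhi2] at he
        rw [f2, he]
        exact mul_nonpos_of_nonneg_of_nonpos hδ.le (by linarith [b0.2])
      · change 0 ≤ p.field δ v 2
        change v 2 = p.boxLo 2 at he
        rw [hlo2] at he
        rw [f2, he]
        exact mul_nonneg hδ.le (by linarith [b0.1])
  have hcoord : ∀ i t, HasDerivAt (fun t => u t i) (p.field δ (K (u t)) i) t := fun i t =>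
    (EuclideanSpace.proj i : E3 →L[ℝ] ℝ).hasFDerivAt.comp_hasDerivAt t (hu t)
  have hmem : ∀ t, 0 ≤ t → ∀ i, p.boxLo i ≤ u t i ∧ u t i ≤ p.boxHi i := by
    intro t ht i
    constructor
    · have := ODEAux.le_of_deriv_nonpos_of_lt (h := fun t => -u t i)
        (h' := fun t => -p.field δ (K (u t)) i) (a := 0) (c := -p.boxLo i)
        (fun t _ => (hcoord i t).neg.hasDerivWithinAt) (by simp only [hu0]; linarith [(hφ i).1])
        (fun t _ hlt => by
          have h5 : K (u t) i = p.boxLo i := by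
            simp only [hK, clampBox]
            rw [max_eq_left]
            exact (min_le_left _ _).trans (by linarith)
          linarith [(hface _ (fun j => clampBox_mem hle _ j) i).2 h5]) t ht
      linarith
    · refine ODEAux.le_of_deriv_nonpos_of_lt (h := fun t => u t i)
        (h' := fun t => p.field δ (K (u t)) i) (a := 0) (c := p.boxHi i)
        (fun t _ => (hcoord i t).hasDerivWithinAt) (by simp only [hu0]; exact (hφ i).2)
        (fun t _ hlt => ?_) t ht
      have h5 : K (u t) i = p.boxHi i := by
        simp only [hK, clampBox]
        rw [min_eq_right hlt.le, max_eq_right (hle i)]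
      exact (hface _ (fun j => clampBox_mem hle _ j) i).1 h5
  refine ⟨u, isForwardSolution_of_hasDerivAt fun t ht => ?_, hu0⟩
  have h5 := hu t
  rwa [clampBox_eq_self (hmem t ht)] at h5

/-- The neighbourhood in which solutions are followed is the invariant box, which does not depend on
`δ`. A solution that is eventually small tends to `0`, so its initial value is on the stable
manifold. -/
theorem hasDynamicTransition : HasDynamicTransition p.field p.δ₀ := by
  refine ⟨fun δ hδ => ?_, ?_⟩
  · obtain ⟨Q, hQ, hpos, -⟩ := h.exists_lyapunov (h.δ₀_pos.trans hδ) hδ.ne'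
    exact hQ.isAsymptoticallyStable (h.isQuadraticField δ) (contDiff_field δ) (hpos hδ)
  · refine ⟨{φ | ∀ i, p.boxLo i ≤ φ i ∧ φ i ≤ p.boxHi i}, ?_, fun δ hδ hlt => ?_⟩
    · have : ∀ᶠ φ : E3 in 𝓝 0, ∀ i, p.boxLo i ≤ φ i ∧ φ i ≤ p.boxHi i := by
        rw [eventually_all]
        intro i
        have hc : ContinuousAt (fun φ : E3 => φ i) 0 := by fun_prop
        filter_upwards [hc.eventually (lt_mem_nhds (h.boxLo_neg i)),
          hc.eventually (gt_mem_nhds (h.boxHi_pos i))] with φ h1 h2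
        exact ⟨h1.le, h2.le⟩
      exact this
    · obtain ⟨Q, hQ, -, hneg⟩ := h.exists_lyapunov hδ hlt.ne
      constructor
      · have := hQ.dimH_stableManifold_le (h.isQuadraticField δ) (contDiff_field δ) (hneg hlt)
        calc dimH (stableManifold (p.field δ)) + 1 ≤ 2 + 1 := by gcongr
          _ = 3 := by norm_num
      · obtain ⟨r, hr, htend⟩ := hQ.exists_radius_tendsto (h.isQuadraticField δ)
          (contDiff_field δ).continuous
        refine ⟨r, hr, fun φ hφ => ?_⟩
        obtain ⟨u, hu, hu0⟩ := h.exists_forwardSolution_box hδ hφ.1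
        refine ⟨u, hu, hu0, fun hev => hφ.2 ⟨u, hu, hu0, htend u hu ?_⟩⟩
        exact hev.mono fun t ht => (not_le.1 ht).le

end Admissible

end Params

end Oregonator


/-! ### Periodically forced slow–fast systems in the plane -/

namespace Hopf

open Real

/-- The state `(r, w, ν)`: a radius, the distance to the approximate centre manifold, and the scaled
control parameter, which does not change in time. -/
abbrev St := ℝ × ℝ × ℝ

/-- The box `|r - 1| ≤ 1/2`, `|w| ≤ 1`, `|ν - ν₀| ≤ 1`. -/
def box (ν₀ : ℝ) : Set St := Icc (1 / 2, -1, ν₀ - 1) (3 / 2, 1, ν₀ + 1)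

theorem mem_box {ν₀ : ℝ} {Y : St} : Y ∈ box ν₀ ↔
    (1 / 2 ≤ Y.1 ∧ Y.1 ≤ 3 / 2) ∧ (-1 ≤ Y.2.1 ∧ Y.2.1 ≤ 1) ∧ (ν₀ - 1 ≤ Y.2.2 ∧ Y.2.2 ≤ ν₀ + 1) := by
  simp only [box, mem_Icc, Prod.le_def]
  tauto

/-- A function of the angle and the state that is bounded and Lipschitz on the box, with
constant `C`. -/
structure IsTame (C ν₀ : ℝ) (h : ℝ → St → ℝ) : Prop where
  bound : ∀ θ, ∀ Y ∈ box ν₀, |h θ Y| ≤ C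
  lip : ∀ θ, ∀ Y ∈ box ν₀, ∀ Z ∈ box ν₀, |h θ Y - h θ Z| ≤ C * dist Y Z

/-- A system `r' = ε f`, `w' = -a w + ε g`, `ν' = 0`, `2π`-periodic in the angle `θ`, together with a
function `V = r² + ε V₁` that changes along solutions at the rate `ε² (m + w q + ε v)`. The constant
`C`, which bounds all data, and the leading rate `m` are parameters because they do not depend
on `ε`. -/
structure PolarSystem (C a ν₀ ε : ℝ) (m : St → ℝ) where
  f : ℝ → St → ℝ
  g : ℝ → St → ℝ
  V₁ : ℝ → St → ℝ
  q : ℝ → St → ℝ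
  v : ℝ → St → ℝ
  tame_f : IsTame C ν₀ f
  tame_g : IsTame C ν₀ g
  tame_V₁ : IsTame C ν₀ V₁
  tame_q : IsTame C ν₀ q
  tame_v : IsTame C ν₀ v
  cont_f : ∀ Y ∈ box ν₀, Continuous fun θ => f θ Y
  cont_g : ∀ Y ∈ box ν₀, Continuous fun θ => g θ Y
  per_f : ∀ θ Y, f (θ + 2 * π) Y = f θ Y
  per_g : ∀ θ Y, g (θ + 2 * π) Y = g θ Y
  per_V₁ : ∀ θ Y, V₁ (θ + 2 * π) Y = V₁ θ Y
  deriv_V : ∀ (Y : ℝ → St) θ, Y θ ∈ box ν₀ →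
    HasDerivAt Y (ε * f θ (Y θ), -a * (Y θ).2.1 + ε * g θ (Y θ), 0) θ →
    HasDerivAt (fun t => (Y t).1 ^ 2 + ε * V₁ t (Y t))
      (ε ^ 2 * (m (Y θ) + (Y θ).2.1 * q θ (Y θ) + ε * v θ (Y θ))) θ

/-- On the box, the function `m` depends on `r` and `ν` only, and is Lipschitz in `r`. -/
structure IsTameRate (C ν₀ : ℝ) (m : St → ℝ) : Prop where
  lip : ∀ Y ∈ box ν₀, ∀ Z ∈ box ν₀, Y.2.2 = Z.2.2 → |m Y - m Z| ≤ C * |Y.1 - Z.1|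

/-- The clamping map onto the box. -/
def clamp (ν₀ : ℝ) (Y : St) : St :=
  (max (1 / 2) (min Y.1 (3 / 2)), max (-1) (min Y.2.1 1), max (ν₀ - 1) (min Y.2.2 (ν₀ + 1)))

theorem clamp_mem (ν₀ : ℝ) (Y : St) : clamp ν₀ Y ∈ box ν₀ := by
  rw [mem_box]
  simp only [clamp]
  refine ⟨⟨le_max_left _ _, max_le (by norm_num) (min_le_right _ _)⟩,
    ⟨le_max_left _ _, max_le (by norm_num) (min_le_right _ _)⟩,
    ⟨le_max_left _ _, max_le (by linarith) (min_le_right _ _)⟩⟩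

theorem clamp_eq_self {ν₀ : ℝ} {Y : St} (hY : Y ∈ box ν₀) : clamp ν₀ Y = Y := by
  rw [mem_box] at hY
  obtain ⟨⟨h1, h2⟩, ⟨h3, h4⟩, h5, h6⟩ := hY
  simp only [clamp]
  rw [min_eq_left h2, max_eq_right h1, min_eq_left h4, max_eq_right h3, min_eq_left h6,
    max_eq_right h5]

theorem dist_clamp_le (ν₀ : ℝ) (Y Z : St) : dist (clamp ν₀ Y) (clamp ν₀ Z) ≤ dist Y Z := by
  have key : ∀ lo hi x y : ℝ, dist (max lo (min x hi)) (max lo (min y hi)) ≤ dist x y := by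
    intro lo hi x y
    have h1 : LipschitzWith 1 fun z : ℝ => max lo (min z hi) :=
      (LipschitzWith.id.min_const _).const_max _
    have h2 := h1.dist_le_mul x y
    rwa [NNReal.coe_one, one_mul] at h2
  simp only [Prod.dist_eq, clamp]
  exact max_le_max (key _ _ _ _) (max_le_max (key _ _ _ _) (key _ _ _ _))

/-- Solutions of a damped linear equation with small forcing are small, up to the decay of the
initial value. -/
theorem abs_le_of_damped {h e : ℝ → ℝ} {a η T : ℝ} (ha : 0 ≤ a) (hT : 0 ≤ T)
    (hd : ∀ t ∈ Icc 0 T, HasDerivAt h (-a * h t + e t) t) (he : ∀ t ∈ Icc 0 T, |e t| ≤ η) :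
    |h T| ≤ exp (-a * T) * |h 0| + η * T := by
  have hη : 0 ≤ η := (abs_nonneg _).trans (he 0 ⟨le_rfl, hT⟩)
  have h1 : ∀ t ∈ Icc 0 T, HasDerivWithinAt (fun t => exp (a * t) * h t) (exp (a * t) * e t)
      (Icc 0 T) t := fun t ht => by
    have h2 : HasDerivAt (fun t => exp (a * t)) (exp (a * t) * a) t := by
      simpa using ((hasDerivAt_id t).const_mul a).exp
    refine (h2.mul (hd t ht)).hasDerivWithinAt.congr_deriv ?_
    ring
  have h3 : ∀ t ∈ Icc 0 T, ‖exp (a * t) * e t‖ ≤ exp (a * T) * η := fun t ht => by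
    rw [norm_mul, norm_of_nonneg (exp_pos _).le]
    gcongr
    · exact ht.2
    · exact he t ht
  have h4 := (convex_Icc 0 T).norm_image_sub_le_of_norm_hasDerivWithin_le h1 h3
    (left_mem_Icc.2 hT) (right_mem_Icc.2 hT)
  simp only [mul_zero, exp_zero, one_mul, sub_zero, Real.norm_eq_abs, abs_of_nonneg hT] at h4
  have h5 : |exp (a * T) * h T| ≤ |h 0| + exp (a * T) * η * T := by
    have := abs_sub_abs_le_abs_sub (exp (a * T) * h T) (h 0)
    linarith
  rw [abs_mul, abs_of_pos (exp_pos _)] at h5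
  have h6 : exp (-a * T) * exp (a * T) = 1 := by rw [← exp_add]; simp
  calc |h T| = exp (-a * T) * (exp (a * T) * |h T|) := by rw [← mul_assoc, h6, one_mul]
    _ ≤ exp (-a * T) * (|h 0| + exp (a * T) * η * T) := by gcongr
    _ = exp (-a * T) * |h 0| + (exp (-a * T) * exp (a * T)) * η * T := by ring
    _ = _ := by rw [h6, one_mul]

namespace PolarSystem

variable {C a ν₀ ε : ℝ} {m : St → ℝ}

/-- The vector field on the box. -/
def field (S : PolarSystem C a ν₀ ε m) (θ : ℝ) (Y : St) : St :=
  (ε * S.f θ Y, -a * Y.2.1 + ε * S.g θ Y, 0)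

/-- The slowly varying function `V = r² + ε V₁`. -/
def V (S : PolarSystem C a ν₀ ε m) (θ : ℝ) (Y : St) : ℝ := Y.1 ^ 2 + ε * S.V₁ θ Y

theorem per_field (S : PolarSystem C a ν₀ ε m) (θ : ℝ) (Y : St) :
    S.field (θ + 2 * π) Y = S.field θ Y := by
  simp only [field, S.per_f, S.per_g]

theorem lip_field (S : PolarSystem C a ν₀ ε m) (ha : 0 < a) (hC : 0 < C) (hε : 0 < ε)
    (hε1 : ε ≤ 1) (θ : ℝ) {Y Z : St} (hY : Y ∈ box ν₀) (hZ : Z ∈ box ν₀) :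
    dist (S.field θ Y) (S.field θ Z) ≤ (a + C) * dist Y Z := by
  have h1 := S.tame_f.lip θ Y hY Z hZ
  have h2 := S.tame_g.lip θ Y hY Z hZ
  have h3 : |Y.2.1 - Z.2.1| ≤ dist Y Z :=
    (le_max_left _ _).trans (le_max_right (dist Y.1 Z.1) (dist Y.2 Z.2))
  have hd : 0 ≤ dist Y Z := dist_nonneg
  have h4 : ε * (C * dist Y Z) ≤ 1 * (C * dist Y Z) := by gcongr
  generalize dist Y Z = D at *
  simp only [field, Prod.dist_eq, Real.dist_eq, sub_self, abs_zero]
  refine max_le ?_ (max_le ?_ (by positivity))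
  · rw [← mul_sub, abs_mul, abs_of_pos hε]
    have : ε * |S.f θ Y - S.f θ Z| ≤ ε * (C * D) := by gcongr
    have : 0 ≤ a * D := by positivity
    linarith
  · have e1 : -a * Y.2.1 + ε * S.g θ Y - (-a * Z.2.1 + ε * S.g θ Z)
        = -(a * (Y.2.1 - Z.2.1)) + ε * (S.g θ Y - S.g θ Z) := by ring
    rw [e1]
    refine (abs_add_le _ _).trans ?_
    rw [abs_neg, abs_mul, abs_mul, abs_of_pos hε, abs_of_pos ha]
    have : ε * |S.g θ Y - S.g θ Z| ≤ ε * (C * D) := by gcongr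
    have : a * |Y.2.1 - Z.2.1| ≤ a * D := by gcongr
    linarith

theorem norm_field_le (S : PolarSystem C a ν₀ ε m) (ha : 0 < a) (hε : 0 < ε)
    (hε1 : ε ≤ 1) (θ : ℝ) {Y : St} (hY : Y ∈ box ν₀) : ‖S.field θ Y‖ ≤ a + C := by
  have h1 := S.tame_f.bound θ Y hY
  have h2 := S.tame_g.bound θ Y hY
  have hC : 0 ≤ C := (abs_nonneg _).trans h1
  have h3 : |Y.2.1| ≤ 1 := abs_le.2 (mem_box.1 hY).2.1
  have h4 : ∀ x : ℝ, |x| ≤ C → ε * |x| ≤ C := fun x hx => by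
    calc ε * |x| ≤ 1 * C := by gcongr
      _ = C := one_mul C
  simp only [field, Prod.norm_def, norm_zero, Real.norm_eq_abs]
  refine max_le ?_ (max_le ?_ (by positivity))
  · rw [abs_mul, abs_of_pos hε]
    linarith [h4 _ h1]
  · refine (abs_add_le _ _).trans ?_
    rw [abs_mul, abs_mul, abs_of_pos hε, abs_neg, abs_of_pos ha]
    have : a * |Y.2.1| ≤ a * 1 := by gcongr
    linarith [h4 _ h2]

theorem lip_clampField (S : PolarSystem C a ν₀ ε m) (ha : 0 < a) (hC : 0 < C) (hε : 0 < ε)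
    (hε1 : ε ≤ 1) (θ : ℝ) :
    LipschitzWith ⟨a + C, by positivity⟩ fun Y => S.field θ (clamp ν₀ Y) :=
  LipschitzWith.of_dist_le_mul fun Y Z => by
    refine (S.lip_field ha hC hε hε1 θ (clamp_mem _ _) (clamp_mem _ _)).trans ?_
    change _ ≤ (a + C) * dist Y Z
    gcongr
    exact dist_clamp_le _ _ _

/-- The clamped vector field has global solutions. -/
theorem exists_flow (S : PolarSystem C a ν₀ ε m) (ha : 0 < a) (hC : 0 < C) (hε : 0 < ε)
    (hε1 : ε ≤ 1) (θ₀ : ℝ) (Y₀ : St) : ∃ Y : ℝ → St, Y θ₀ = Y₀ ∧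
      ∀ θ, HasDerivAt Y (S.field θ (clamp ν₀ (Y θ))) θ := by
  refine ODEAux.exists_global_solution (f := fun θ Y => S.field θ (clamp ν₀ Y))
    (S.lip_clampField ha hC hε hε1) (fun Y => ?_)
    (fun θ Y => S.norm_field_le ha hε hε1 θ (clamp_mem _ _)) θ₀ Y₀
  have h1 := S.cont_f _ (clamp_mem ν₀ Y)
  have h2 := S.cont_g _ (clamp_mem ν₀ Y)
  simp only [field]
  fun_prop

theorem dist_V_le (S : PolarSystem C a ν₀ ε m) (hε : 0 < ε) (hε1 : ε ≤ 1) (θ : ℝ)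
    {Y Z : St} (hY : Y ∈ box ν₀) (hZ : Z ∈ box ν₀) :
    |S.V θ Y - S.V θ Z| ≤ (3 + C) * dist Y Z := by
  have h1 := S.tame_V₁.lip θ Y hY Z hZ
  have h3 : |Y.1 - Z.1| ≤ dist Y Z := le_max_left (dist Y.1 Z.1) (dist Y.2 Z.2)
  have hY' := (mem_box.1 hY).1
  have hZ' := (mem_box.1 hZ).1
  have e1 : S.V θ Y - S.V θ Z = (Y.1 + Z.1) * (Y.1 - Z.1) + ε * (S.V₁ θ Y - S.V₁ θ Z) := by
    simp only [V]; ring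
  have hd : 0 ≤ dist Y Z := dist_nonneg
  rw [e1]
  refine (abs_add_le _ _).trans ?_
  rw [abs_mul, abs_mul, abs_of_pos hε, abs_of_pos (by linarith : 0 < Y.1 + Z.1)]
  have h5 : (Y.1 + Z.1) * |Y.1 - Z.1| ≤ 3 * dist Y Z := by
    have := abs_nonneg (Y.1 - Z.1)
    gcongr
    linarith
  have h6 : ε * |S.V₁ θ Y - S.V₁ θ Z| ≤ 1 * (C * dist Y Z) := by gcongr
  linarith

/-- For given `w` and `ν`, the radius is determined by the value of `V`. -/
theorem fst_eq_of_V_eq (S : PolarSystem C a ν₀ ε m) (hε : 0 < ε) (hεC : ε * C < 1) (θ : ℝ)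
    {Y Z : St} (hY : Y ∈ box ν₀) (hZ : Z ∈ box ν₀) (h2 : Y.2 = Z.2) (hV : S.V θ Y = S.V θ Z) :
    Y.1 = Z.1 := by
  have h1 := S.tame_V₁.lip θ Y hY Z hZ
  have hY' := (mem_box.1 hY).1
  have hZ' := (mem_box.1 hZ).1
  have hd : dist Y Z = |Y.1 - Z.1| := by
    rw [Prod.dist_eq, h2, dist_self, Real.dist_eq, max_eq_left (abs_nonneg _)]
  rw [hd] at h1
  have e1 : (Y.1 + Z.1) * (Y.1 - Z.1) = -(ε * (S.V₁ θ Y - S.V₁ θ Z)) := by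
    simp only [V] at hV; linarith
  have e2 : (Y.1 + Z.1) * |Y.1 - Z.1| ≤ ε * C * |Y.1 - Z.1| := by
    rw [← abs_of_pos (by linarith : 0 < Y.1 + Z.1), ← abs_mul, e1, abs_neg, abs_mul,
      abs_of_pos hε, mul_assoc]
    gcongr
  by_contra hne
  have hpos : 0 < |Y.1 - Z.1| := abs_pos.2 (sub_ne_zero.2 hne)
  have := le_of_mul_le_mul_right e2 hpos
  linarith

end PolarSystem

end Hopf


/-! ### Existence of periodic solutions -/

namespace Hopf

open Real

theorem hasDerivAt_components {Y : ℝ → St} {Y' : St} {θ : ℝ} (h : HasDerivAt Y Y' θ) :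
    HasDerivAt (fun t => (Y t).1) Y'.1 θ ∧ HasDerivAt (fun t => (Y t).2.1) Y'.2.1 θ ∧
      HasDerivAt (fun t => (Y t).2.2) Y'.2.2 θ :=
  ⟨(ContinuousLinearMap.fst ℝ ℝ (ℝ × ℝ)).hasFDerivAt.comp_hasDerivAt θ h,
    ((ContinuousLinearMap.fst ℝ ℝ ℝ).comp
      (ContinuousLinearMap.snd ℝ ℝ (ℝ × ℝ))).hasFDerivAt.comp_hasDerivAt θ h,
    ((ContinuousLinearMap.snd ℝ ℝ ℝ).comp
      (ContinuousLinearMap.snd ℝ ℝ (ℝ × ℝ))).hasFDerivAt.comp_hasDerivAt θ h⟩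

theorem eventually_mul_le (K : ℝ) {c : ℝ} (hc : 0 < c) : ∀ᶠ ε in 𝓝[>] (0 : ℝ), K * ε ≤ c := by
  have h : Tendsto (fun ε : ℝ => K * ε) (𝓝 0) (𝓝 0) := by
    simpa using (continuous_const_mul K).tendsto (0 : ℝ)
  exact ((h.mono_left nhdsWithin_le_nhds).eventually (gt_mem_nhds hc)).mono fun ε hε => le_of_lt hε

namespace PolarSystem

variable {C a ν₀ ε : ℝ} {m : St → ℝ} (S : PolarSystem C a ν₀ ε m)

/-- Initial values from which the flow stays in the box for one period. -/
def IsStart (ν₀ : ℝ) (Y : St) : Prop := |Y.1 - 1| ≤ 1 / 4 ∧ |Y.2.1| ≤ 1 ∧ |Y.2.2 - ν₀| ≤ 1 / 4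

/-- A solution of the clamped system. -/
def IsFlow (Y : ℝ → St) : Prop := ∀ θ, HasDerivAt Y (S.field θ (clamp ν₀ (Y θ))) θ

variable {S} in
theorem IsFlow.snd_snd {Y : ℝ → St} (hY : S.IsFlow Y) (θ : ℝ) : (Y θ).2.2 = (Y 0).2.2 :=
  is_const_of_deriv_eq_zero (f := fun θ => (Y θ).2.2)
    (fun t => (hasDerivAt_components (hY t)).2.2.differentiableAt)
    (fun t => (hasDerivAt_components (hY t)).2.2.deriv) θ 0

variable {S} in
theorem IsFlow.abs_fst_sub {Y : ℝ → St} (hY : S.IsFlow Y) (hε : 0 < ε) {θ : ℝ}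
    (hθ : θ ∈ Icc 0 (2 * π)) : |(Y θ).1 - (Y 0).1| ≤ 2 * π * C * ε := by
  have h1 := (convex_Icc 0 (2 * π)).norm_image_sub_le_of_norm_hasDerivWithin_le
    (f := fun t => (Y t).1) (f' := fun t => ε * S.f t (clamp ν₀ (Y t))) (C := ε * C)
    (fun t _ => (hasDerivAt_components (hY t)).1.hasDerivWithinAt)
    (fun t _ => by
      rw [norm_mul, norm_of_nonneg hε.le]
      have := S.tame_f.bound t _ (clamp_mem ν₀ (Y t))
      rw [Real.norm_eq_abs]
      gcongr) (left_mem_Icc.2 (by positivity)) hθ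
  simp only [Real.norm_eq_abs, sub_zero, abs_of_nonneg hθ.1] at h1
  have hC : 0 ≤ C := (abs_nonneg _).trans (S.tame_f.bound 0 _ (clamp_mem ν₀ (Y 0)))
  calc |(Y θ).1 - (Y 0).1| ≤ ε * C * θ := h1
    _ ≤ ε * C * (2 * π) := by gcongr; exact hθ.2
    _ = _ := by ring

variable {S} in
theorem IsFlow.abs_snd_le {Y : ℝ → St} (hY : S.IsFlow Y) (hε : 0 < ε) (hεa : C * ε ≤ a)
    (h0 : |(Y 0).2.1| ≤ 1) {θ : ℝ} (hθ : 0 ≤ θ) : |(Y θ).2.1| ≤ 1 := by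
  have hg : ∀ t, |ε * S.g t (clamp ν₀ (Y t))| ≤ a := fun t => by
    rw [abs_mul, abs_of_pos hε]
    have := S.tame_g.bound t _ (clamp_mem ν₀ (Y t))
    calc ε * |S.g t (clamp ν₀ (Y t))| ≤ ε * C := by gcongr
      _ ≤ a := by linarith
  have hd : ∀ t, HasDerivAt (fun t => (Y t).2.1)
      (-a * (clamp ν₀ (Y t)).2.1 + ε * S.g t (clamp ν₀ (Y t))) t := fun t =>
    (hasDerivAt_components (hY t)).2.1
  rw [abs_le] at h0 ⊢
  constructor
  · have := ODEAux.le_of_deriv_nonpos_of_lt (h := fun t => -(Y t).2.1)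
      (h' := fun t => -(-a * (clamp ν₀ (Y t)).2.1 + ε * S.g t (clamp ν₀ (Y t)))) (a := 0) (c := 1)
      (fun t _ => (hd t).neg.hasDerivWithinAt) (by linarith [h0.1]) (fun t _ hlt => by
        have e : (clamp ν₀ (Y t)).2.1 = -1 := by
          simp only [clamp]
          rw [max_eq_left]
          exact (min_le_left _ _).trans (by linarith)
        rw [e]
        linarith [(abs_le.1 (hg t)).1]) θ hθ
    linarith
  · refine ODEAux.le_of_deriv_nonpos_of_lt (h := fun t => (Y t).2.1)
      (h' := fun t => -a * (clamp ν₀ (Y t)).2.1 + ε * S.g t (clamp ν₀ (Y t))) (a := 0) (c := 1)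
      (fun t _ => (hd t).hasDerivWithinAt) h0.2 (fun t _ hlt => ?_) θ hθ
    have e : (clamp ν₀ (Y t)).2.1 = 1 := by
      simp only [clamp]
      rw [min_eq_right hlt.le, max_eq_right (by norm_num)]
    rw [e]
    linarith [(abs_le.1 (hg t)).2]

variable {S} in
theorem IsFlow.mem_box {Y : ℝ → St} (hY : S.IsFlow Y) (hε : 0 < ε) (hεa : C * ε ≤ a)
    (hεC : 2 * π * C * ε ≤ 1 / 4) (h0 : IsStart ν₀ (Y 0)) {θ : ℝ} (hθ : θ ∈ Icc 0 (2 * π)) :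
    Y θ ∈ box ν₀ := by
  have h1 := abs_le.1 (hY.abs_fst_sub hε hθ)
  have h2 := abs_le.1 (hY.abs_snd_le hε hεa h0.2.1 hθ.1)
  have h3 := hY.snd_snd θ
  have h4 := abs_le.1 h0.1
  have h5 := abs_le.1 h0.2.2
  rw [Hopf.mem_box, h3]
  refine ⟨⟨?_, ?_⟩, h2, ?_, ?_⟩ <;> linarith

variable {S} in
theorem IsFlow.dist_le {Y Z : ℝ → St} (hY : S.IsFlow Y) (hZ : S.IsFlow Z) (ha : 0 < a) (hC : 0 < C)
    (hε : 0 < ε) (hε1 : ε ≤ 1) {θ : ℝ} (hθ : θ ∈ Icc 0 (2 * π)) :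
    dist (Y θ) (Z θ) ≤ dist (Y 0) (Z 0) * exp ((a + C) * (2 * π)) := by
  have h1 := dist_le_of_trajectories_ODE (v := fun θ Y => S.field θ (clamp ν₀ Y))
    (S.lip_clampField ha hC hε hε1) (a := 0) (b := 2 * π)
    (fun t _ => (hY t).continuousAt.continuousWithinAt) (fun t _ => (hY t).hasDerivWithinAt)
    (fun t _ => (hZ t).continuousAt.continuousWithinAt) (fun t _ => (hZ t).hasDerivWithinAt)
    le_rfl θ hθ
  refine h1.trans (mul_le_mul_of_nonneg_left (Real.exp_le_exp.2 ?_) dist_nonneg)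
  change (a + C) * (θ - 0) ≤ _
  rw [sub_zero]
  exact mul_le_mul_of_nonneg_left hθ.2 (by positivity)

theorem dist_eq_of_eq {Y Z : St} (h1 : Y.1 = Z.1) (h3 : Y.2.2 = Z.2.2) :
    dist Y Z = |Y.2.1 - Z.2.1| := by
  rw [Prod.dist_eq, Prod.dist_eq, h1, h3, dist_self, dist_self, Real.dist_eq,
    max_eq_left (a := |Y.2.1 - Z.2.1|) (b := 0) (abs_nonneg _), max_eq_right (abs_nonneg _)]

variable {S} in
/-- For fixed `r` and `ν`, the time-`2π` map contracts the stable coordinate `w`. -/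
theorem IsFlow.contraction {Y Z : ℝ → St} (hY : S.IsFlow Y) (hZ : S.IsFlow Z) (ha : 0 < a)
    (hC : 0 < C) (hε : 0 < ε) (hε1 : ε ≤ 1) (hεa : C * ε ≤ a) (hεC : 2 * π * C * ε ≤ 1 / 4)
    (hY0 : IsStart ν₀ (Y 0)) (hZ0 : IsStart ν₀ (Z 0)) (h1 : (Y 0).1 = (Z 0).1)
    (h3 : (Y 0).2.2 = (Z 0).2.2) :
    |(Y (2 * π)).2.1 - (Z (2 * π)).2.1| ≤
      (exp (-a * (2 * π)) + C * exp ((a + C) * (2 * π)) * (2 * π) * ε)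
        * |(Y 0).2.1 - (Z 0).2.1| := by
  have hd0 : dist (Y 0) (Z 0) = |(Y 0).2.1 - (Z 0).2.1| := dist_eq_of_eq h1 h3
  have := abs_le_of_damped (h := fun t => (Y t).2.1 - (Z t).2.1) (a := a) (T := 2 * π)
    (e := fun t => ε * (S.g t (Y t) - S.g t (Z t)))
    (η := ε * (C * (|(Y 0).2.1 - (Z 0).2.1| * exp ((a + C) * (2 * π))))) ha.le (by positivity)
    (fun t ht => by
      have e1 := (hasDerivAt_components (hY t)).2.1
      have e2 := (hasDerivAt_components (hZ t)).2.1
      rw [clamp_eq_self (hY.mem_box hε hεa hεC hY0 ht)] at e1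
      rw [clamp_eq_self (hZ.mem_box hε hεa hεC hZ0 ht)] at e2
      refine (e1.sub e2).congr_deriv ?_
      simp only [field]
      ring)
    (fun t ht => by
      rw [abs_mul, abs_of_pos hε]
      have e1 := S.tame_g.lip t _ (hY.mem_box hε hεa hεC hY0 ht) _ (hZ.mem_box hε hεa hεC hZ0 ht)
      have e2 := hY.dist_le hZ ha hC hε hε1 ht
      rw [hd0] at e2
      refine mul_le_mul_of_nonneg_left (e1.trans ?_) hε.le
      gcongr)
  refine this.trans (le_of_eq ?_)
  ring

variable {S} in
/-- The stable coordinate after one period is small up to a contraction. -/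
theorem IsFlow.abs_snd_damped {Y : ℝ → St} (hY : S.IsFlow Y) (ha : 0 < a) (hε : 0 < ε)
    (hεa : C * ε ≤ a) (hεC : 2 * π * C * ε ≤ 1 / 4) (hY0 : IsStart ν₀ (Y 0)) {θ : ℝ}
    (hθ : θ ∈ Icc 0 (2 * π)) : |(Y θ).2.1| ≤ exp (-a * θ) * |(Y 0).2.1| + ε * C * θ := by
  refine abs_le_of_damped (h := fun t => (Y t).2.1) (e := fun t => ε * S.g t (Y t)) ha.le hθ.1
    (fun t ht => ?_) (fun t ht => ?_)
  · have e1 := (hasDerivAt_components (hY t)).2.1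
    rwa [clamp_eq_self (hY.mem_box hε hεa hεC hY0 ⟨ht.1, ht.2.trans hθ.2⟩)] at e1
  · rw [abs_mul, abs_of_pos hε]
    have := S.tame_g.bound t _ (hY.mem_box hε hεa hεC hY0 ⟨ht.1, ht.2.trans hθ.2⟩)
    gcongr

variable {S} in
/-- Over one period, `V` changes by about `2π ε² m`. -/
theorem IsFlow.V_increment {Y : ℝ → St} (hY : S.IsFlow Y) (hm : IsTameRate C ν₀ m) (hC : 0 < C)
    (hε : 0 < ε) (hεa : C * ε ≤ a) (hεC : 2 * π * C * ε ≤ 1 / 4)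
    (hY0 : IsStart ν₀ (Y 0)) {M₁ : ℝ} (hM₁ : ∀ θ ∈ Icc 0 (2 * π), |(Y θ).2.1| ≤ M₁ * ε) :
    ∃ μ, S.V (2 * π) (Y (2 * π)) - S.V 0 (Y 0) = 2 * π * ε ^ 2 * μ ∧
      |μ - m (Y 0)| ≤ (2 * π * C ^ 2 + M₁ * C + C) * ε := by
  have hbox : ∀ θ ∈ Icc 0 (2 * π), Y θ ∈ box ν₀ := fun θ hθ => hY.mem_box hε hεa hεC hY0 hθ
  have hd : ∀ θ ∈ Icc 0 (2 * π), HasDerivAt (fun t => S.V t (Y t))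
      (ε ^ 2 * (m (Y θ) + (Y θ).2.1 * S.q θ (Y θ) + ε * S.v θ (Y θ))) θ := fun θ hθ => by
    have h1 := hY θ
    rw [clamp_eq_self (hbox θ hθ)] at h1
    exact S.deriv_V Y θ (hbox θ hθ) h1
  have hpi : 0 < 2 * π := by positivity
  obtain ⟨θ, hθ, heq⟩ := exists_hasDerivAt_eq_slope (fun t => S.V t (Y t)) _ hpi
    (fun t ht => (hd t ht).continuousAt.continuousWithinAt)
    (fun t ht => hd t (Ioo_subset_Icc_self ht))
  have hθ' := Ioo_subset_Icc_self hθ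
  refine ⟨m (Y θ) + (Y θ).2.1 * S.q θ (Y θ) + ε * S.v θ (Y θ), ?_, ?_⟩
  · rw [sub_zero, eq_div_iff hpi.ne'] at heq
    linarith
  · have h1 := hm.lip _ (hbox θ hθ') _ (hbox 0 ⟨le_rfl, hpi.le⟩) (hY.snd_snd θ)
    have h2 := hY.abs_fst_sub hε hθ'
    have h3 := S.tame_q.bound θ _ (hbox θ hθ')
    have h4 := S.tame_v.bound θ _ (hbox θ hθ')
    have h5 := hM₁ θ hθ'
    have e1 : C * |(Y θ).1 - (Y 0).1| ≤ C * (2 * π * C * ε) := by gcongr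
    have e2 : |(Y θ).2.1 * S.q θ (Y θ)| ≤ M₁ * ε * C := by
      rw [abs_mul]
      exact mul_le_mul h5 h3 (abs_nonneg _) ((abs_nonneg _).trans h5)
    have e3 : |ε * S.v θ (Y θ)| ≤ ε * C := by
      rw [abs_mul, abs_of_pos hε]; gcongr
    have e4 : m (Y θ) + (Y θ).2.1 * S.q θ (Y θ) + ε * S.v θ (Y θ) - m (Y 0)
        = (m (Y θ) - m (Y 0)) + (Y θ).2.1 * S.q θ (Y θ) + ε * S.v θ (Y θ) := by ring
    rw [e4]
    have := abs_add_three (m (Y θ) - m (Y 0)) ((Y θ).2.1 * S.q θ (Y θ)) (ε * S.v θ (Y θ))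
    nlinarith

end PolarSystem

/-- A path of initial data `(r, ν) = (R l, n l)` through `(1, ν₀)` along which the rate `m` changes
sign with nonzero speed. -/
structure IsTransversePath (ν₀ c : ℝ) (m : St → ℝ) (R n : ℝ → ℝ) (s : ℝ) : Prop where
  R_zero : R 0 = 1
  n_zero : n 0 = ν₀
  R_lip : ∀ x y, |R x - R y| ≤ |x - y|
  n_lip : ∀ x y, |n x - n y| ≤ |x - y|
  abs_s : |s| = 1
  pos : ∀ l, 0 ≤ l → l ≤ 1 / 4 → ∀ w, c * l ≤ s * m (R l, w, n l)
  neg : ∀ l, 0 ≤ l → l ≤ 1 / 4 → ∀ w, s * m (R (-l), w, n (-l)) ≤ -(c * l)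

/-- A `2π`-periodic solution in the box that is `M ε`-close to `r = 1`, `w = 0`. -/
structure PolarSystem.IsPeriodicOrbit {C a ν₀ ε : ℝ} {m : St → ℝ} (S : PolarSystem C a ν₀ ε m)
    (M : ℝ) (Y : ℝ → St) : Prop where
  mem_box : ∀ θ, Y θ ∈ box ν₀
  deriv : ∀ θ, HasDerivAt Y (S.field θ (Y θ)) θ
  periodic : ∀ θ, Y (θ + 2 * π) = Y θ
  abs_fst : ∀ θ, |(Y θ).1 - 1| ≤ M * ε
  abs_snd : ∀ θ, |(Y θ).2.1| ≤ M * ε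

open PolarSystem in
/-- Existence of periodic solutions. For each value of the path parameter the contracting coordinate
has a unique fixed point, depending continuously on the parameter; the increment of `V` over one
period then vanishes for some parameter value, by the intermediate value theorem. -/
theorem exists_isPeriodicOrbit {C a ν₀ c s : ℝ} (ha : 0 < a) (hC : 0 < C) (hc : 0 < c) {m : St → ℝ}
    (hm : IsTameRate C ν₀ m) {R n : ℝ → ℝ} (hp : IsTransversePath ν₀ c m R n s) :
    ∃ M > 0, ∀ᶠ ε in 𝓝[>] (0 : ℝ), ∀ S : PolarSystem C a ν₀ ε m,
      ∃ l Y, |l| ≤ M * ε ∧ S.IsPeriodicOrbit M Y ∧ (Y 0).1 = R l ∧ ∀ θ, (Y θ).2.2 = n l := by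
  set E := exp ((a + C) * (2 * π)) with hE
  set κ₁ := exp (-a * (2 * π)) with hκ₁
  have hκ₁1 : κ₁ < 1 := exp_lt_one_iff.2 (by have := pi_pos; nlinarith)
  have hκ₁0 : 0 < κ₁ := exp_pos _
  -- on the solutions considered `|w| ≤ M₁ ε`
  set M₁ := 2 * π * C / (1 - κ₁) + 2 * π * C with hM₁
  have h1κ : 0 < 1 - κ₁ := by linarith
  have hpi := pi_pos
  have hM₁0 : 0 < M₁ := by positivity
  -- the mean rate of change of `V` is `ε² m` up to `M₂ ε³`
  set M₂ := 2 * π * C ^ 2 + M₁ * C + C with hM₂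
  have hM₂0 : 0 < M₂ := by positivity
  -- at the parameters `±M₃ ε` the rate `m` is large enough to determine the sign of the increment
  set M₃ := M₂ / c + 1 with hM₃
  have hM₃0 : 0 < M₃ := by positivity
  have hcM : M₂ < c * M₃ := by rw [hM₃]; field_simp; linarith
  refine ⟨M₃ + 2 * π * C + M₁, by positivity, ?_⟩
  filter_upwards [self_mem_nhdsWithin, eventually_mul_le 1 one_pos,
    eventually_mul_le (2 * π * C) (by norm_num : (0 : ℝ) < 1 / 4), eventually_mul_le C ha,
    eventually_mul_le M₃ (by norm_num : (0 : ℝ) < 1 / 4), eventually_mul_le C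
      (by norm_num : (0 : ℝ) < 1 / 2), eventually_mul_le (C * E * (2 * π))
      (by linarith : 0 < (1 - κ₁) / 2)] with ε hε0 hε1 hεC hεa hε3 hεC1 hεE S
  have hε : 0 < ε := hε0
  rw [one_mul] at hε1
  have hex : ∀ Y₀ : St, ∃ Y : ℝ → St, Y 0 = Y₀ ∧ S.IsFlow Y := fun Y₀ =>
    S.exists_flow ha hC hε hε1 0 Y₀
  choose Φ hΦ0 hΦ using hex
  have hRn : ∀ l, |l| ≤ 1 / 4 → |R l - 1| ≤ 1 / 4 ∧ |n l - ν₀| ≤ 1 / 4 := fun l hl => by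
    have h1 := hp.R_lip l 0
    have h2 := hp.n_lip l 0
    rw [hp.R_zero, sub_zero] at h1
    rw [hp.n_zero, sub_zero] at h2
    exact ⟨h1.trans hl, h2.trans hl⟩
  have hstart : ∀ l w, |l| ≤ 1 / 4 → |w| ≤ 1 → IsStart ν₀ (Φ (R l, w, n l) 0) := fun l w hl hw => by
    rw [hΦ0]
    exact ⟨(hRn l hl).1, hw, (hRn l hl).2⟩
  set κ := κ₁ + C * E * (2 * π) * ε with hκ
  have hκ1 : κ < 1 := by linarith
  have h2pi : (2 * π) ∈ Icc 0 (2 * π) := right_mem_Icc.2 (by positivity)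
  -- the fixed points of the contracting coordinate
  have hcontr : ∀ l w w', |l| ≤ 1 / 4 → |w| ≤ 1 → |w'| ≤ 1 →
      |(Φ (R l, w, n l) (2 * π)).2.1 - (Φ (R l, w', n l) (2 * π)).2.1| ≤ κ * |w - w'| := by
    intro l w w' hl hw hw'
    have := (hΦ (R l, w, n l)).contraction (hΦ (R l, w', n l)) ha hC hε hε1 hεa hεC
      (hstart l w hl hw) (hstart l w' hl hw') (by rw [hΦ0, hΦ0]) (by rw [hΦ0, hΦ0])
    rwa [hΦ0, hΦ0] at this
  have hfix : ∀ l, ∃ w, |l| ≤ 1 / 4 → |w| ≤ 1 ∧ (Φ (R l, w, n l) (2 * π)).2.1 = w := by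
    intro l
    by_cases hl : |l| ≤ 1 / 4
    swap
    · exact ⟨0, fun h => absurd h hl⟩
    have hself : ∀ w, |w| ≤ 1 → |(Φ (R l, w, n l) (2 * π)).2.1| ≤ 1 := fun w hw =>
      (hΦ _).abs_snd_le hε hεa (by rw [hΦ0]; exact hw) (by positivity)
    have hcont : ContinuousOn (fun w => (Φ (R l, w, n l) (2 * π)).2.1 - w) (Icc (-1) 1) := by
      refine ContinuousOn.sub ?_ continuousOn_id
      refine LipschitzOnWith.continuousOn (K := ⟨κ, by positivity⟩) ?_
      refine LipschitzOnWith.of_dist_le_mul fun w hw w' hw' => ?_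
      rw [Real.dist_eq, Real.dist_eq]
      exact hcontr l w w' hl (abs_le.2 hw) (abs_le.2 hw')
    obtain ⟨w, hw, hw0⟩ : (0 : ℝ) ∈ (fun w => (Φ (R l, w, n l) (2 * π)).2.1 - w) '' Icc (-1) 1 := by
      refine intermediate_value_Icc' (by norm_num) hcont ⟨?_, ?_⟩
      · have := (abs_le.1 (hself 1 (by norm_num))).2
        linarith
      · have := (abs_le.1 (hself (-1) (by norm_num))).1
        linarith
    exact ⟨w, fun _ => ⟨abs_le.2 hw, sub_eq_zero.1 hw0⟩⟩
  choose W hW using hfix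
  set Ψ : ℝ → ℝ → St := fun l => Φ (R l, W l, n l) with hΨ
  have hΨ0 : ∀ l, Ψ l 0 = (R l, W l, n l) := fun l => hΦ0 _
  have hΨf : ∀ l, S.IsFlow (Ψ l) := fun l => hΦ _
  have hΨs : ∀ l, |l| ≤ 1 / 4 → IsStart ν₀ (Ψ l 0) := fun l hl => hstart l (W l) hl (hW l hl).1
  have hΨbox : ∀ l, |l| ≤ 1 / 4 → ∀ θ ∈ Icc 0 (2 * π), Ψ l θ ∈ box ν₀ := fun l hl θ hθ =>
    (hΨf l).mem_box hε hεa hεC (hΨs l hl) hθ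
  have hW1 : ∀ l, |l| ≤ 1 / 4 → |W l| ≤ 2 * π * C / (1 - κ₁) * ε := fun l hl => by
    have h1 := (hΨf l).abs_snd_damped ha hε hεa hεC (hΨs l hl) h2pi
    rw [hΨ0] at h1
    have h2 : (Ψ l (2 * π)).2.1 = W l := (hW l hl).2
    rw [h2] at h1
    have h3 : |W l| * (1 - κ₁) ≤ 2 * π * C * ε := by
      simp only [hκ₁]
      linarith
    rw [div_mul_eq_mul_div, le_div_iff₀ h1κ]
    exact h3
  have hΨw : ∀ l, |l| ≤ 1 / 4 → ∀ θ ∈ Icc 0 (2 * π), |(Ψ l θ).2.1| ≤ M₁ * ε := fun l hl θ hθ => by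
    have h1 := (hΨf l).abs_snd_damped ha hε hεa hεC (hΨs l hl) hθ
    rw [hΨ0] at h1
    have h2 := hW1 l hl
    have h3 : exp (-a * θ) ≤ 1 := exp_le_one_iff.2 (by nlinarith [hθ.1])
    have h4 : exp (-a * θ) * |W l| ≤ 1 * |W l| := by gcongr
    have h5 : ε * C * θ ≤ ε * C * (2 * π) := by have := hθ.2; gcongr
    rw [hM₁, add_mul]
    simp only at h1
    linarith
  -- the fixed points depend continuously on the parameter
  have hdist0 : ∀ l l', dist (R l, W l', n l) (R l', W l', n l') ≤ |l - l'| := fun l l' => by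
    rw [Prod.dist_eq, Prod.dist_eq, dist_self]
    exact max_le (hp.R_lip l l') (max_le (abs_nonneg _) (hp.n_lip l l'))
  have hWlip : ∀ l l', |l| ≤ 1 / 4 → |l'| ≤ 1 / 4 → |W l - W l'| ≤ E / (1 - κ) * |l - l'| := by
    intro l l' hl hl'
    have h1 := hcontr l (W l) (W l') hl (hW l hl).1 (hW l' hl').1
    have h2 := (hΦ (R l, W l', n l)).dist_le (hΦ (R l', W l', n l')) ha hC hε hε1 h2pi
    rw [hΦ0, hΦ0] at h2
    have h3 : |(Φ (R l, W l', n l) (2 * π)).2.1 - (Φ (R l', W l', n l') (2 * π)).2.1|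
        ≤ |l - l'| * E :=
      ((le_max_left _ _).trans (le_max_right _ _)).trans
        (h2.trans (mul_le_mul_of_nonneg_right (hdist0 l l') (exp_pos _).le))
    rw [(hW l hl).2] at h1
    rw [(hW l' hl').2] at h3
    have h4 := abs_sub_le (W l) (Φ (R l, W l', n l) (2 * π)).2.1 (W l')
    rw [div_mul_eq_mul_div, le_div_iff₀ (by linarith)]
    linarith
  set l₁ := M₃ * ε with hl₁
  have hl₁0 : 0 < l₁ := by positivity
  have habs : ∀ l ∈ Icc (-l₁) l₁, |l| ≤ 1 / 4 := fun l hl => (abs_le.2 hl).trans hε3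
  have hΨ0cont : ContinuousOn (fun l => Ψ l 0) (Icc (-l₁) l₁) := by
    have hRc : Continuous R := (LipschitzWith.of_dist_le_mul (K := 1) fun x y => by
      simpa [Real.dist_eq] using hp.R_lip x y).continuous
    have hnc : Continuous n := (LipschitzWith.of_dist_le_mul (K := 1) fun x y => by
      simpa [Real.dist_eq] using hp.n_lip x y).continuous
    have hWc : ContinuousOn W (Icc (-l₁) l₁) := by
      refine LipschitzOnWith.continuousOn (K := ⟨E / (1 - κ), by
        have : 0 < 1 - κ := by linarith
        positivity⟩) ?_
      refine LipschitzOnWith.of_dist_le_mul fun l hl l' hl' => ?_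
      rw [Real.dist_eq, Real.dist_eq]
      exact hWlip l l' (habs l hl) (habs l' hl')
    simp only [hΨ0]
    exact hRc.continuousOn.prodMk (hWc.prodMk hnc.continuousOn)
  have hΨcont : ContinuousOn (fun l => Ψ l (2 * π)) (Icc (-l₁) l₁) := by
    intro l hl
    have h1 : Tendsto (fun l' => dist (Ψ l' 0) (Ψ l 0) * E) (𝓝[Icc (-l₁) l₁] l) (𝓝 0) := by
      have := ((tendsto_iff_dist_tendsto_zero.1 (hΨ0cont l hl)).mul_const E)
      rwa [zero_mul] at this
    refine tendsto_iff_dist_tendsto_zero.2 (squeeze_zero (fun _ => dist_nonneg) (fun l' => ?_) h1)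
    exact (hΨf l').dist_le (hΨf l) ha hC hε hε1 h2pi
  have hVcont : ∀ θ (Y : ℝ → St), (∀ l ∈ Icc (-l₁) l₁, Y l ∈ box ν₀) →
      ContinuousOn Y (Icc (-l₁) l₁) → ContinuousOn (fun l => S.V θ (Y l)) (Icc (-l₁) l₁) := by
    intro θ Y hY hYc
    have h1 : LipschitzOnWith ⟨3 + C, by positivity⟩ (S.V θ) (box ν₀) :=
      LipschitzOnWith.of_dist_le_mul fun Y hY Z hZ => S.dist_V_le hε hε1 θ hY hZ
    exact h1.continuousOn.comp hYc hY
  -- the increment of `V` over one period changes sign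
  set H : ℝ → ℝ := fun l => s * (S.V (2 * π) (Ψ l (2 * π)) - S.V 0 (Ψ l 0)) with hH
  have hHcont : ContinuousOn H (Icc (-l₁) l₁) :=
    continuousOn_const.mul ((hVcont _ _ (fun l hl => hΨbox l (habs l hl) _ h2pi) hΨcont).sub
      (hVcont _ _ (fun l hl => hΨbox l (habs l hl) _ ⟨le_rfl, h2pi.1⟩) hΨ0cont))
  have hinc : ∀ l ∈ Icc (-l₁) l₁, ∃ μ, H l = 2 * π * ε ^ 2 * (s * μ) ∧
      |s * μ - s * m (R l, W l, n l)| ≤ M₂ * ε := fun l hl => by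
    obtain ⟨μ, hμ, hμm⟩ := (hΨf l).V_increment hm hC hε hεa hεC (hΨs l (habs l hl))
      (hΨw l (habs l hl))
    refine ⟨μ, by simp only [hH, hμ]; ring, ?_⟩
    rw [← mul_sub, abs_mul, hp.abs_s, one_mul, ← hΨ0]
    exact hμm
  have hl₁4 : l₁ ≤ 1 / 4 := hε3
  have hkey : M₂ * ε < c * l₁ := by rw [hl₁, ← mul_assoc]; gcongr
  obtain ⟨l, hl, hHl⟩ : (0 : ℝ) ∈ H '' Icc (-l₁) l₁ := by
    refine intermediate_value_Icc (by linarith) hHcont ⟨?_, ?_⟩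
    · obtain ⟨μ, hμ, hμm⟩ := hinc (-l₁) ⟨le_rfl, by linarith⟩
      have h1 := hp.neg l₁ hl₁0.le hl₁4 (W (-l₁))
      have h2 := (abs_le.1 hμm).2
      rw [hμ]
      exact mul_nonpos_of_nonneg_of_nonpos (by positivity) (by linarith)
    · obtain ⟨μ, hμ, hμm⟩ := hinc l₁ ⟨by linarith, le_rfl⟩
      have h1 := hp.pos l₁ hl₁0.le hl₁4 (W l₁)
      have h2 := (abs_le.1 hμm).1
      rw [hμ]
      exact mul_nonneg (by positivity) (by linarith)
  have hs0 : s ≠ 0 := fun h0 => by have := hp.abs_s; rw [h0, abs_zero] at this; norm_num at this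
  have hl4 := habs l hl
  have hVeq : S.V 0 (Ψ l (2 * π)) = S.V 0 (Ψ l 0) := by
    have h1 := (mul_eq_zero.1 hHl).resolve_left hs0
    have h2 : S.V (2 * π) (Ψ l (2 * π)) = S.V 0 (Ψ l (2 * π)) := by
      have := S.per_V₁ 0 (Ψ l (2 * π))
      rw [zero_add] at this
      simp only [V, this]
    linarith
  have h22 : (Ψ l (2 * π)).2 = (Ψ l 0).2 := by
    refine Prod.ext ?_ ((hΨf l).snd_snd _)
    rw [hΨ0]
    exact (hW l hl4).2
  have hper0 : Ψ l (2 * π) = Ψ l 0 := by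
    refine Prod.ext ?_ h22
    exact S.fst_eq_of_V_eq hε (by linarith) 0 (hΨbox l hl4 _ h2pi) (hΨbox l hl4 _ ⟨le_rfl, h2pi.1⟩)
      h22 hVeq
  have hper : ∀ θ, Ψ l (θ + 2 * π) = Ψ l θ := by
    have h1 : (fun θ => Ψ l (θ + 2 * π)) = Ψ l := by
      refine ODE_solution_unique_univ (v := fun θ Y => S.field θ (clamp ν₀ Y)) (s := fun _ => univ)
        (t₀ := 0) (fun t => (S.lip_clampField ha hC hε hε1 t).lipschitzOnWith)
        (fun t => ⟨?_, trivial⟩) (fun t => ⟨hΨf l t, trivial⟩) (by simpa using hper0)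
      have := (hΨf l (t + 2 * π)).comp_add_const t (2 * π)
      rwa [S.per_field] at this
    exact fun θ => congrFun h1 θ
  have hred : ∀ P : St → Prop, (∀ θ ∈ Icc 0 (2 * π), P (Ψ l θ)) → ∀ θ, P (Ψ l θ) := by
    intro P hP θ
    have hper' : Function.Periodic (Ψ l) (2 * π) := hper
    obtain ⟨y, hy, hyθ⟩ := hper'.exists_mem_Ico₀ (by positivity) θ
    rw [hyθ]
    exact hP y (Ico_subset_Icc_self hy)
  have hboxall := hred (fun Y => Y ∈ box ν₀) (hΨbox l hl4)
  have hlM : |l| ≤ (M₃ + 2 * π * C + M₁) * ε := by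
    have h1 : |l| ≤ M₃ * ε := abs_le.2 hl
    have h2 : 0 ≤ (2 * π * C + M₁) * ε := by positivity
    linarith
  refine ⟨l, Ψ l, hlM, ⟨hboxall, fun θ => ?_, hper,
    hred (fun Y => |Y.1 - 1| ≤ _) fun θ hθ => ?_, hred (fun Y => |Y.2.1| ≤ _) fun θ hθ => ?_⟩, ?_,
    fun θ => ?_⟩
  · have := hΨf l θ
    rwa [clamp_eq_self (hboxall θ)] at this
  · have h1 := (hΨf l).abs_fst_sub hε hθ
    rw [hΨ0] at h1
    have h2 := hp.R_lip l 0
    rw [hp.R_zero, sub_zero] at h2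
    have h3 : |l| ≤ M₃ * ε := abs_le.2 hl
    have h4 := abs_sub_le (Ψ l θ).1 (R l) 1
    have h5 : 0 ≤ M₁ * ε := by positivity
    simp only at h1
    linarith
  · have h1 := hΨw l hl4 θ hθ
    have h2 : 0 ≤ (M₃ + 2 * π * C) * ε := by positivity
    linarith
  · rw [hΨ0]
  · rw [(hΨf l).snd_snd, hΨ0]

end Hopf


/-! ### Stability of the periodic solutions -/

namespace Hopf

open Real

set_option maxHeartbeats 1000000 in
/-- Pointwise estimate behind the stability and the instability of periodic orbits: with
`κ = a c / (32 C²)`, half the derivative of `s x² - κ y²` is positive, where `x` and `y` are the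
differences of `V` and `w` along two solutions. The numbers `P`, `dm`, `dq`, `dv`, `dg` stand for the
differences of `r²`, `m`, `w q`, `v` and `g`, and `D` for the distance of the two states. The weight
`κ` is so small that the term `C x y` coming from `w q` is absorbed. -/
theorem quadratic_rate_le {a c C M ε s x y P D dm dq dv dg : ℝ} (ha : 0 < a) (hc : 0 < c)
    (hC : 0 < C) (hM : 0 < M) (hε : 0 < ε) (hε1 : ε ≤ 1) (hs : |s| = 1)
    (hεC : C * ε ≤ 1 / 2)
    (hε2 : (8 * C ^ 2 + 8 * c * C ^ 2 + 4 * M * C + 4 * C) * ε ≤ c / 8)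
    (hε3 : (a * c / (32 * C ^ 2) * (2 * C) + 2 * C ^ 2 / c + c / 8) * ε
      ≤ a * c / (32 * C ^ 2) * (a / 2))
    (hP : c * P ^ 2 ≤ s * (dm * P)) (hxP : |x - P| ≤ ε * (C * D)) (hD : D ≤ |P| + |y|)
    (hdm : |dm| ≤ C * |P|) (hdq : |dq| ≤ C * |y| + M * ε * (C * D)) (hdv : |dv| ≤ C * D)
    (hdg : |dg| ≤ C * D) :
    ε ^ 2 * (c / 8) * x ^ 2 + a * c / (32 * C ^ 2) * (a / 4) * y ^ 2 ≤
      s * (x * (ε ^ 2 * (dm + dq + ε * dv))) - a * c / (32 * C ^ 2) * (y * (-a * y + ε * dg)) := by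
  have hκ : 0 < a * c / (32 * C ^ 2) := by positivity
  have hκC : a * c / (32 * C ^ 2) * (8 * C ^ 2 / c) = a / 4 := by field_simp; norm_num
  generalize a * c / (32 * C ^ 2) = κ at *
  have hx2 : x ^ 2 = |x| ^ 2 := (sq_abs x).symm
  have hy2 : y ^ 2 = |y| ^ 2 := (sq_abs y).symm
  have hX := abs_nonneg x
  have hY := abs_nonneg y
  have hPX : |P| ≤ 2 * |x| + |y| := by
    have h1 : |P| ≤ |x| + |x - P| := by
      have := abs_sub_abs_le_abs_sub P x
      rw [abs_sub_comm P x] at this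
      linarith
    have h2 : ε * (C * D) ≤ 1 / 2 * (|P| + |y|) := by
      calc ε * (C * D) ≤ ε * (C * (|P| + |y|)) := by gcongr
        _ = C * ε * (|P| + |y|) := by ring
        _ ≤ _ := by gcongr
    linarith
  have hD2 : D ≤ 2 * (|x| + |y|) := by linarith
  have hxP2 : |x - P| ≤ 2 * (C * ε) * (|x| + |y|) := by
    calc |x - P| ≤ ε * (C * D) := hxP
      _ ≤ ε * (C * (2 * (|x| + |y|))) := by gcongr
      _ = _ := by ring
  have hsq : (|x| + |y|) ^ 2 ≤ 2 * (x ^ 2 + y ^ 2) := by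
    rw [hx2, hy2]; nlinarith [sq_nonneg (|x| - |y|)]
  have hXs : |x| * (|x| + |y|) ≤ 2 * (x ^ 2 + y ^ 2) := by
    rw [hx2, hy2]; nlinarith [sq_nonneg (|x| - |y|)]
  have hP2 : x ^ 2 / 2 - 8 * C ^ 2 * ε * (x ^ 2 + y ^ 2) ≤ P ^ 2 := by
    have h1 : (x - P) ^ 2 ≤ (2 * (C * ε) * (|x| + |y|)) ^ 2 := by
      rw [← sq_abs (x - P)]; gcongr
    have h2 : (2 * (C * ε) * (|x| + |y|)) ^ 2 ≤ 8 * C ^ 2 * ε * (x ^ 2 + y ^ 2) := by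
      calc (2 * (C * ε) * (|x| + |y|)) ^ 2 = 4 * C ^ 2 * (ε * ε) * (|x| + |y|) ^ 2 := by ring
        _ ≤ 4 * C ^ 2 * (ε * 1) * (2 * (x ^ 2 + y ^ 2)) := by gcongr
        _ = _ := by ring
    nlinarith [sq_nonneg (x - 2 * P)]
  have hsabs : ∀ z : ℝ, -|z| ≤ s * z := fun z => by
    have := neg_abs_le (s * z)
    rwa [abs_mul, hs, one_mul] at this
  have hm1 : c / 2 * x ^ 2 - (8 * C ^ 2 + 8 * c * C ^ 2) * ε * (x ^ 2 + y ^ 2)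
      ≤ s * (x * dm) := by
    have h1 : s * (x * dm) = s * (dm * P) + s * ((x - P) * dm) := by ring
    have h2 : |(x - P) * dm| ≤ 8 * C ^ 2 * ε * (x ^ 2 + y ^ 2) := by
      rw [abs_mul]
      calc |x - P| * |dm| ≤ (2 * (C * ε) * (|x| + |y|)) * (C * (2 * |x| + |y|)) := by
            have : C * |P| ≤ C * (2 * |x| + |y|) := by gcongr
            exact mul_le_mul hxP2 (hdm.trans this) (abs_nonneg _) (by positivity)
        _ ≤ (2 * (C * ε) * (|x| + |y|)) * (C * (2 * (|x| + |y|))) := by gcongr; linarith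
        _ = 4 * C ^ 2 * ε * (|x| + |y|) ^ 2 := by ring
        _ ≤ 4 * C ^ 2 * ε * (2 * (x ^ 2 + y ^ 2)) := by gcongr
        _ = _ := by ring
    have h3 := hsabs ((x - P) * dm)
    have h4 : c * (x ^ 2 / 2 - 8 * C ^ 2 * ε * (x ^ 2 + y ^ 2)) ≤ c * P ^ 2 := by gcongr
    linarith
  have hq1 : -(C * (|x| * |y|)) - 4 * M * C * ε * (x ^ 2 + y ^ 2) ≤ s * (x * dq) := by
    have h2 : |x * dq| ≤ C * (|x| * |y|) + 4 * M * C * ε * (x ^ 2 + y ^ 2) := by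
      rw [abs_mul]
      calc |x| * |dq| ≤ |x| * (C * |y| + M * ε * (C * (2 * (|x| + |y|)))) := by
            refine mul_le_mul_of_nonneg_left (hdq.trans ?_) hX
            gcongr
        _ = C * (|x| * |y|) + 2 * M * C * ε * (|x| * (|x| + |y|)) := by ring
        _ ≤ C * (|x| * |y|) + 2 * M * C * ε * (2 * (x ^ 2 + y ^ 2)) := by gcongr
        _ = _ := by ring
    linarith [hsabs (x * dq)]
  have hv1 : -(4 * C * ε * (x ^ 2 + y ^ 2)) ≤ s * (x * (ε * dv)) := by
    have h2 : |x * (ε * dv)| ≤ 4 * C * ε * (x ^ 2 + y ^ 2) := by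
      rw [abs_mul, abs_mul, abs_of_pos hε]
      calc |x| * (ε * |dv|) ≤ |x| * (ε * (C * (2 * (|x| + |y|)))) := by
            have : C * D ≤ C * (2 * (|x| + |y|)) := by gcongr
            gcongr
            exact hdv.trans this
        _ = 2 * C * ε * (|x| * (|x| + |y|)) := by ring
        _ ≤ 2 * C * ε * (2 * (x ^ 2 + y ^ 2)) := by gcongr
        _ = _ := by ring
    linarith [hsabs (x * (ε * dv))]
  have hg1 : κ * (y * (ε * dg)) ≤ κ * (2 * C * ε) * (|x| * |y|) + κ * (2 * C * ε) * y ^ 2 := by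
    have h2 : y * (ε * dg) ≤ 2 * C * ε * (|x| * |y|) + 2 * C * ε * y ^ 2 := by
      refine (le_abs_self _).trans ?_
      rw [abs_mul, abs_mul, abs_of_pos hε]
      calc |y| * (ε * |dg|) ≤ |y| * (ε * (C * (2 * (|x| + |y|)))) := by
            have : C * D ≤ C * (2 * (|x| + |y|)) := by gcongr
            gcongr
            exact hdg.trans this
        _ = _ := by rw [hy2]; ring
    calc κ * (y * (ε * dg)) ≤ κ * (2 * C * ε * (|x| * |y|) + 2 * C * ε * y ^ 2) := by gcongr
      _ = _ := by ring
  -- the two mixed terms are absorbed by the squares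
  have hmix1 : C * (|x| * |y|) ≤ c / 8 * x ^ 2 + 2 * C ^ 2 / c * y ^ 2 := by
    have h1 : c / 8 * x ^ 2 + 2 * C ^ 2 / c * y ^ 2 - C * (|x| * |y|)
        = c / 8 * (|x| - 4 * C / c * |y|) ^ 2 := by
      rw [hx2, hy2]; field_simp; ring
    have h2 : 0 ≤ c / 8 * (|x| - 4 * C / c * |y|) ^ 2 := by positivity
    linarith
  have hmix2 : κ * (2 * C * ε) * (|x| * |y|) ≤ ε ^ 2 * (c / 8) * x ^ 2 + κ * (a / 4) * y ^ 2 := by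
    have h1 : ε ^ 2 * (c / 8) * x ^ 2 + κ * (a / 4) * y ^ 2 - κ * (2 * C * ε) * (|x| * |y|)
        = c / 8 * (ε * |x| - 8 * κ * C / c * |y|) ^ 2 := by
      rw [hx2, hy2, ← hκC]; field_simp; ring
    have h2 : 0 ≤ c / 8 * (ε * |x| - 8 * κ * C / c * |y|) ^ 2 := by positivity
    linarith
  have hε22 : ε ^ 2 ≤ ε := by nlinarith
  have hcx : (8 * C ^ 2 + 8 * c * C ^ 2 + 4 * M * C + 4 * C) * ε * (x ^ 2 + y ^ 2)
      ≤ c / 8 * (x ^ 2 + y ^ 2) := by gcongr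
  have hmain : ε ^ 2 * (c / 4 * x ^ 2 - (2 * C ^ 2 / c + c / 8) * y ^ 2)
      ≤ s * (x * (ε ^ 2 * (dm + dq + ε * dv))) := by
    have h1 : s * (x * (ε ^ 2 * (dm + dq + ε * dv)))
        = ε ^ 2 * (s * (x * dm) + s * (x * dq) + s * (x * (ε * dv))) := by ring
    rw [h1]
    gcongr
    linarith
  have hyy : ε ^ 2 * ((2 * C ^ 2 / c + c / 8) * y ^ 2) + κ * (2 * C * ε) * y ^ 2
      ≤ κ * (a / 2) * y ^ 2 := by
    have h1 : ε ^ 2 * ((2 * C ^ 2 / c + c / 8) * y ^ 2)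
        ≤ ε * ((2 * C ^ 2 / c + c / 8) * y ^ 2) := by gcongr
    have h2 := mul_le_mul_of_nonneg_right hε3 (sq_nonneg y)
    linarith
  linarith

variable {C a ν₀ ε : ℝ} {m : St → ℝ}

/-- The rate `m`, at the parameter value `ν₀`, is strictly monotone in `r²` near `r = 1`,
increasing for `s = 1` and decreasing for `s = -1`. -/
def IsMonotoneRate (ν₀ c s : ℝ) (m : St → ℝ) : Prop :=
  ∀ Y Z : St, |Y.1 - 1| ≤ 1 / 8 → |Z.1 - 1| ≤ 1 / 8 → Y.2.2 = ν₀ → Z.2.2 = ν₀ →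
    c * (Y.1 ^ 2 - Z.1 ^ 2) ^ 2 ≤ s * ((m Y - m Z) * (Y.1 ^ 2 - Z.1 ^ 2))

namespace PolarSystem

variable {S : PolarSystem C a ν₀ ε m}

set_option maxHeartbeats 1000000 in
/-- Comparison of a solution of the clamped system with a periodic orbit `Z`, as long as the two are
close: their distance is controlled by the differences `x` of `V` and `y` of `w`, and the quadratic
form `s (x² - s κ y²)` increases at an exponential rate. -/
theorem IsFlow.quadratic_rate {M c s : ℝ} (ha : 0 < a) (hc : 0 < c)
    (hC : 0 < C) (hM : 0 < M) (hε : 0 < ε) (hε1 : ε ≤ 1) (hs : |s| = 1)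
    (hεC : C * ε ≤ 1 / 2) (hεM : M * ε ≤ 1 / 16)
    (hε2 : (8 * C ^ 2 + 8 * c * C ^ 2 + 4 * M * C + 4 * C) * ε ≤ c / 8)
    (hε3 : (a * c / (32 * C ^ 2) * (2 * C) + 2 * C ^ 2 / c + c / 8) * ε
      ≤ a * c / (32 * C ^ 2) * (a / 2)) (hε4 : c * ε ≤ 2 * a)
    (hm : IsTameRate C ν₀ m) (hmono : IsMonotoneRate ν₀ c s m)
    {Y Z : ℝ → St} (hY : S.IsFlow Y) (hZ : S.IsPeriodicOrbit M Z) {θ : ℝ}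
    (hYν : (Y θ).2.2 = ν₀) (hZν : (Z θ).2.2 = ν₀) (hd : dist (Y θ) (Z θ) ≤ 1 / 16) :
    Y θ ∈ box ν₀ ∧
    dist (Y θ) (Z θ) ^ 2 ≤
      8 * ((S.V θ (Y θ) - S.V θ (Z θ)) ^ 2 + ((Y θ).2.1 - (Z θ).2.1) ^ 2) ∧
    ∃ W', HasDerivAt (fun t => s * ((S.V t (Y t) - S.V t (Z t)) ^ 2
        - s * (a * c / (32 * C ^ 2)) * ((Y t).2.1 - (Z t).2.1) ^ 2)) W' θ ∧
      c * ε ^ 2 / 4 * ((S.V θ (Y θ) - S.V θ (Z θ)) ^ 2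
        + a * c / (32 * C ^ 2) * ((Y θ).2.1 - (Z θ).2.1) ^ 2) ≤ W' := by
  have hκ : 0 < a * c / (32 * C ^ 2) := by positivity
  have hZbox := hZ.mem_box θ
  have hdr : |(Y θ).1 - (Z θ).1| ≤ dist (Y θ) (Z θ) := le_max_left (dist (Y θ).1 (Z θ).1) _
  have hdw : |(Y θ).2.1 - (Z θ).2.1| ≤ dist (Y θ) (Z θ) :=
    (le_max_left _ _).trans (le_max_right (dist (Y θ).1 (Z θ).1) (dist (Y θ).2 (Z θ).2))
  have hZ1 := (hZ.abs_fst θ).trans hεM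
  have hZ2 := (hZ.abs_snd θ).trans hεM
  have hY1 : |(Y θ).1 - 1| ≤ 1 / 8 := by
    have := abs_sub_le (Y θ).1 (Z θ).1 1
    linarith
  have hYbox : Y θ ∈ box ν₀ := by
    have h1 := abs_le.1 hY1
    have h2 := abs_le.1 (hdw.trans hd)
    have h3 := abs_le.1 hZ2
    rw [Hopf.mem_box, hYν]
    refine ⟨⟨?_, ?_⟩, ⟨?_, ?_⟩, ?_, ?_⟩ <;> linarith
  have hdY := hY θ
  rw [clamp_eq_self hYbox] at hdY
  have hdZ := hZ.deriv θ
  have hVY := S.deriv_V Y θ hYbox hdY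
  have hVZ := S.deriv_V Z θ hZbox hdZ
  have hwY := (hasDerivAt_components hdY).2.1
  have hwZ := (hasDerivAt_components hdZ).2.1
  have hsum : 1 ≤ (Y θ).1 + (Z θ).1 := by
    have h1 := (Hopf.mem_box.1 hYbox).1.1
    have h2 := (Hopf.mem_box.1 hZbox).1.1
    linarith
  have hΔr : |(Y θ).1 - (Z θ).1| ≤ |(Y θ).1 ^ 2 - (Z θ).1 ^ 2| := by
    have : (Y θ).1 ^ 2 - (Z θ).1 ^ 2 = ((Y θ).1 + (Z θ).1) * ((Y θ).1 - (Z θ).1) := by ring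
    rw [this, abs_mul, abs_of_pos (by linarith : 0 < (Y θ).1 + (Z θ).1)]
    nlinarith [abs_nonneg ((Y θ).1 - (Z θ).1)]
  have hDle : dist (Y θ) (Z θ) ≤ |(Y θ).1 ^ 2 - (Z θ).1 ^ 2| + |(Y θ).2.1 - (Z θ).2.1| := by
    rw [Prod.dist_eq, Prod.dist_eq, Real.dist_eq, Real.dist_eq, hYν, hZν, dist_self]
    have := abs_nonneg ((Y θ).2.1 - (Z θ).2.1)
    have := abs_nonneg ((Y θ).1 ^ 2 - (Z θ).1 ^ 2)
    refine max_le (by linarith) (max_le (by linarith) (by linarith))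
  have hxP : |(S.V θ (Y θ) - S.V θ (Z θ)) - ((Y θ).1 ^ 2 - (Z θ).1 ^ 2)|
      ≤ ε * (C * dist (Y θ) (Z θ)) := by
    have : (S.V θ (Y θ) - S.V θ (Z θ)) - ((Y θ).1 ^ 2 - (Z θ).1 ^ 2)
        = ε * (S.V₁ θ (Y θ) - S.V₁ θ (Z θ)) := by simp only [V]; ring
    rw [this, abs_mul, abs_of_pos hε]
    have := S.tame_V₁.lip θ _ hYbox _ hZbox
    gcongr
  have hdq : |(Y θ).2.1 * S.q θ (Y θ) - (Z θ).2.1 * S.q θ (Z θ)|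
      ≤ C * |(Y θ).2.1 - (Z θ).2.1| + M * ε * (C * dist (Y θ) (Z θ)) := by
    have h1 := S.tame_q.bound θ _ hYbox
    have h2 := S.tame_q.lip θ _ hYbox _ hZbox
    have h3 := hZ.abs_snd θ
    have : (Y θ).2.1 * S.q θ (Y θ) - (Z θ).2.1 * S.q θ (Z θ)
        = S.q θ (Y θ) * ((Y θ).2.1 - (Z θ).2.1) + (Z θ).2.1 * (S.q θ (Y θ) - S.q θ (Z θ)) := by
      ring
    rw [this]
    refine (abs_add_le _ _).trans ?_
    rw [abs_mul, abs_mul]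
    gcongr
  refine ⟨hYbox, ?_, ?_⟩
  · have h1 : |(Y θ).1 ^ 2 - (Z θ).1 ^ 2| ≤ |S.V θ (Y θ) - S.V θ (Z θ)|
        + |(S.V θ (Y θ) - S.V θ (Z θ)) - ((Y θ).1 ^ 2 - (Z θ).1 ^ 2)| := by
      have := abs_sub_abs_le_abs_sub ((Y θ).1 ^ 2 - (Z θ).1 ^ 2) (S.V θ (Y θ) - S.V θ (Z θ))
      rw [abs_sub_comm ((Y θ).1 ^ 2 - (Z θ).1 ^ 2)] at this
      linarith
    have h2 : ε * (C * dist (Y θ) (Z θ)) ≤ 1 / 2 * dist (Y θ) (Z θ) := by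
      rw [← mul_assoc, mul_comm ε C]
      gcongr
    have h3 : dist (Y θ) (Z θ) ≤
        2 * (|S.V θ (Y θ) - S.V θ (Z θ)| + |(Y θ).2.1 - (Z θ).2.1|) := by linarith
    rw [← sq_abs (S.V θ (Y θ) - S.V θ (Z θ)), ← sq_abs ((Y θ).2.1 - (Z θ).2.1)]
    have h4 : dist (Y θ) (Z θ) ^ 2 ≤
      (2 * (|S.V θ (Y θ) - S.V θ (Z θ)| + |(Y θ).2.1 - (Z θ).2.1|)) ^ 2 := by
      have : 0 ≤ dist (Y θ) (Z θ) := dist_nonneg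
      gcongr
    nlinarith [sq_nonneg (|S.V θ (Y θ) - S.V θ (Z θ)| - |(Y θ).2.1 - (Z θ).2.1|)]
  · have hrate := quadratic_rate_le (x := S.V θ (Y θ) - S.V θ (Z θ)) (y := (Y θ).2.1 - (Z θ).2.1)
      ha hc hC hM hε hε1 hs hεC hε2 hε3 (hmono _ _ hY1 (hZ1.trans (by norm_num)) hYν hZν) hxP hDle
      (dm := m (Y θ) - m (Z θ))
      (dq := (Y θ).2.1 * S.q θ (Y θ) - (Z θ).2.1 * S.q θ (Z θ))
      (dv := S.v θ (Y θ) - S.v θ (Z θ)) (dg := S.g θ (Y θ) - S.g θ (Z θ))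
      ((hm.lip _ hYbox _ hZbox (hYν.trans hZν.symm)).trans (by gcongr)) hdq
      (S.tame_v.lip θ _ hYbox _ hZbox) (S.tame_g.lip θ _ hYbox _ hZbox)
    have hV := hVY.sub hVZ
    have hw := hwY.sub hwZ
    have hD := ((hV.pow 2).sub ((hw.pow 2).const_mul (s * (a * c / (32 * C ^ 2))))).const_mul s
    refine ⟨_, hD, ?_⟩
    have hs2 : s * s = 1 := by
      rw [← abs_mul_abs_self, hs, one_mul]
    simp only [Pi.sub_apply, Nat.cast_ofNat, pow_one, Nat.add_one_sub_one, field]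
    simp only [V] at hrate ⊢
    generalize a * c / (32 * C ^ 2) = κ at *
    generalize (Y θ).1 ^ 2 + ε * S.V₁ θ (Y θ) - ((Z θ).1 ^ 2 + ε * S.V₁ θ (Z θ)) = x at *
    have e1 : κ * (a / 4) * ((Y θ).2.1 - (Z θ).2.1) ^ 2
        ≥ c * ε ^ 2 / 8 * (κ * ((Y θ).2.1 - (Z θ).2.1) ^ 2) := by
      have h5 : c * ε ^ 2 ≤ 2 * a := by nlinarith
      have h6 : 0 ≤ κ * ((Y θ).2.1 - (Z θ).2.1) ^ 2 := by positivity
      nlinarith [mul_le_mul_of_nonneg_right h5 h6]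
    linear_combination 2 * hrate + 2 * e1 + 2 * κ * (((Y θ).2.1 - (Z θ).2.1)
      * (-a * ((Y θ).2.1 - (Z θ).2.1) + ε * (S.g θ (Y θ) - S.g θ (Z θ)))) * hs2

end PolarSystem

end Hopf


/-! ### Attracting and repelling periodic orbits -/

namespace Hopf

open Real PolarSystem

variable {C a ν₀ : ℝ} {m : St → ℝ}

theorem PolarSystem.IsPeriodicOrbit.isFlow {ε M : ℝ} {S : PolarSystem C a ν₀ ε m} {Z : ℝ → St}
    (hZ : S.IsPeriodicOrbit M Z) : S.IsFlow Z := fun θ => by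
  rw [clamp_eq_self (hZ.mem_box θ)]
  exact hZ.deriv θ

/-- For small `ε`, `IsFlow.quadratic_rate` applies. -/
theorem eventually_quadratic_rate {M c s : ℝ} (ha : 0 < a) (hC : 0 < C) (hc : 0 < c) (hM : 0 < M)
    (hs : |s| = 1) (hm : IsTameRate C ν₀ m) (hmono : IsMonotoneRate ν₀ c s m) :
    ∀ᶠ ε in 𝓝[>] (0 : ℝ), 0 < ε ∧ ε ≤ 1 ∧ ∀ (S : PolarSystem C a ν₀ ε m) (Y Z : ℝ → St),
      S.IsFlow Y → S.IsPeriodicOrbit M Z → ∀ θ, (Y θ).2.2 = ν₀ → (Z θ).2.2 = ν₀ →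
      dist (Y θ) (Z θ) ≤ 1 / 16 → Y θ ∈ box ν₀ ∧
      dist (Y θ) (Z θ) ^ 2 ≤
        8 * ((S.V θ (Y θ) - S.V θ (Z θ)) ^ 2 + ((Y θ).2.1 - (Z θ).2.1) ^ 2) ∧
      ∃ W', HasDerivAt (fun t => s * ((S.V t (Y t) - S.V t (Z t)) ^ 2
          - s * (a * c / (32 * C ^ 2)) * ((Y t).2.1 - (Z t).2.1) ^ 2)) W' θ ∧
        c * ε ^ 2 / 4 * ((S.V θ (Y θ) - S.V θ (Z θ)) ^ 2
          + a * c / (32 * C ^ 2) * ((Y θ).2.1 - (Z θ).2.1) ^ 2) ≤ W' := by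
  filter_upwards [self_mem_nhdsWithin, eventually_mul_le 1 one_pos,
    eventually_mul_le C (by norm_num : (0 : ℝ) < 1 / 2),
    eventually_mul_le M (by norm_num : (0 : ℝ) < 1 / 16),
    eventually_mul_le (8 * C ^ 2 + 8 * c * C ^ 2 + 4 * M * C + 4 * C) (by positivity : 0 < c / 8),
    eventually_mul_le (a * c / (32 * C ^ 2) * (2 * C) + 2 * C ^ 2 / c + c / 8)
      (by positivity : 0 < a * c / (32 * C ^ 2) * (a / 2)),
    eventually_mul_le c (by positivity : 0 < 2 * a)] with ε hε hε1 hεC hεM hε2 hε3 hε4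
  rw [one_mul] at hε1
  exact ⟨hε, hε1, fun S Y Z hY hZ θ hYν hZν hd => hY.quadratic_rate ha hc hC hM hε hε1 hs hεC hεM
    hε2 hε3 hε4 hm hmono hZ hYν hZν hd⟩

theorem dist_le_of_forall_lt {Y Z : ℝ → St} (hY : Continuous Y) (hZ : Continuous Z) {a b η : ℝ}
    (hab : a < b) (h : ∀ t ∈ Ico a b, dist (Y t) (Z t) < η) : dist (Y b) (Z b) ≤ η := by
  have h1 : Tendsto (fun t => dist (Y t) (Z t)) (𝓝[<] b) (𝓝 (dist (Y b) (Z b))) :=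
    ((hY.dist hZ).tendsto b).mono_left nhdsWithin_le_nhds
  refine le_of_tendsto h1 ?_
  filter_upwards [Ioo_mem_nhdsLT hab] with t ht
  exact (h t ⟨ht.1.le, ht.2⟩).le

/-- If the rate decreases with `r` near `r = 1`, the periodic orbits attract exponentially: for
`s = -1` the quadratic form of the differences is the positive definite `x² + κ y²`. -/
theorem eventually_attracting {M c : ℝ} (ha : 0 < a) (hC : 0 < C) (hc : 0 < c) (hM : 0 < M)
    (hm : IsTameRate C ν₀ m) (hmono : IsMonotoneRate ν₀ c (-1) m) :
    ∀ᶠ ε in 𝓝[>] (0 : ℝ), ∀ (S : PolarSystem C a ν₀ ε m) (Z : ℝ → St),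
      S.IsPeriodicOrbit M Z → (∀ θ, (Z θ).2.2 = ν₀) →
      ∃ η > 0, ∃ K > 0, ∃ l > 0, ∀ Y, S.IsFlow Y → (∀ θ, (Y θ).2.2 = ν₀) →
        ∀ θ₀, dist (Y θ₀) (Z θ₀) ≤ η → ∀ θ, θ₀ ≤ θ → Y θ ∈ box ν₀ ∧
          dist (Y θ) (Z θ) ≤ K * dist (Y θ₀) (Z θ₀) * exp (-l * (θ - θ₀)) := by
  filter_upwards [eventually_quadratic_rate ha hC hc hM (by norm_num) hm hmono]
    with ε ⟨hε, hε1, hrate⟩ S Z hZ hZν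
  have hκ : 0 < a * c / (32 * C ^ 2) := by positivity
  have hBdef : ∃ B : ℝ, B = (3 + C) ^ 2 + a * c / (32 * C ^ 2) := ⟨_, rfl⟩
  generalize a * c / (32 * C ^ 2) = κ at *
  obtain ⟨B, hB⟩ := hBdef
  have hB1 : 1 ≤ B := by nlinarith
  set K₁ := 8 * (1 + 1 / κ) with hK₁
  have hK₁1 : 1 ≤ K₁ := by
    have : 0 < 1 / κ := by positivity
    linarith
  set K := K₁ * B with hK
  have hK1 : 1 ≤ K := one_le_mul_of_one_le_of_one_le hK₁1 hB1
  have hK0 : 0 < K := by linarith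
  refine ⟨1 / (32 * K), by positivity, K, by positivity, c * ε ^ 2 / 8, by positivity, ?_⟩
  intro Y hY hYν θ₀ hd0
  set l := c * ε ^ 2 / 4 with hl
  have hl0 : 0 < l := by positivity
  have hYc : Continuous Y := continuous_iff_continuousAt.2 fun t => (hY t).continuousAt
  have hZc : Continuous Z := continuous_iff_continuousAt.2 fun t => (hZ.deriv t).continuousAt
  have hη16 : 1 / (32 * K) ≤ 1 / 32 := by
    rw [div_le_div_iff₀ (by positivity) (by norm_num)]; linarith
  set N : ℝ → ℝ := fun t => (S.V t (Y t) - S.V t (Z t)) ^ 2 + κ * ((Y t).2.1 - (Z t).2.1) ^ 2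
    with hN
  -- exponential decay, as long as the solution stays close
  have hdecay : ∀ T, θ₀ ≤ T → (∀ t ∈ Icc θ₀ T, dist (Y t) (Z t) ≤ 1 / 16) →
      dist (Y T) (Z T) ≤ K * dist (Y θ₀) (Z θ₀) * exp (-(c * ε ^ 2 / 8) * (T - θ₀)) := by
    intro T hT hcl
    have hex : ∀ t, ∃ N', t ∈ Icc θ₀ T → HasDerivAt N N' t ∧ N' ≤ -l * N t := by
      intro t
      by_cases ht : t ∈ Icc θ₀ T
      swap
      · exact ⟨0, fun h => absurd h ht⟩
      obtain ⟨_, _, W', hW', hle⟩ := hrate S Y Z hY hZ t (hYν t) (hZν t) (hcl t ht)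
      refine ⟨-W', fun _ => ⟨?_, by simp only [hN]; linarith⟩⟩
      refine hW'.neg.congr_of_eventuallyEq (Eventually.of_forall fun t => ?_)
      simp only [hN, Pi.neg_apply]; ring
    choose N' hN' using hex
    have h1 := ODEAux.le_mul_exp_of_deriv_le (h := N) (h' := N') (a := θ₀) (b := T) (K := -l)
      (fun t ht => (hN' t ht).1.hasDerivWithinAt) (fun t ht => (hN' t ht).2) T ⟨hT, le_rfl⟩
    obtain ⟨_, h2, _⟩ := hrate S Y Z hY hZ T (hYν T) (hZν T) (hcl T ⟨hT, le_rfl⟩)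
    obtain ⟨hYb, -, _⟩ := hrate S Y Z hY hZ θ₀ (hYν θ₀) (hZν θ₀) (hcl θ₀ ⟨le_rfl, hT⟩)
    have h3 : N θ₀ ≤ B * dist (Y θ₀) (Z θ₀) ^ 2 := by
      have e1 := S.dist_V_le hε hε1 θ₀ hYb (hZ.mem_box θ₀)
      have e2 : |(Y θ₀).2.1 - (Z θ₀).2.1| ≤ dist (Y θ₀) (Z θ₀) := (le_max_left _ _).trans
        (le_max_right (dist (Y θ₀).1 (Z θ₀).1) (dist (Y θ₀).2 (Z θ₀).2))
      simp only [hN]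
      rw [← sq_abs (S.V θ₀ (Y θ₀) - S.V θ₀ (Z θ₀)), ← sq_abs ((Y θ₀).2.1 - (Z θ₀).2.1)]
      calc _ ≤ ((3 + C) * dist (Y θ₀) (Z θ₀)) ^ 2 + κ * dist (Y θ₀) (Z θ₀) ^ 2 := by gcongr
        _ = _ := by rw [hB]; ring
    have h4 : dist (Y T) (Z T) ^ 2 ≤ K₁ * N T := by
      refine h2.trans ?_
      simp only [hN, hK₁]
      have e1 : 8 * (1 + 1 / κ) * ((S.V T (Y T) - S.V T (Z T)) ^ 2
          + κ * ((Y T).2.1 - (Z T).2.1) ^ 2)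
          = 8 * ((S.V T (Y T) - S.V T (Z T)) ^ 2 + ((Y T).2.1 - (Z T).2.1) ^ 2)
          + 8 * (1 / κ * (S.V T (Y T) - S.V T (Z T)) ^ 2 + κ * ((Y T).2.1 - (Z T).2.1) ^ 2) := by
        field_simp
        ring
      have e2 : 0 ≤ 8 * (1 / κ * (S.V T (Y T) - S.V T (Z T)) ^ 2
          + κ * ((Y T).2.1 - (Z T).2.1) ^ 2) := by positivity
      linarith
    refine (sq_le_sq₀ dist_nonneg (by positivity)).1 ?_
    have hexp : exp (-(c * ε ^ 2 / 8) * (T - θ₀)) ^ 2 = exp (-l * (T - θ₀)) := by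
      rw [← exp_nat_mul]; congr 1; rw [hl]; push_cast; ring
    calc dist (Y T) (Z T) ^ 2 ≤ K₁ * N T := h4
      _ ≤ K₁ * (N θ₀ * exp (-l * (T - θ₀))) := by gcongr
      _ ≤ K₁ * (B * dist (Y θ₀) (Z θ₀) ^ 2 * exp (-l * (T - θ₀))) := by gcongr
      _ = 1 * K * (dist (Y θ₀) (Z θ₀) ^ 2 * exp (-l * (T - θ₀))) := by rw [hK]; ring
      _ ≤ K * K * (dist (Y θ₀) (Z θ₀) ^ 2 * exp (-l * (T - θ₀))) := by gcongr
      _ = _ := by rw [← hexp]; ring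
  have hclose : ∀ T, θ₀ ≤ T → dist (Y T) (Z T) < 1 / 16 := by
    refine ODEAux.lt_of_forall_le_imp_lt (h := fun t => dist (Y t) (Z t))
      (hYc.dist hZc).continuousOn fun T hT hlt => ?_
    have hle : ∀ t ∈ Icc θ₀ T, dist (Y t) (Z t) ≤ 1 / 16 := by
      intro t ht
      rcases ht.2.lt_or_eq with h | h
      · exact (hlt t ⟨ht.1, h⟩).le
      · subst h
        rcases ht.1.lt_or_eq with h' | h'
        · exact dist_le_of_forall_lt hYc hZc h' hlt
        · subst h'; linarith
    have h1 := hdecay T hT hle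
    have h2 : exp (-(c * ε ^ 2 / 8) * (T - θ₀)) ≤ 1 := by
      refine exp_le_one_iff.2 ?_
      have : 0 ≤ c * ε ^ 2 / 8 * (T - θ₀) := mul_nonneg (by positivity) (by linarith)
      linarith
    calc dist (Y T) (Z T) ≤ K * dist (Y θ₀) (Z θ₀) * exp (-(c * ε ^ 2 / 8) * (T - θ₀)) := h1
      _ ≤ K * (1 / (32 * K)) * 1 := by gcongr
      _ < 1 / 16 := by field_simp; norm_num
  intro θ hθ
  exact ⟨(hrate S Y Z hY hZ θ (hYν θ) (hZν θ) (hclose θ hθ).le).1,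
    hdecay θ hθ fun t ht => (hclose t ht.1).le⟩

/-- If the rate increases with `r` near `r = 1`, solutions that differ initially from a periodic
orbit only in the radius leave a fixed neighbourhood of the orbit: `x² - κ y²` is positive at the
start and grows exponentially. -/
theorem eventually_repelling {M c : ℝ} (ha : 0 < a) (hC : 0 < C) (hc : 0 < c) (hM : 0 < M)
    (hm : IsTameRate C ν₀ m) (hmono : IsMonotoneRate ν₀ c 1 m) :
    ∀ᶠ ε in 𝓝[>] (0 : ℝ), ∀ (S : PolarSystem C a ν₀ ε m) (Z : ℝ → St),
      S.IsPeriodicOrbit M Z → (∀ θ, (Z θ).2.2 = ν₀) →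
      (∀ Y θ, S.IsFlow Y → (Y θ).2.2 = ν₀ → dist (Y θ) (Z θ) ≤ 1 / 16 → Y θ ∈ box ν₀) ∧
      ∀ Y, S.IsFlow Y → (∀ θ, (Y θ).2.2 = ν₀) → (Y 0).2.1 = (Z 0).2.1 → (Y 0).1 ≠ (Z 0).1 →
        ∃ θ, 0 ≤ θ ∧ 1 / 16 < dist (Y θ) (Z θ) := by
  filter_upwards [eventually_quadratic_rate ha hC hc hM (by norm_num) hm hmono,
    eventually_mul_le C (by norm_num : (0 : ℝ) < 1 / 2)]
    with ε ⟨hε, hε1, hrate⟩ hεC S Z hZ hZν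
  refine ⟨fun Y θ hY hν hd => (hrate S Y Z hY hZ θ hν (hZν θ) hd).1, ?_⟩
  intro Y hY hYν hw hr
  by_contra! hcon
  have hκ : 0 < a * c / (32 * C ^ 2) := by positivity
  generalize a * c / (32 * C ^ 2) = κ at *
  have hbox : ∀ t, 0 ≤ t → Y t ∈ box ν₀ := fun t ht =>
    (hrate S Y Z hY hZ t (hYν t) (hZν t) (hcon t ht)).1
  set l := c * ε ^ 2 / 4 with hl
  have hl0 : 0 < l := by positivity
  set W : ℝ → ℝ := fun t => (S.V t (Y t) - S.V t (Z t)) ^ 2 - κ * ((Y t).2.1 - (Z t).2.1) ^ 2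
    with hW
  have hex : ∀ t, ∃ W', 0 ≤ t → HasDerivAt W W' t ∧ l * W t ≤ W' := by
    intro t
    by_cases ht : 0 ≤ t
    swap
    · exact ⟨0, fun h => absurd h ht⟩
    obtain ⟨_, _, W', hW', hle⟩ := hrate S Y Z hY hZ t (hYν t) (hZν t) (hcon t ht)
    refine ⟨W', fun _ => ⟨?_, ?_⟩⟩
    · simpa only [one_mul] using hW'
    · refine le_trans ?_ hle
      gcongr
      simp only [hW]
      have : 0 ≤ κ * ((Y t).2.1 - (Z t).2.1) ^ 2 := by positivity
      linarith
  choose W' hW' using hex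
  have hW0 : 0 < W 0 := by
    have h1 : S.V 0 (Y 0) ≠ S.V 0 (Z 0) := fun h =>
      hr (S.fst_eq_of_V_eq hε (by linarith) 0 (hbox 0 le_rfl) (hZ.mem_box 0)
        (Prod.ext hw ((hYν 0).trans (hZν 0).symm)) h)
    have h2 : 0 < (S.V 0 (Y 0) - S.V 0 (Z 0)) ^ 2 := by
      have := sub_ne_zero.2 h1
      positivity
    simp only [hW, hw, sub_self]
    linarith
  have hgrow : ∀ t, 0 ≤ t → W 0 * exp (l * t) ≤ (3 + C) ^ 2 := by
    intro t ht
    have h1 := ODEAux.mul_exp_le_of_le_deriv (h := W) (h' := W') (a := 0) (b := t) (K := l)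
      (fun s hs => (hW' s hs.1).1.hasDerivWithinAt) (fun s hs => (hW' s hs.1).2) t ⟨ht, le_rfl⟩
    rw [sub_zero] at h1
    have h2 := S.dist_V_le hε hε1 t (hbox t ht) (hZ.mem_box t)
    have h3 : (S.V t (Y t) - S.V t (Z t)) ^ 2 ≤ (3 + C) ^ 2 := by
      rw [← sq_abs]
      have h4 := hcon t ht
      have h5 : (3 + C) * dist (Y t) (Z t) ≤ (3 + C) * 1 := by gcongr; linarith
      have h6 : |S.V t (Y t) - S.V t (Z t)| ≤ 3 + C := by linarith
      gcongr
    have h4 : 0 ≤ κ * ((Y t).2.1 - (Z t).2.1) ^ 2 := by positivity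
    simp only [hW] at h1 ⊢
    linarith
  have htend : Tendsto (fun t => W 0 * exp (l * t)) atTop atTop :=
    (tendsto_exp_atTop.comp (tendsto_id.const_mul_atTop hl0)).const_mul_atTop hW0
  obtain ⟨t, ht, ht0⟩ := ((htend.eventually_gt_atTop ((3 + C) ^ 2)).and
    (eventually_ge_atTop 0)).exists
  linarith [hgrow t ht0]

end Hopf


/-! ### The normal form near a pair of imaginary eigenvalues -/

namespace Hopf

open Real

/-- The quadratic system
`x' = -ρ y + (x + z)(a₁ x + a₂ y + a₃ z) + μ n₁ ℓ`,
`y' =  ρ x + (x + z)(b₁ x + b₂ y + b₃ z) + μ n₂ ℓ`,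
`z' = -A z + (x + z)(d₁ x + d₂ y + d₃ z) + μ n₃ ℓ`, where `ℓ = l₁ x + l₂ y + l₃ z`,
together with the coefficients of the quadratic approximation
`z = h₁ x² + h₂ x y + h₃ y²` to its centre manifold at `μ = 0`. -/
structure NormalForm where
  (ρ A a₁ a₂ a₃ b₁ b₂ b₃ d₁ d₂ d₃ n₁ n₂ n₃ l₁ l₂ l₃ h₁ h₂ h₃ : ℝ)
  ρ_pos : 0 < ρ
  A_pos : 0 < A
  h_eq₁ : A * h₁ + ρ * h₂ = d₁
  h_eq₂ : A * h₂ - 2 * ρ * h₁ + 2 * ρ * h₃ = d₂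
  h_eq₃ : A * h₃ = ρ * h₂

/-- A point `((c, s), (r, w, ν), ε)`; `(c, s)` stands for `(cos θ, sin θ)`. -/
abbrev Pt := (ℝ × ℝ) × St × ℝ

/-- The point with angle `θ`. -/
def pt (ε θ : ℝ) (Y : St) : Pt := ((cos θ, sin θ), Y, ε)

/-- The points over the box with `0 ≤ ε ≤ ε₀`. -/
def ptBox (ν₀ ε₀ : ℝ) : Set Pt :=
  (Icc (-1) 1 ×ˢ Icc (-1) 1) ×ˢ box ν₀ ×ˢ Icc 0 ε₀

theorem isCompact_ptBox (ν₀ ε₀ : ℝ) : IsCompact (ptBox ν₀ ε₀) :=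
  (isCompact_Icc.prod isCompact_Icc).prod (isCompact_Icc.prod isCompact_Icc)

theorem convex_ptBox (ν₀ ε₀ : ℝ) : Convex ℝ (ptBox ν₀ ε₀) :=
  ((convex_Icc _ _).prod (convex_Icc _ _)).prod ((convex_Icc _ _).prod (convex_Icc _ _))

theorem pt_mem {ν₀ ε₀ ε : ℝ} (hε : 0 ≤ ε) (hε₀ : ε ≤ ε₀) (θ : ℝ) {Y : St} (hY : Y ∈ box ν₀) :
    pt ε θ Y ∈ ptBox ν₀ ε₀ :=
  ⟨⟨cos_mem_Icc θ, sin_mem_Icc θ⟩, hY, hε, hε₀⟩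

theorem pt_add_two_pi (ε θ : ℝ) (Y : St) : pt ε (θ + 2 * π) Y = pt ε θ Y := by
  simp only [pt, cos_add_two_pi, sin_add_two_pi]

theorem fst_pos_of_mem_ptBox {ν₀ ε₀ : ℝ} {q : Pt} (hq : q ∈ ptBox ν₀ ε₀) : 0 < q.2.1.1 := by
  have := (mem_box.1 hq.2.1).1.1
  linarith

/-- Smooth functions of `(cos θ, sin θ)`, the state and `ε` are tame, uniformly in `ε`. -/
theorem exists_isTame {ν₀ ε₀ : ℝ} {F : Pt → ℝ} (hF : ∀ q ∈ ptBox ν₀ ε₀, ContDiffAt ℝ 1 F q) :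
    ∃ C, ∀ C' ≥ C, ∀ ε, 0 ≤ ε → ε ≤ ε₀ → IsTame C' ν₀ fun θ Y => F (pt ε θ Y) := by
  have hF' : ContDiffOn ℝ 1 F (ptBox ν₀ ε₀) := fun q hq => (hF q hq).contDiffWithinAt
  obtain ⟨K, hK⟩ := hF'.exists_lipschitzOnWith one_ne_zero (convex_ptBox ν₀ ε₀)
    (isCompact_ptBox ν₀ ε₀)
  obtain ⟨B, hB⟩ := (isCompact_ptBox ν₀ ε₀).exists_bound_of_continuousOn hF'.continuousOn
  refine ⟨max B K, fun C' hC' ε hε hε₀ => ⟨fun θ Y hY => ?_, fun θ Y hY Z hZ => ?_⟩⟩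
  · exact (hB _ (pt_mem hε hε₀ θ hY)).trans ((le_max_left _ _).trans hC')
  · have h1 := hK.dist_le_mul _ (pt_mem hε hε₀ θ hY) _ (pt_mem hε hε₀ θ hZ)
    have h2 : dist (pt ε θ Y) (pt ε θ Z) = dist Y Z := by
      simp only [pt, Prod.dist_eq, dist_self]
      simp
    rw [h2, Real.dist_eq] at h1
    exact h1.trans (mul_le_mul_of_nonneg_right ((le_max_right _ _).trans hC') dist_nonneg)

theorem continuous_comp_pt {ν₀ ε₀ ε : ℝ} {F : Pt → ℝ} (hF : ∀ q ∈ ptBox ν₀ ε₀, ContDiffAt ℝ 1 F q)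
    (hε : 0 ≤ ε) (hε₀ : ε ≤ ε₀) {Y : ℝ → St} (hY : Continuous Y) (hY' : ∀ θ, Y θ ∈ box ν₀) :
    Continuous fun θ => F (pt ε θ (Y θ)) := by
  refine continuous_iff_continuousAt.2 fun θ => ?_
  have h1 := (hF _ (pt_mem hε hε₀ θ (hY' θ))).continuousAt
  have h2 : Continuous fun θ => pt ε θ (Y θ) := by
    simp only [pt]; fun_prop
  exact ContinuousAt.comp (f := fun θ => pt ε θ (Y θ)) h1 h2.continuousAt

namespace NormalForm

variable (k : NormalForm)

/-- The scaled coordinate `X = r cos θ`. -/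
def px (q : Pt) : ℝ := q.2.1.1 * q.1.1

/-- The scaled coordinate `Y = r sin θ`. -/
def py (q : Pt) : ℝ := q.2.1.1 * q.1.2

/-- The quadratic approximation to the centre manifold. -/
def hq (x y : ℝ) : ℝ := k.h₁ * x ^ 2 + k.h₂ * (x * y) + k.h₃ * y ^ 2

/-- The scaled coordinate `Z = h(X, Y) + w`. -/
def pz (q : Pt) : ℝ := k.hq (px q) (py q) + q.2.1.2.1

/-- The linear form `ℓ`, divided by `ε`, in scaled coordinates. -/
def ℓ (ε x y z : ℝ) : ℝ := k.l₁ * x + k.l₂ * y + ε * (k.l₃ * z)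

/-- With `x = ε X`, `y = ε Y`, `z = ε² Z`, `μ = ε² ν`, the equation for `x` reads
`X' = -ρ Y + ε X₁`. -/
def X₁ (q : Pt) : ℝ :=
  (px q + q.2.2 * k.pz q) * (k.a₁ * px q + k.a₂ * py q + q.2.2 * (k.a₃ * k.pz q))
    + q.2.2 * (q.2.1.2.2 * k.n₁ * k.ℓ q.2.2 (px q) (py q) (k.pz q))

/-- The equation for `y` reads `Y' = ρ X + ε Y₁`. -/
def Y₁ (q : Pt) : ℝ :=
  (px q + q.2.2 * k.pz q) * (k.b₁ * px q + k.b₂ * py q + q.2.2 * (k.b₃ * k.pz q))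
    + q.2.2 * (q.2.1.2.2 * k.n₂ * k.ℓ q.2.2 (px q) (py q) (k.pz q))

/-- With `Z = h(X, Y) + w`, the equation for `z` reads `w' = -A w + ε Z₁`. -/
def Z₁ (q : Pt) : ℝ :=
  k.pz q * ((k.d₁ + k.d₃) * px q + k.d₂ * py q) + q.2.2 * (k.d₃ * k.pz q ^ 2)
    + q.2.1.2.2 * k.n₃ * k.ℓ q.2.2 (px q) (py q) (k.pz q)
    - (2 * k.h₁ * px q + k.h₂ * py q) * k.X₁ q - (k.h₂ * px q + 2 * k.h₃ * py q) * k.Y₁ q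

/-- In polar coordinates the angle satisfies `θ' = ρ + ε Θ₁`. -/
def Θ₁ (q : Pt) : ℝ := (q.1.1 * k.Y₁ q - q.1.2 * k.X₁ q) / q.2.1.1

/-- The angular velocity. -/
def Θ (q : Pt) : ℝ := k.ρ + q.2.2 * k.Θ₁ q

/-- With the angle as independent variable, `dr/dθ = ε f`. -/
def fq (q : Pt) : ℝ := (q.1.1 * k.X₁ q + q.1.2 * k.Y₁ q) / k.Θ q

/-- With the angle as independent variable, `dw/dθ = -(A/ρ) w + ε g`. -/
def gq (q : Pt) : ℝ :=
  k.Z₁ q / k.Θ q + k.A * q.2.1.2.1 * k.Θ₁ q / (k.ρ * k.Θ q)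

/-! The coefficients of the near-identity change of the squared radius. The derivative of
`X² + Y² + ε C₃ + ε² (C₄ + ν C₂)` along the flow has no terms of order `ε`, and its terms of order
`ε²` are functions of `X² + Y²` and `ν`, up to a multiple of `w`. In the names, `x` and `y` mark partial
derivatives, and `eij` is the coefficient of `xⁱ yʲ` in the quartic form that `C₄` averages. -/

def c30 : ℝ := 2 * (k.a₂ + k.b₁) / (3 * k.ρ)
def c21 : ℝ := -(2 * k.a₁) / k.ρ
def c03 : ℝ := -(4 * k.a₁ + 2 * k.b₂) / (3 * k.ρ)

def C₃ (x y : ℝ) : ℝ := k.c30 * x ^ 3 + k.c21 * (x ^ 2 * y) + k.c03 * y ^ 3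
def C₃x (x y : ℝ) : ℝ := 3 * k.c30 * x ^ 2 + 2 * k.c21 * (x * y)
def C₃y (x y : ℝ) : ℝ := k.c21 * x ^ 2 + 3 * k.c03 * y ^ 2

def e40 : ℝ := 2 * k.h₁ * (k.a₁ + k.a₃) + 3 * k.c30 * k.a₁ + k.c21 * k.b₁
def e31 : ℝ := 2 * k.h₂ * (k.a₁ + k.a₃) + 2 * k.h₁ * k.a₂ + 2 * k.h₁ * (k.b₁ + k.b₃)
  + 3 * k.c30 * k.a₂ + 2 * k.c21 * k.a₁ + k.c21 * k.b₂
def e22 : ℝ := 2 * k.h₃ * (k.a₁ + k.a₃) + 2 * k.h₂ * k.a₂ + 2 * k.h₂ * (k.b₁ + k.b₃)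
  + 2 * k.h₁ * k.b₂ + 2 * k.c21 * k.a₂ + 3 * k.c03 * k.b₁
def e13 : ℝ := 2 * k.h₃ * k.a₂ + 2 * k.h₃ * (k.b₁ + k.b₃) + 2 * k.h₂ * k.b₂ + 3 * k.c03 * k.b₂
def e04 : ℝ := 2 * k.h₃ * k.b₂

/-- The first Lyapunov number: half the mean over the unit circle of the quartic form with the
coefficients `eij`. -/
def b : ℝ := (3 * k.e40 + 3 * k.e04 + k.e22) / 16

/-- The derivative of the real part of the critical eigenvalue in `μ`. -/
def κ : ℝ := (k.n₁ * k.l₁ + k.n₂ * k.l₂) / 2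

def c40 : ℝ := k.e31 / (4 * k.ρ)
def c31 : ℝ := (2 * k.b - k.e40) / k.ρ
def c13 : ℝ := -(2 * k.b - k.e04) / k.ρ
def c04 : ℝ := -k.e13 / (4 * k.ρ)

def C₄ (x y : ℝ) : ℝ :=
  k.c40 * x ^ 4 + k.c31 * (x ^ 3 * y) + k.c13 * (x * y ^ 3) + k.c04 * y ^ 4
def C₄x (x y : ℝ) : ℝ := 4 * k.c40 * x ^ 3 + 3 * k.c31 * (x ^ 2 * y) + k.c13 * y ^ 3
def C₄y (x y : ℝ) : ℝ := k.c31 * x ^ 3 + 3 * k.c13 * (x * y ^ 2) + 4 * k.c04 * y ^ 3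

def c20 : ℝ := (k.n₁ * k.l₂ + k.n₂ * k.l₁) / k.ρ
def c11 : ℝ := (2 * k.κ - 2 * k.n₁ * k.l₁) / k.ρ

def C₂ (x y : ℝ) : ℝ := k.c20 * x ^ 2 + k.c11 * (x * y)
def C₂x (x y : ℝ) : ℝ := 2 * k.c20 * x + k.c11 * y
def C₂y (x _y : ℝ) : ℝ := k.c11 * x

/-- The terms of order `ε` in the derivative of the modified squared radius cancel. -/
theorem order_one (x y : ℝ) :
    2 * x * (x * (k.a₁ * x + k.a₂ * y)) + 2 * y * (x * (k.b₁ * x + k.b₂ * y))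
      - k.ρ * y * k.C₃x x y + k.ρ * x * k.C₃y x y = 0 := by
  have := k.ρ_pos.ne'
  simp only [C₃x, C₃y, c30, c21, c03]
  field_simp
  ring

/-- The quartic terms of order `ε²` at `w = 0` reduce to `2 b r⁴`. -/
theorem order_two_quartic (x y : ℝ) :
    2 * x * (k.hq x y * ((k.a₁ + k.a₃) * x + k.a₂ * y))
      + 2 * y * (k.hq x y * ((k.b₁ + k.b₃) * x + k.b₂ * y))
      + k.C₃x x y * (x * (k.a₁ * x + k.a₂ * y)) + k.C₃y x y * (x * (k.b₁ * x + k.b₂ * y))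
      - k.ρ * y * k.C₄x x y + k.ρ * x * k.C₄y x y = 2 * k.b * (x ^ 2 + y ^ 2) ^ 2 := by
  have hρ := k.ρ_pos.ne'
  have h1 : k.ρ * k.c31 = 2 * k.b - k.e40 := by simp only [c31]; field_simp
  have h2 : k.ρ * k.c13 = -(2 * k.b - k.e04) := by simp only [c13]; field_simp
  have h3 : k.ρ * k.c40 = k.e31 / 4 := by simp only [c40]; field_simp
  have h4 : k.ρ * k.c04 = -k.e13 / 4 := by simp only [c04]; field_simp
  have h5 : 16 * k.b = 3 * k.e40 + 3 * k.e04 + k.e22 := by simp only [b]; ring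
  simp only [hq, C₃x, C₃y, C₄x, C₄y]
  simp only [e40, e04, e31, e13, e22] at h1 h2 h3 h4 h5
  linear_combination (x ^ 4 - 3 * x ^ 2 * y ^ 2) * h1 + (3 * x ^ 2 * y ^ 2 - y ^ 4) * h2
    - 4 * x ^ 3 * y * h3 + 4 * x * y ^ 3 * h4 - x ^ 2 * y ^ 2 * h5

/-- The terms of order `ε²` with the factor `ν` reduce to `2 κ r²`. -/
theorem order_two_quadratic (x y : ℝ) :
    2 * x * (k.n₁ * (k.l₁ * x + k.l₂ * y)) + 2 * y * (k.n₂ * (k.l₁ * x + k.l₂ * y))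
      - k.ρ * y * k.C₂x x y + k.ρ * x * k.C₂y x y = 2 * k.κ * (x ^ 2 + y ^ 2) := by
  have := k.ρ_pos.ne'
  simp only [C₂x, C₂y, c20, c11, κ]
  field_simp
  ring

/-! The terms of `X₁`, `Y₁` beyond the leading order are `ε PX` and `ε PY`. -/

def PX (q : Pt) : ℝ :=
  k.pz q * ((k.a₁ + k.a₃) * px q + k.a₂ * py q) + q.2.1.2.2 * k.n₁ * (k.l₁ * px q + k.l₂ * py q)
    + q.2.2 * (k.a₃ * k.pz q ^ 2 + q.2.1.2.2 * k.n₁ * (k.l₃ * k.pz q))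

def PY (q : Pt) : ℝ :=
  k.pz q * ((k.b₁ + k.b₃) * px q + k.b₂ * py q) + q.2.1.2.2 * k.n₂ * (k.l₁ * px q + k.l₂ * py q)
    + q.2.2 * (k.b₃ * k.pz q ^ 2 + q.2.1.2.2 * k.n₂ * (k.l₃ * k.pz q))

theorem X₁_eq (q : Pt) :
    k.X₁ q = px q * (k.a₁ * px q + k.a₂ * py q) + q.2.2 * k.PX q := by
  simp only [X₁, PX, ℓ]; ring

theorem Y₁_eq (q : Pt) :
    k.Y₁ q = px q * (k.b₁ * px q + k.b₂ * py q) + q.2.2 * k.PY q := by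
  simp only [Y₁, PY, ℓ]; ring

/-- The coefficient of `w` in the terms of order `ε²`. -/
def Qw (q : Pt) : ℝ :=
  2 * px q * ((k.a₁ + k.a₃) * px q + k.a₂ * py q) + 2 * py q * ((k.b₁ + k.b₃) * px q + k.b₂ * py q)

/-- The terms of order `ε³`. -/
def Rq (q : Pt) : ℝ :=
  2 * px q * (k.a₃ * k.pz q ^ 2 + q.2.1.2.2 * k.n₁ * (k.l₃ * k.pz q))
    + 2 * py q * (k.b₃ * k.pz q ^ 2 + q.2.1.2.2 * k.n₂ * (k.l₃ * k.pz q))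
    + k.C₃x (px q) (py q) * k.PX q + k.C₃y (px q) (py q) * k.PY q
    + (k.C₄x (px q) (py q) + q.2.1.2.2 * k.C₂x (px q) (py q)) * k.X₁ q
    + (k.C₄y (px q) (py q) + q.2.1.2.2 * k.C₂y (px q) (py q)) * k.Y₁ q

/-- The averaged rate of change of the squared radius per unit of angle, divided by `ε²`. -/
def m (Y : St) : ℝ := 2 / k.ρ * (k.b * Y.1 ^ 4 + k.κ * Y.2.2 * Y.1 ^ 2)

/-- The derivative with respect to time of `X² + Y² + ε C₃ + ε² (C₄ + ν C₂)`. -/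
theorem expansion (q : Pt) (hcs : q.1.1 ^ 2 + q.1.2 ^ 2 = 1) :
    2 * px q * (-(k.ρ * py q) + q.2.2 * k.X₁ q) + 2 * py q * (k.ρ * px q + q.2.2 * k.Y₁ q)
      + q.2.2 * (k.C₃x (px q) (py q) * (-(k.ρ * py q) + q.2.2 * k.X₁ q)
        + k.C₃y (px q) (py q) * (k.ρ * px q + q.2.2 * k.Y₁ q))
      + q.2.2 ^ 2 * ((k.C₄x (px q) (py q) + q.2.1.2.2 * k.C₂x (px q) (py q))
          * (-(k.ρ * py q) + q.2.2 * k.X₁ q)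
        + (k.C₄y (px q) (py q) + q.2.1.2.2 * k.C₂y (px q) (py q)) * (k.ρ * px q + q.2.2 * k.Y₁ q))
      = q.2.2 ^ 2 * (k.ρ * k.m q.2.1 + q.2.1.2.1 * k.Qw q + q.2.2 * k.Rq q) := by
  have hr : px q ^ 2 + py q ^ 2 = q.2.1.1 ^ 2 := by
    simp only [px, py]; linear_combination q.2.1.1 ^ 2 * hcs
  have hm : k.ρ * k.m q.2.1 = 2 * k.b * (px q ^ 2 + py q ^ 2) ^ 2
      + q.2.1.2.2 * (2 * k.κ * (px q ^ 2 + py q ^ 2)) := by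
    have := k.ρ_pos.ne'
    rw [hr]
    simp only [m]
    field_simp
  rw [hm, ← k.order_two_quartic, ← k.order_two_quadratic]
  have h1 := k.order_one (px q) (py q)
  have hX := k.X₁_eq q
  have hY := k.Y₁_eq q
  simp only [Rq, Qw, PX, PY, pz] at hX hY ⊢
  generalize k.X₁ q = X at *
  generalize k.Y₁ q = Y at *
  generalize k.hq (px q) (py q) = H at *
  generalize k.C₃x (px q) (py q) = C3x at *
  generalize k.C₃y (px q) (py q) = C3y at *
  generalize k.C₄x (px q) (py q) = C4x at *
  generalize k.C₄y (px q) (py q) = C4y at *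
  generalize k.C₂x (px q) (py q) = C2x at *
  generalize k.C₂y (px q) (py q) = C2y at *
  linear_combination q.2.2 * h1 + (2 * px q * q.2.2 + q.2.2 ^ 2 * C3x) * hX
    + (2 * py q * q.2.2 + q.2.2 ^ 2 * C3y) * hY

end NormalForm

end Hopf


/-! ### The normal form in polar coordinates -/

namespace Hopf

open Real

namespace NormalForm

variable (k : NormalForm)

theorem isTameRate_m (ν₀ : ℝ) : ∃ C, ∀ C' ≥ C, IsTameRate C' ν₀ k.m := by
  have hF : ContDiff ℝ 1 k.m := by unfold m; fun_prop
  obtain ⟨K, hK⟩ := (hF.contDiffOn (s := box ν₀)).exists_lipschitzOnWith one_ne_zero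
    (convex_Icc _ _) isCompact_Icc
  refine ⟨K, fun C' hC' => ⟨fun Y hY Z hZ hν => ?_⟩⟩
  have hmem : ∀ Y ∈ box ν₀, ((Y.1, 0, Y.2.2) : St) ∈ box ν₀ := fun Y hY => by
    rw [mem_box] at hY ⊢
    exact ⟨hY.1, ⟨by norm_num, by norm_num⟩, hY.2.2⟩
  have h1 := hK.dist_le_mul _ (hmem Y hY) _ (hmem Z hZ)
  have h2 : dist ((Y.1, 0, Y.2.2) : St) (Z.1, 0, Z.2.2) = |Y.1 - Z.1| := by
    rw [hν]
    simp [Prod.dist_eq, Real.dist_eq]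
  rw [h2, Real.dist_eq] at h1
  exact h1.trans (mul_le_mul_of_nonneg_right hC' (abs_nonneg _))

theorem contDiff_X₁ : ContDiff ℝ 1 k.X₁ := by
  unfold X₁ pz ℓ hq px py; fun_prop

theorem contDiff_Y₁ : ContDiff ℝ 1 k.Y₁ := by
  unfold Y₁ pz ℓ hq px py; fun_prop

theorem contDiff_Z₁ : ContDiff ℝ 1 k.Z₁ := by
  have h1 := k.contDiff_X₁
  have h2 := k.contDiff_Y₁
  unfold Z₁ pz ℓ hq px py; fun_prop

theorem contDiff_Qw : ContDiff ℝ 1 k.Qw := by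
  unfold Qw px py; fun_prop

theorem contDiff_Rq : ContDiff ℝ 1 k.Rq := by
  have h1 := k.contDiff_X₁
  have h2 := k.contDiff_Y₁
  unfold Rq PX PY C₃x C₃y C₄x C₄y C₂x C₂y pz hq px py; fun_prop

theorem contDiffAt_Θ₁ {q : Pt} (hq : q.2.1.1 ≠ 0) : ContDiffAt ℝ 1 k.Θ₁ q := by
  have h1 := k.contDiff_X₁
  have h2 := k.contDiff_Y₁
  refine ContDiffAt.div (ContDiff.contDiffAt ?_) (ContDiff.contDiffAt ?_) hq <;> fun_prop

theorem contDiffAt_Θ {q : Pt} (hq : q.2.1.1 ≠ 0) : ContDiffAt ℝ 1 k.Θ q := by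
  have h1 := k.contDiffAt_Θ₁ hq
  unfold Θ; fun_prop

/-- The near-identity change of the squared radius: `V = r² + ε V₁`. -/
def V₁q (q : Pt) : ℝ :=
  k.C₃ (px q) (py q) + q.2.2 * (k.C₄ (px q) (py q) + q.2.1.2.2 * k.C₂ (px q) (py q))

theorem contDiff_V₁q : ContDiff ℝ 1 k.V₁q := by
  unfold V₁q C₃ C₄ C₂ px py; fun_prop

/-- The rectangular coordinates of a curve that solves the equations in polar coordinates. -/
theorem hasDerivAt_px_py {ε : ℝ} {Y : ℝ → St} {θ w' : ℝ} (hr : (Y θ).1 ≠ 0)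
    (hΘ : k.Θ (pt ε θ (Y θ)) ≠ 0)
    (hY : HasDerivAt Y (ε * k.fq (pt ε θ (Y θ)), w', 0) θ) :
    HasDerivAt (fun t => px (pt ε t (Y t)))
      ((-(k.ρ * py (pt ε θ (Y θ))) + ε * k.X₁ (pt ε θ (Y θ))) / k.Θ (pt ε θ (Y θ))) θ ∧
    HasDerivAt (fun t => py (pt ε t (Y t)))
      ((k.ρ * px (pt ε θ (Y θ)) + ε * k.Y₁ (pt ε θ (Y θ))) / k.Θ (pt ε θ (Y θ))) θ := by
  have h1 := (hasDerivAt_components hY).1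
  have hcs := cos_sq_add_sin_sq θ
  have hΘr : (Y θ).1 * k.Θ (pt ε θ (Y θ)) = (Y θ).1 * k.ρ
      + ε * (cos θ * k.Y₁ (pt ε θ (Y θ)) - sin θ * k.X₁ (pt ε θ (Y θ))) := by
    simp only [Θ, Θ₁, pt]
    field_simp
  have hf : k.fq (pt ε θ (Y θ)) * k.Θ (pt ε θ (Y θ))
      = cos θ * k.X₁ (pt ε θ (Y θ)) + sin θ * k.Y₁ (pt ε θ (Y θ)) := by
    simp only [fq]
    rw [div_mul_cancel₀ _ hΘ]
    simp only [pt]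
  simp only [px, py]
  generalize k.Θ (pt ε θ (Y θ)) = T at *
  generalize k.fq (pt ε θ (Y θ)) = f at *
  generalize k.X₁ (pt ε θ (Y θ)) = X at *
  generalize k.Y₁ (pt ε θ (Y θ)) = X' at *
  simp only [pt] at *
  constructor
  · refine (h1.mul (hasDerivAt_cos θ)).congr_deriv ?_
    rw [eq_div_iff hΘ]
    linear_combination ε * cos θ * hf - sin θ * hΘr + ε * X * hcs
  · refine (h1.mul (hasDerivAt_sin θ)).congr_deriv ?_
    rw [eq_div_iff hΘ]
    linear_combination ε * sin θ * hf + cos θ * hΘr + ε * X' * hcs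

theorem hasDerivAt_V {ε : ℝ} {Y : ℝ → St} {θ w' : ℝ} (hr : (Y θ).1 ≠ 0)
    (hΘ : k.Θ (pt ε θ (Y θ)) ≠ 0)
    (hY : HasDerivAt Y (ε * k.fq (pt ε θ (Y θ)), w', 0) θ) :
    HasDerivAt (fun t => (Y t).1 ^ 2 + ε * k.V₁q (pt ε t (Y t)))
      (ε ^ 2 * (k.m (Y θ) + (Y θ).2.1 * (k.Qw (pt ε θ (Y θ)) / k.Θ (pt ε θ (Y θ)))
        + ε * ((k.Rq (pt ε θ (Y θ)) - k.m (Y θ) * k.Θ₁ (pt ε θ (Y θ))) / k.Θ (pt ε θ (Y θ))))) θ := by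
  obtain ⟨hX, hX'⟩ := k.hasDerivAt_px_py hr hΘ hY
  have hν := (hasDerivAt_components hY).2.2
  have hexp := k.expansion (pt ε θ (Y θ)) (cos_sq_add_sin_sq θ)
  have e1 : ∀ t, (Y t).1 ^ 2 = px (pt ε t (Y t)) ^ 2 + py (pt ε t (Y t)) ^ 2 := fun t => by
    simp only [px, py, pt]
    linear_combination -(Y t).1 ^ 2 * cos_sq_add_sin_sq t
  have hΘdef : k.Θ (pt ε θ (Y θ)) = k.ρ + ε * k.Θ₁ (pt ε θ (Y θ)) := rfl
  have hVeq : (fun t => (Y t).1 ^ 2 + ε * k.V₁q (pt ε t (Y t))) = fun t =>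
      px (pt ε t (Y t)) ^ 2 + py (pt ε t (Y t)) ^ 2
        + ε * (k.c30 * px (pt ε t (Y t)) ^ 3
            + k.c21 * (px (pt ε t (Y t)) ^ 2 * py (pt ε t (Y t))) + k.c03 * py (pt ε t (Y t)) ^ 3
          + ε * (k.c40 * px (pt ε t (Y t)) ^ 4
              + k.c31 * (px (pt ε t (Y t)) ^ 3 * py (pt ε t (Y t)))
              + k.c13 * (px (pt ε t (Y t)) * py (pt ε t (Y t)) ^ 3)
              + k.c04 * py (pt ε t (Y t)) ^ 4
            + (Y t).2.2 * (k.c20 * px (pt ε t (Y t)) ^ 2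
              + k.c11 * (px (pt ε t (Y t)) * py (pt ε t (Y t)))))) := by
    funext t
    rw [e1 t]
    rfl
  rw [hVeq]
  have hm : k.m (pt ε θ (Y θ)).2.1 = k.m (Y θ) := rfl
  have hw : (pt ε θ (Y θ)).2.1.2.1 = (Y θ).2.1 := rfl
  have hνe : (pt ε θ (Y θ)).2.1.2.2 = (Y θ).2.2 := rfl
  have hεe : (pt ε θ (Y θ)).2.2 = ε := rfl
  rw [hm, hw, hνe, hεe] at hexp
  simp only [C₃x, C₃y, C₄x, C₄y, C₂x, C₂y] at hexp
  generalize k.Θ (pt ε θ (Y θ)) = T at *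
  generalize k.X₁ (pt ε θ (Y θ)) = X at *
  generalize k.Y₁ (pt ε θ (Y θ)) = X' at *
  generalize k.Θ₁ (pt ε θ (Y θ)) = T₁ at *
  generalize k.Rq (pt ε θ (Y θ)) = R at *
  generalize k.Qw (pt ε θ (Y θ)) = Q at *
  refine (((hX.pow 2).add (hX'.pow 2)).add ((((((hX.pow 3).const_mul k.c30).add
    (((hX.pow 2).mul hX').const_mul k.c21)).add ((hX'.pow 3).const_mul k.c03)).add
    (((((((hX.pow 4).const_mul k.c40).add (((hX.pow 3).mul hX').const_mul k.c31)).add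
      ((hX.mul (hX'.pow 3)).const_mul k.c13)).add ((hX'.pow 4).const_mul k.c04)).add
      (hν.mul (((hX.pow 2).const_mul k.c20).add ((hX.mul hX').const_mul k.c11)))).const_mul
        ε)).const_mul ε)).congr_deriv ?_
  simp only [Pi.add_apply, Pi.mul_apply, Pi.pow_apply, Nat.cast_ofNat, Nat.add_one_sub_one,
    zero_mul, zero_add, pow_one]
  generalize px (pt ε θ (Y θ)) = x at *
  generalize py (pt ε θ (Y θ)) = y at *
  generalize k.m (Y θ) = μ at *
  field_simp
  linear_combination hexp - ε ^ 2 * μ * hΘdef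

/-- The normal form in polar coordinates is a polar system with rate `m`. -/
theorem exists_polarSystem (ν₀ : ℝ) : ∃ C > 0, ∃ ε₀ > 0, IsTameRate C ν₀ k.m ∧
    ∀ ε, 0 < ε → ε ≤ ε₀ →
      (∀ θ, ∀ Y ∈ box ν₀, k.ρ / 2 ≤ k.Θ (pt ε θ Y) ∧ |k.Θ (pt ε θ Y) - k.ρ| ≤ C * ε) ∧
      (∀ Y : ℝ → St, Continuous Y → (∀ θ, Y θ ∈ box ν₀) →
        Continuous fun θ => k.Θ (pt ε θ (Y θ))) ∧
      ∃ S : PolarSystem C (k.A / k.ρ) ν₀ ε k.m,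
        (S.f = fun θ Y => k.fq (pt ε θ Y)) ∧ S.g = fun θ Y => k.gq (pt ε θ Y) := by
  have hρ := k.ρ_pos
  have hr : ∀ {ε₀ : ℝ}, ∀ q ∈ ptBox ν₀ ε₀, q.2.1.1 ≠ 0 := fun q hq =>
    (fst_pos_of_mem_ptBox hq).ne'
  obtain ⟨B, hB⟩ := (isCompact_ptBox ν₀ 1).exists_bound_of_continuousOn (f := k.Θ₁)
    fun q hq => (k.contDiffAt_Θ₁ (hr q hq)).continuousAt.continuousWithinAt
  set B' := max B 1 with hB'
  have hB'1 : 1 ≤ B' := le_max_right _ _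
  have hB'0 : 0 < B' := by linarith
  set ε₀ := min 1 (k.ρ / (2 * B')) with hε₀
  have hε₀0 : 0 < ε₀ := by positivity
  have hΘ₁ : ∀ q ∈ ptBox ν₀ ε₀, |k.Θ₁ q| ≤ B' := fun q hq =>
    (hB q ⟨hq.1, hq.2.1, hq.2.2.1, hq.2.2.2.trans (min_le_left _ _)⟩).trans (le_max_left _ _)
  have hΘ : ∀ q ∈ ptBox ν₀ ε₀, k.ρ / 2 ≤ k.Θ q := fun q hq => by
    have h1 := (abs_le.1 (hΘ₁ q hq)).1
    have h2 : q.2.2 ≤ k.ρ / (2 * B') := hq.2.2.2.trans (min_le_right _ _)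
    have h3 : 0 ≤ q.2.2 := hq.2.2.1
    have h4 : q.2.2 * B' ≤ k.ρ / 2 := by
      calc q.2.2 * B' ≤ k.ρ / (2 * B') * B' := by gcongr
        _ = _ := by field_simp
    simp only [Θ]
    nlinarith
  have hΘ0 : ∀ q ∈ ptBox ν₀ ε₀, k.Θ q ≠ 0 := fun q hq => by
    have := hΘ q hq
    exact (by linarith : 0 < k.Θ q).ne'
  have hX := k.contDiff_X₁
  have hY := k.contDiff_Y₁
  have hZ := k.contDiff_Z₁
  have hQ := k.contDiff_Qw
  have hR := k.contDiff_Rq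
  have hV := k.contDiff_V₁q
  have hm : ContDiff ℝ 1 k.m := by unfold m; fun_prop
  have hfq : ∀ q ∈ ptBox ν₀ ε₀, ContDiffAt ℝ 1 k.fq q := fun q hq => by
    have h1 := k.contDiffAt_Θ (hr q hq)
    refine ContDiffAt.div (ContDiff.contDiffAt ?_) h1 (hΘ0 q hq)
    fun_prop
  have hgq : ∀ q ∈ ptBox ν₀ ε₀, ContDiffAt ℝ 1 k.gq q := fun q hq => by
    have h1 := k.contDiffAt_Θ (hr q hq)
    have h2 := k.contDiffAt_Θ₁ (hr q hq)
    refine ContDiffAt.add (ContDiffAt.div hZ.contDiffAt h1 (hΘ0 q hq))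
      (ContDiffAt.div ?_ ?_ (mul_ne_zero hρ.ne' (hΘ0 q hq))) <;> fun_prop
  have hqq : ∀ q ∈ ptBox ν₀ ε₀, ContDiffAt ℝ 1 (fun q => k.Qw q / k.Θ q) q := fun q hq =>
    hQ.contDiffAt.div (k.contDiffAt_Θ (hr q hq)) (hΘ0 q hq)
  have hvq : ∀ q ∈ ptBox ν₀ ε₀,
      ContDiffAt ℝ 1 (fun q => (k.Rq q - k.m q.2.1 * k.Θ₁ q) / k.Θ q) q := fun q hq => by
    have h2 := k.contDiffAt_Θ₁ (hr q hq)
    refine ContDiffAt.div ?_ (k.contDiffAt_Θ (hr q hq)) (hΘ0 q hq)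
    fun_prop
  obtain ⟨C₁, hC₁⟩ := exists_isTame hfq
  obtain ⟨C₂, hC₂⟩ := exists_isTame hgq
  obtain ⟨C₃, hC₃⟩ := exists_isTame (ν₀ := ν₀) (ε₀ := ε₀) fun q _ => hV.contDiffAt (x := q)
  obtain ⟨C₄, hC₄⟩ := exists_isTame hqq
  obtain ⟨C₅, hC₅⟩ := exists_isTame hvq
  obtain ⟨C₆, hC₆⟩ := k.isTameRate_m ν₀
  set C := |C₁| + |C₂| + |C₃| + |C₄| + |C₅| + |C₆| + B' with hC
  have hle : C₁ ≤ C ∧ C₂ ≤ C ∧ C₃ ≤ C ∧ C₄ ≤ C ∧ C₅ ≤ C ∧ C₆ ≤ C ∧ B' ≤ C := by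
    have := le_abs_self C₁
    have := le_abs_self C₂
    have := le_abs_self C₃
    have := le_abs_self C₄
    have := le_abs_self C₅
    have := le_abs_self C₆
    have := abs_nonneg C₁
    have := abs_nonneg C₂
    have := abs_nonneg C₃
    have := abs_nonneg C₄
    have := abs_nonneg C₅
    have := abs_nonneg C₆
    refine ⟨?_, ?_, ?_, ?_, ?_, ?_, ?_⟩ <;> linarith
  obtain ⟨hle₁, hle₂, hle₃, hle₄, hle₅, hle₆, hleB⟩ := hle
  refine ⟨C, by linarith, ε₀, hε₀0, hC₆ C hle₆, fun ε hε hεε₀ => ⟨fun θ Y hY => ?_, ?_, ?_⟩⟩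
  · have hq := pt_mem hε.le hεε₀ θ hY
    refine ⟨hΘ _ hq, ?_⟩
    have : k.Θ (pt ε θ Y) - k.ρ = ε * k.Θ₁ (pt ε θ Y) := by simp only [Θ, pt]; ring
    rw [this, abs_mul, abs_of_pos hε, mul_comm]
    gcongr
    exact (hΘ₁ _ hq).trans hleB
  · exact fun Y hY hY' =>
      continuous_comp_pt (fun q hq => k.contDiffAt_Θ (hr q hq)) hε.le hεε₀ hY hY'
  · refine ⟨{ f := fun θ Y => k.fq (pt ε θ Y)
              g := fun θ Y => k.gq (pt ε θ Y)
              V₁ := fun θ Y => k.V₁q (pt ε θ Y)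
              q := fun θ Y => k.Qw (pt ε θ Y) / k.Θ (pt ε θ Y)
              v := fun θ Y => (k.Rq (pt ε θ Y) - k.m Y * k.Θ₁ (pt ε θ Y)) / k.Θ (pt ε θ Y)
              tame_f := hC₁ C hle₁ ε hε.le hεε₀
              tame_g := hC₂ C hle₂ ε hε.le hεε₀
              tame_V₁ := hC₃ C hle₃ ε hε.le hεε₀
              tame_q := hC₄ C hle₄ ε hε.le hεε₀
              tame_v := hC₅ C hle₅ ε hε.le hεε₀
              cont_f := fun Y hY =>
                continuous_comp_pt hfq hε.le hεε₀ (Y := fun _ => Y) continuous_const fun _ => hY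
              cont_g := fun Y hY =>
                continuous_comp_pt hgq hε.le hεε₀ (Y := fun _ => Y) continuous_const fun _ => hY
              per_f := fun θ Y => by rw [pt_add_two_pi]
              per_g := fun θ Y => by rw [pt_add_two_pi]
              per_V₁ := fun θ Y => by rw [pt_add_two_pi]
              deriv_V := fun Y θ hY hd => ?_ }, rfl, rfl⟩
    have hq := pt_mem hε.le hεε₀ θ hY
    exact k.hasDerivAt_V (hr _ hq) (hΘ0 _ hq) hd

end NormalForm

end Hopf


namespace Hopf

open Real

/-! ### From the angle back to time -/

theorem hasDerivAt_integral_inv {ω : ℝ → ℝ} (hω : Continuous ω) (h0 : ∀ θ, ω θ ≠ 0) (θ₀ θ : ℝ) :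
    HasDerivAt (fun θ => ∫ t in θ₀..θ, (ω t)⁻¹) (ω θ)⁻¹ θ := by
  have hc : Continuous fun t => (ω t)⁻¹ := hω.inv₀ h0
  exact intervalIntegral.integral_hasDerivAt_right (hc.intervalIntegrable _ _)
    (hc.stronglyMeasurableAtFilter _ _) hc.continuousAt

/-- A scalar autonomous equation with a continuous, positive and bounded right-hand side has global
solutions: the inverse functions of the antiderivatives of its reciprocal. -/
theorem exists_time_change {ω : ℝ → ℝ} (hω : Continuous ω) {c C : ℝ} (hc : 0 < c)
    (hle : ∀ θ, c ≤ ω θ) (hge : ∀ θ, ω θ ≤ C) (θ₀ : ℝ) :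
    ∃ φ : ℝ → ℝ, φ 0 = θ₀ ∧ ∀ t, HasDerivAt φ (ω (φ t)) t := by
  have hpos : ∀ θ, 0 < ω θ := fun θ => hc.trans_le (hle θ)
  have hC : 0 < C := (hpos 0).trans_le (hge 0)
  set τ : ℝ → ℝ := fun θ => ∫ t in θ₀..θ, (ω t)⁻¹ with hτ
  have hd : ∀ θ, HasDerivAt τ (ω θ)⁻¹ θ := hasDerivAt_integral_inv hω (fun θ => (hpos θ).ne') θ₀
  have hmono : StrictMono τ := strictMono_of_deriv_pos fun θ => by
    rw [(hd θ).deriv]; exact inv_pos.2 (hpos θ)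
  have hcont : Continuous τ := continuous_iff_continuousAt.2 fun θ => (hd θ).continuousAt
  -- `τ θ - θ / C` is nondecreasing
  have hmono2 : Monotone fun θ => τ θ - C⁻¹ * θ := by
    have hd2 : ∀ θ, HasDerivAt (fun θ => τ θ - C⁻¹ * θ) ((ω θ)⁻¹ - C⁻¹) θ := fun θ => by
      have := (hd θ).sub ((hasDerivAt_id θ).const_mul C⁻¹)
      rwa [mul_one] at this
    refine monotone_of_deriv_nonneg (fun θ => (hd2 θ).differentiableAt) fun θ => ?_
    rw [(hd2 θ).deriv, sub_nonneg]
    exact inv_anti₀ (hpos θ) (hge θ)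
  have hC' : 0 < C⁻¹ := inv_pos.2 hC
  have htop : Tendsto τ atTop atTop := by
    refine tendsto_atTop_mono' _ (f₁ := fun θ => C⁻¹ * θ + τ 0) ?_
      (tendsto_atTop_add_const_right _ _ (tendsto_id.const_mul_atTop hC'))
    filter_upwards [eventually_ge_atTop 0] with θ hθ
    have := hmono2 hθ
    simp only [mul_zero, sub_zero] at this
    linarith
  have hbot : Tendsto τ atBot atBot := by
    refine tendsto_atBot_mono' _ (f₁ := fun θ => C⁻¹ * θ + τ 0) ?_
      (tendsto_atBot_add_const_right _ _ (tendsto_id.const_mul_atBot hC'))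
    filter_upwards [eventually_le_atBot 0] with θ hθ
    have := hmono2 hθ
    simp only [mul_zero, sub_zero] at this
    linarith
  set e := hmono.orderIsoOfSurjective τ (hcont.surjective htop hbot) with he
  refine ⟨e.symm, ?_, fun t => ?_⟩
  · rw [OrderIso.symm_apply_eq]
    change (0 : ℝ) = τ θ₀
    simp only [hτ, intervalIntegral.integral_same]
  · have h1 := HasDerivAt.of_local_left_inverse (f := τ) (g := e.symm) (a := t)
      e.symm.continuous.continuousAt (hd (e.symm t)) (inv_ne_zero (hpos _).ne')
      (Eventually.of_forall fun s => e.apply_symm_apply s)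
    rwa [inv_inv] at h1

theorem time_change_unique {ω : ℝ → ℝ} (hω : Continuous ω) (hpos : ∀ θ, 0 < ω θ) {φ ψ : ℝ → ℝ}
    (hφ : ∀ t, HasDerivAt φ (ω (φ t)) t) (hψ : ∀ t, HasDerivAt ψ (ω (ψ t)) t) (h0 : φ 0 = ψ 0) :
    φ = ψ := by
  set τ : ℝ → ℝ := fun θ => ∫ t in 0..θ, (ω t)⁻¹ with hτ
  have hd : ∀ θ, HasDerivAt τ (ω θ)⁻¹ θ := hasDerivAt_integral_inv hω (fun θ => (hpos θ).ne') 0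
  have hmono : StrictMono τ := strictMono_of_deriv_pos fun θ => by
    rw [(hd θ).deriv]; exact inv_pos.2 (hpos θ)
  funext t
  refine hmono.injective ?_
  have h1 : ∀ t, HasDerivAt (fun t => τ (φ t) - τ (ψ t)) 0 t := fun t => by
    refine (((hd (φ t)).comp t (hφ t)).sub ((hd (ψ t)).comp t (hψ t))).congr_deriv ?_
    rw [inv_mul_cancel₀ (hpos _).ne', inv_mul_cancel₀ (hpos _).ne', sub_self]
  have h2 := is_const_of_deriv_eq_zero (fun t => (h1 t).differentiableAt)
    (fun t => (h1 t).deriv) t 0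
  simp only [h0, sub_self] at h2
  linarith

theorem le_time_change {ω φ : ℝ → ℝ} {c : ℝ} (hle : ∀ θ, c ≤ ω θ)
    (hφ : ∀ t, HasDerivAt φ (ω (φ t)) t) {t : ℝ} (ht : 0 ≤ t) : φ 0 + c * t ≤ φ t := by
  have hm : Monotone fun t => φ t - c * t := by
    have hd : ∀ t, HasDerivAt (fun t => φ t - c * t) (ω (φ t) - c) t := fun t => by
      have := (hφ t).sub ((hasDerivAt_id t).const_mul c)
      rwa [mul_one] at this
    refine monotone_of_deriv_nonneg (fun t => (hd t).differentiableAt) fun t => ?_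
    rw [(hd t).deriv, sub_nonneg]
    exact hle _
  have := hm ht
  simp only [mul_zero, sub_zero] at this
  linarith

theorem strictMono_time_change {ω φ : ℝ → ℝ} (hpos : ∀ θ, 0 < ω θ)
    (hφ : ∀ t, HasDerivAt φ (ω (φ t)) t) : StrictMono φ :=
  strictMono_of_deriv_pos fun t => by rw [(hφ t).deriv]; exact hpos _

theorem abs_time_change_sub_le {ω φ : ℝ → ℝ} {ρ K : ℝ} (hle : ∀ θ, |ω θ - ρ| ≤ K)
    (hφ : ∀ t, HasDerivAt φ (ω (φ t)) t) (h0 : φ 0 = 0) (t : ℝ) : |φ t - ρ * t| ≤ K * |t| := by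
  have hd : ∀ t, HasDerivAt (fun t => φ t - ρ * t) (ω (φ t) - ρ) t := fun t => by
    have := (hφ t).sub ((hasDerivAt_id t).const_mul ρ)
    rwa [mul_one] at this
  have := convex_univ.norm_image_sub_le_of_norm_hasDerivWithin_le (C := K)
    (fun t _ => (hd t).hasDerivWithinAt) (fun t _ => hle (φ t)) (mem_univ 0) (mem_univ t)
  simpa [h0] using this

/-- For every angle reached after the start there is a time. -/
theorem exists_time {ω φ : ℝ → ℝ} {c : ℝ} (hc : 0 < c) (hle : ∀ θ, c ≤ ω θ)
    (hφ : ∀ t, HasDerivAt φ (ω (φ t)) t) {θ : ℝ} (hθ : φ 0 ≤ θ) : ∃ t, 0 ≤ t ∧ φ t = θ := by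
  have hcont : Continuous φ := continuous_iff_continuousAt.2 fun t => (hφ t).continuousAt
  have hT : 0 ≤ (θ - φ 0) / c := div_nonneg (by linarith) hc.le
  have h1 := le_time_change hle hφ hT
  rw [mul_div_cancel₀ _ hc.ne'] at h1
  obtain ⟨t, ht, hte⟩ := intermediate_value_Icc hT hcont.continuousOn
    (⟨hθ, by linarith⟩ : θ ∈ Icc (φ 0) (φ ((θ - φ 0) / c)))
  exact ⟨t, ht.1, hte⟩

namespace NormalForm

variable (k : NormalForm)

/-- The first component of the normal form. -/
def fieldX (μ x y z : ℝ) : ℝ :=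
  -(k.ρ * y) + (x + z) * (k.a₁ * x + k.a₂ * y + k.a₃ * z)
    + μ * (k.n₁ * (k.l₁ * x + k.l₂ * y + k.l₃ * z))

/-- The second component of the normal form. -/
def fieldY (μ x y z : ℝ) : ℝ :=
  k.ρ * x + (x + z) * (k.b₁ * x + k.b₂ * y + k.b₃ * z)
    + μ * (k.n₂ * (k.l₁ * x + k.l₂ * y + k.l₃ * z))

/-- The third component of the normal form. -/
def fieldZ (μ x y z : ℝ) : ℝ :=
  -(k.A * z) + (x + z) * (k.d₁ * x + k.d₂ * y + k.d₃ * z)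
    + μ * (k.n₃ * (k.l₁ * x + k.l₂ * y + k.l₃ * z))

/-- A solution in polar coordinates, reparametrized by time, solves the normal form. -/
theorem hasDerivAt_coords {ε : ℝ} {Y : ℝ → St} {φ : ℝ → ℝ} {t : ℝ} (hr : (Y (φ t)).1 ≠ 0)
    (hΘ : k.Θ (pt ε (φ t) (Y (φ t))) ≠ 0)
    (hY : HasDerivAt Y (ε * k.fq (pt ε (φ t) (Y (φ t))),
      -(k.A / k.ρ) * (Y (φ t)).2.1 + ε * k.gq (pt ε (φ t) (Y (φ t))), 0) (φ t))
    (hφ : HasDerivAt φ (k.Θ (pt ε (φ t) (Y (φ t)))) t) :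
    HasDerivAt (fun t => ε * px (pt ε (φ t) (Y (φ t))))
      (k.fieldX (ε ^ 2 * (Y (φ t)).2.2) (ε * px (pt ε (φ t) (Y (φ t))))
        (ε * py (pt ε (φ t) (Y (φ t)))) (ε ^ 2 * k.pz (pt ε (φ t) (Y (φ t))))) t ∧
    HasDerivAt (fun t => ε * py (pt ε (φ t) (Y (φ t))))
      (k.fieldY (ε ^ 2 * (Y (φ t)).2.2) (ε * px (pt ε (φ t) (Y (φ t))))
        (ε * py (pt ε (φ t) (Y (φ t)))) (ε ^ 2 * k.pz (pt ε (φ t) (Y (φ t))))) t ∧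
    HasDerivAt (fun t => ε ^ 2 * k.pz (pt ε (φ t) (Y (φ t))))
      (k.fieldZ (ε ^ 2 * (Y (φ t)).2.2) (ε * px (pt ε (φ t) (Y (φ t))))
        (ε * py (pt ε (φ t) (Y (φ t)))) (ε ^ 2 * k.pz (pt ε (φ t) (Y (φ t))))) t := by
  obtain ⟨hX, hX'⟩ := k.hasDerivAt_px_py hr hΘ hY
  have hw := (hasDerivAt_components hY).2.1
  have hX := hX.comp t hφ
  have hX' := hX'.comp t hφ
  have hw := hw.comp t hφ
  rw [div_mul_cancel₀ _ hΘ] at hX hX'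
  have hρ := k.ρ_pos.ne'
  have hw' : (-(k.A / k.ρ) * (Y (φ t)).2.1 + ε * k.gq (pt ε (φ t) (Y (φ t))))
      * k.Θ (pt ε (φ t) (Y (φ t))) = -(k.A * (Y (φ t)).2.1) + ε * k.Z₁ (pt ε (φ t) (Y (φ t))) := by
    have hΘdef : k.Θ (pt ε (φ t) (Y (φ t))) = k.ρ + ε * k.Θ₁ (pt ε (φ t) (Y (φ t))) := rfl
    have hg : k.gq (pt ε (φ t) (Y (φ t))) * k.Θ (pt ε (φ t) (Y (φ t)))
        = k.Z₁ (pt ε (φ t) (Y (φ t)))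
          + k.A * (Y (φ t)).2.1 * k.Θ₁ (pt ε (φ t) (Y (φ t))) / k.ρ := by
      have : (pt ε (φ t) (Y (φ t))).2.1.2.1 = (Y (φ t)).2.1 := rfl
      simp only [gq, this]
      field_simp
    rw [add_mul, mul_assoc ε, hg, hΘdef]
    field_simp
    ring
  rw [hw'] at hw
  have hwe : (pt ε (φ t) (Y (φ t))).2.1.2.1 = (Y (φ t)).2.1 := rfl
  have hνe : (pt ε (φ t) (Y (φ t))).2.1.2.2 = (Y (φ t)).2.2 := rfl
  have hεe : (pt ε (φ t) (Y (φ t))).2.2 = ε := rfl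
  have hpz : k.pz (pt ε (φ t) (Y (φ t)))
      = k.hq (px (pt ε (φ t) (Y (φ t)))) (py (pt ε (φ t) (Y (φ t)))) + (Y (φ t)).2.1 := rfl
  have hX₁ := k.X₁_eq (pt ε (φ t) (Y (φ t)))
  have hY₁ := k.Y₁_eq (pt ε (φ t) (Y (φ t)))
  refine ⟨(hX.const_mul ε).congr_deriv ?_, (hX'.const_mul ε).congr_deriv ?_, ?_⟩
  · simp only [fieldX, X₁, ℓ, hεe, hνe]
    ring
  · simp only [fieldY, Y₁, ℓ, hεe, hνe]
    ring
  · have hZ := ((((hX.pow 2).const_mul k.h₁).add ((hX.mul hX').const_mul k.h₂)).add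
      ((hX'.pow 2).const_mul k.h₃)).add hw
    refine (hZ.const_mul (ε ^ 2)).congr_deriv ?_
    simp only [Nat.cast_ofNat, Nat.add_one_sub_one,
      pow_one, Function.comp_apply]
    simp only [fieldZ, Z₁, ℓ, hεe, hνe]
    rw [hpz]
    simp only [hq]
    rw [← k.h_eq₁, ← k.h_eq₂]
    linear_combination (ε ^ 2 * py (pt ε (φ t) (Y (φ t))) ^ 2) * k.h_eq₃

end NormalForm

end Hopf


/-! ### The Oregonator in eigencoordinates -/

namespace Oregonator

open Flow3

namespace Params

variable (p : Params)

/-- The point with coordinates `x, y, z` in the basis `ξ, η, ζ`. -/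
def comb (x y z : ℝ) : E3 := x • p.ξ + y • p.η + z • p.ζ

/-- The `ζ`-coordinate. -/
def projZ (v : E3) : ℝ := inner ℝ v p.ζs / p.D₀

theorem projX_linear (a b : ℝ) (u v : E3) :
    p.projX (a • u + b • v) = a * p.projX u + b * p.projX v := by
  simp only [projX, inner_add_left, real_inner_smul_left]; ring

theorem projY_linear (a b : ℝ) (u v : E3) :
    p.projY (a • u + b • v) = a * p.projY u + b * p.projY v := by
  simp only [projY, inner_add_left, real_inner_smul_left]; ring

theorem inner_eq (u v : E3) : (inner ℝ u v : ℝ) = u 0 * v 0 + u 1 * v 1 + u 2 * v 2 := by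
  simp [PiLp.inner_apply, Fin.sum_univ_three, mul_comm]

variable {p}

namespace Admissible

variable (h : p.Admissible)
include h

theorem add_pos_eg : 0 < p.e + p.g := add_pos h.e_pos h.g_pos

theorem inner_ξ_ξs : (inner ℝ p.ξ p.ξs : ℝ) =
    (p.δ₀ ^ 2 * (p.e + p.g) - (p.e + p.g) * p.s) / (p.κ * p.s) := by
  have h1 := h.κ_pos.ne'
  have h2 := h.s_pos.ne'
  rw [inner_eq, h.ξ_eq, h.ξs_eq]
  simp
  field_simp
  ring

theorem inner_ξ_ηs : (inner ℝ p.ξ p.ηs : ℝ) =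
    -(p.ρ * (p.s + p.δ₀ * (p.e + p.g))) / (p.κ * p.s) := by
  have h1 := h.κ_pos.ne'
  have h2 := h.s_pos.ne'
  have h3 := h.δ₀_pos.ne'
  rw [inner_eq, h.ξ_eq, h.ηs_eq]
  simp
  field_simp
  ring

theorem inner_η_ξs : (inner ℝ p.η p.ξs : ℝ) =
    p.ρ * (p.s + p.δ₀ * (p.e + p.g)) / (p.κ * p.s) := by
  have h1 := h.κ_pos.ne'
  have h2 := h.s_pos.ne'
  rw [inner_eq, η_eq, h.ξs_eq]
  simp
  field_simp

theorem inner_η_ηs : (inner ℝ p.η p.ηs : ℝ) = -(p.ρ ^ 2 * (p.e + p.g)) / (p.κ * p.s) := by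
  have h1 := h.κ_pos.ne'
  have h2 := h.s_pos.ne'
  have h3 := h.δ₀_pos.ne'
  rw [inner_eq, η_eq, h.ηs_eq]
  simp
  field_simp

theorem inner_ζ_ξs : (inner ℝ p.ζ p.ξs : ℝ) = 0 := by
  have h1 := h.κ_pos.ne'
  have h2 := h.add_pos_eg.ne'
  rw [inner_eq, ζ_eq, h.ξs_eq]
  simp
  field_simp
  ring

theorem inner_ζ_ηs : (inner ℝ p.ζ p.ηs : ℝ) = 0 := by
  have h1 := h.κ_pos.ne'
  have h2 := h.add_pos_eg.ne'
  have h3 := h.δ₀_pos.ne'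
  rw [inner_eq, ζ_eq, h.ηs_eq]
  simp
  field_simp
  ring

theorem inner_ξ_ζs : (inner ℝ p.ξ p.ζs : ℝ) = 0 := by
  have h1 := h.κ_pos.ne'
  have h2 := h.s_pos.ne'
  have h3 := h.δ₀_pos.ne'
  rw [inner_eq, h.ξ_eq, h.ζs_eq]
  simp
  field_simp
  ring

theorem inner_η_ζs : (inner ℝ p.η p.ζs : ℝ) = 0 := by
  have h1 := h.κ_pos.ne'
  have h2 := h.s_pos.ne'
  have h3 := h.δ₀_pos.ne'
  rw [inner_eq, η_eq, h.ζs_eq]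
  simp
  field_simp
  ring

theorem D₀_pos : 0 < p.D₀ := by
  have h1 := h.κ_pos
  have h2 := h.s_pos
  have h3 := h.δ₀_pos
  have h4 := h.add_pos_eg
  have h5 : p.D₀ = (p.e + p.g + 2 * p.δ₀ + p.s / (p.e + p.g)) / p.κ := by
    rw [D₀, inner_eq, ζ_eq, h.ζs_eq]
    simp
    field_simp
    ring
  rw [h5]
  positivity

theorem inner_η_ηs' : (inner ℝ p.η p.ηs : ℝ) = inner ℝ p.ξ p.ξs := by
  rw [h.inner_η_ηs, h.inner_ξ_ξs, s]; congr 1; ring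

theorem inner_η_ξs' : (inner ℝ p.η p.ξs : ℝ) = -inner ℝ p.ξ p.ηs := by
  rw [h.inner_η_ξs, h.inner_ξ_ηs]; ring

theorem Dsq_pos : 0 < p.Dsq := by
  have h1 := h.κ_pos
  have h2 := h.s_pos
  have h3 := h.δ₀_pos
  have h4 := h.add_pos_eg
  have h5 := h.ρ_pos
  have h6 : (inner ℝ p.ξ p.ηs : ℝ) < 0 := by
    rw [h.inner_ξ_ηs, neg_div]
    exact neg_neg_of_pos (by positivity)
  rw [Dsq]
  nlinarith [sq_nonneg (inner ℝ p.ξ p.ξs : ℝ)]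

theorem projX_comb (x y z : ℝ) : p.projX (p.comb x y z) = x := by
  have hD := h.Dsq_pos.ne'
  rw [Dsq] at hD
  simp only [projX, comb, inner_add_left, real_inner_smul_left, h.inner_ζ_ξs, h.inner_ζ_ηs,
    h.inner_η_ηs', h.inner_η_ξs', Dsq]
  field_simp
  ring

theorem projY_comb (x y z : ℝ) : p.projY (p.comb x y z) = y := by
  have hD := h.Dsq_pos.ne'
  rw [Dsq] at hD
  simp only [projY, comb, inner_add_left, real_inner_smul_left, h.inner_ζ_ξs, h.inner_ζ_ηs,
    h.inner_η_ηs', h.inner_η_ξs', Dsq]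
  field_simp
  ring

theorem projZ_comb (x y z : ℝ) : p.projZ (p.comb x y z) = z := by
  have hD := h.D₀_pos.ne'
  rw [D₀] at hD
  simp only [projZ, comb, inner_add_left, real_inner_smul_left, h.inner_ξ_ζs, h.inner_η_ζs, D₀]
  field_simp
  ring

/-- Every vector is the combination of `ξ, η, ζ` with its coordinates as coefficients. -/
theorem comb_proj (v : E3) : p.comb (p.projX v) (p.projY v) (p.projZ v) = v := by
  -- the coordinate map is a left inverse of an injective, hence bijective, linear map
  let L : (Fin 3 → ℝ) →ₗ[ℝ] E3 :=
    { toFun := fun c => p.comb (c 0) (c 1) (c 2)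
      map_add' := fun c d => by simp only [comb, Pi.add_apply, add_smul]; abel
      map_smul' := fun a c => by
        simp only [comb, Pi.smul_apply, smul_eq_mul, mul_smul, smul_add, RingHom.id_apply] }
  have hinj : Function.Injective L := fun c d hcd => by
    have hcd' : p.comb (c 0) (c 1) (c 2) = p.comb (d 0) (d 1) (d 2) := hcd
    funext i
    fin_cases i
    · have := congrArg p.projX hcd'
      rwa [h.projX_comb, h.projX_comb] at this
    · have := congrArg p.projY hcd'
      rwa [h.projY_comb, h.projY_comb] at this
    · have := congrArg p.projZ hcd'
      rwa [h.projZ_comb, h.projZ_comb] at this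
  have hsurj : Function.Surjective L :=
    (LinearMap.injective_iff_surjective_of_finrank_eq_finrank (by simp)).1 hinj
  obtain ⟨c, rfl⟩ := hsurj v
  change p.comb (p.projX (p.comb _ _ _)) (p.projY (p.comb _ _ _)) (p.projZ (p.comb _ _ _)) = _
  rw [h.projX_comb, h.projY_comb, h.projZ_comb]
  rfl

theorem lin_ξ : p.lin p.δ₀ p.ξ = p.ρ • p.η := by
  have h1 := h.κ_pos.ne'
  have h2 := h.s_pos.ne'
  have h3 := h.δ₀_pos.ne'
  have h4 : p.γ / p.α = (p.e + p.g) * p.s / (p.δ₀ * p.κ) := by rw [h.gamma_div, aCoef_eq]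
  rw [lin, h4, h.bCoef_eq, h.ξ_eq, η_eq]
  ext i
  fin_cases i
  · simp; field_simp; ring
  · simp; field_simp; ring
  · simp; field_simp; rw [s]; ring

theorem lin_η : p.lin p.δ₀ p.η = -p.ρ • p.ξ := by
  have h1 := h.κ_pos.ne'
  have h2 := h.s_pos.ne'
  have h3 := h.δ₀_pos.ne'
  have h4 : p.γ / p.α = (p.e + p.g) * p.s / (p.δ₀ * p.κ) := by rw [h.gamma_div, aCoef_eq]
  rw [lin, h4, h.ξ_eq, η_eq]
  ext i
  fin_cases i
  · simp; field_simp
  · simp; field_simp; ring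
  · simp; field_simp

theorem lin_ζ : p.lin p.δ₀ p.ζ = -p.A • p.ζ := by
  have h1 := h.κ_pos.ne'
  have h2 := h.s_pos.ne'
  have h3 := h.δ₀_pos.ne'
  have h5 := h.add_pos_eg.ne'
  have h4 : p.γ / p.α = (p.e + p.g) * p.s / (p.δ₀ * p.κ) := by rw [h.gamma_div, aCoef_eq]
  have hA : p.A = p.e + p.g + p.δ₀ := by rw [A, aCoef_eq]
  rw [lin, h4, h.bCoef_eq, ζ_eq, hA]
  ext i
  fin_cases i
  · simp; field_simp; ring
  · simp; field_simp; rw [s]; ring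
  · simp; field_simp; ring

omit h in
theorem lin_smul_add (δ a b c : ℝ) (u v w : E3) : p.lin δ (a • u + b • v + c • w)
    = a • p.lin δ u + b • p.lin δ v + c • p.lin δ w := by
  ext i
  fin_cases i <;> simp [lin] <;> ring

/-- The third unit vector, along which the control parameter acts. -/
abbrev _root_.Oregonator.Params.e₃ : E3 := !₂[0, 0, 1]

omit h in
theorem lin_eq_add (δ : ℝ) (u : E3) :
    p.lin δ u = p.lin p.δ₀ u + ((δ - p.δ₀) * (u 0 - u 2)) • e₃ := by
  ext i
  fin_cases i <;> simp [lin]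
  ring

end Admissible

end Params

end Oregonator


/-! ### The normal form of the Oregonator -/

namespace Oregonator

open Flow3

namespace Params

variable {p : Params}

namespace Admissible

variable (h : p.Admissible)

/-- The Oregonator in the coordinates with respect to `ξ, η, ζ`, with `μ = δ - δ₀`. The quadratic part
is divisible by the first component of `u`, which is `x + z`, and `δ` enters through
`(δ - δ₀) (u₁ - u₃) e₃`. -/
def nf : Hopf.NormalForm where
  ρ := p.ρ
  A := p.A
  a₁ := p.projX (p.G p.ξ p.ξ)
  a₂ := p.projX (p.G p.ξ p.η)
  a₃ := p.projX (p.G p.ξ p.ζ)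
  b₁ := p.projY (p.G p.ξ p.ξ)
  b₂ := p.projY (p.G p.ξ p.η)
  b₃ := p.projY (p.G p.ξ p.ζ)
  d₁ := p.projZ (p.G p.ξ p.ξ)
  d₂ := p.projZ (p.G p.ξ p.η)
  d₃ := p.projZ (p.G p.ξ p.ζ)
  n₁ := p.projX e₃
  n₂ := p.projY e₃
  n₃ := p.projZ e₃
  l₁ := p.ξ 0 - p.ξ 2
  l₂ := p.η 0 - p.η 2
  l₃ := p.ζ 0 - p.ζ 2
  h₁ := p.F₁ / p.D₀
  h₂ := p.F₂ / p.D₀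
  h₃ := p.F₃ / p.D₀
  ρ_pos := h.ρ_pos
  A_pos := h.A_pos
  h_eq₁ := by
    have h1 := h.A_pos.ne'
    have h2 : p.A ^ 2 + 4 * p.ρ ^ 2 ≠ 0 := by have := h.A_pos; positivity
    have h3 := h.D₀_pos.ne'
    rw [projZ, F₁, F₂, ← D₁]
    field_simp
    ring
  h_eq₂ := by
    have h1 := h.A_pos.ne'
    have h2 : p.A ^ 2 + 4 * p.ρ ^ 2 ≠ 0 := by have := h.A_pos; positivity
    have h3 := h.D₀_pos.ne'
    rw [projZ, F₁, F₂, F₃, ← D₂]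
    field_simp
    ring
  h_eq₃ := by
    have h1 := h.A_pos.ne'
    have h2 : p.A ^ 2 + 4 * p.ρ ^ 2 ≠ 0 := by have := h.A_pos; positivity
    have h3 := h.D₀_pos.ne'
    rw [F₂, F₃]
    field_simp
    ring

theorem G_ζ_ξ : p.G p.ζ p.ξ = p.G p.ξ p.ξ := by
  rw [G_eq, G_eq]; simp [ξ, ζ]

theorem G_ζ_η : p.G p.ζ p.η = p.G p.ξ p.η := by
  rw [G_eq, G_eq]; simp [ξ, ζ]

theorem G_comb (x y z : ℝ) : p.G (p.comb x y z) (p.comb x y z) =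
    (x + z) • (x • p.G p.ξ p.ξ + y • p.G p.ξ p.η + z • p.G p.ξ p.ζ) := by
  simp only [G_eq]
  have h0 : (p.comb x y z) 0 = x + z := by simp [comb, ξ, η, ζ]
  have h1 : p.ξ 0 = 1 := by simp [ξ]
  rw [h0, h1]
  simp only [comb, map_add, map_smul, one_smul]

/-- The number `b` of the theorem is the first Lyapunov number of the normal form. -/
theorem nf_b : (nf h).b = p.b := by
  have h1 := h.ρ_pos.ne'
  have h2 := h.D₀_pos.ne'
  have hX : p.projX (p.G p.ξ p.ζ + p.G p.ζ p.ξ)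
      = p.projX (p.G p.ξ p.ζ) + p.projX (p.G p.ξ p.ξ) := by
    simpa [G_ζ_ξ] using p.projX_linear 1 1 (p.G p.ξ p.ζ) (p.G p.ζ p.ξ)
  have hY : p.projY (p.G p.ξ p.ζ + p.G p.ζ p.ξ)
      = p.projY (p.G p.ξ p.ζ) + p.projY (p.G p.ξ p.ξ) := by
    simpa [G_ζ_ξ] using p.projY_linear 1 1 (p.G p.ξ p.ζ) (p.G p.ζ p.ξ)
  simp only [Hopf.NormalForm.b, Hopf.NormalForm.e40, Hopf.NormalForm.e04, Hopf.NormalForm.e22,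
    Hopf.NormalForm.c30, Hopf.NormalForm.c21, Hopf.NormalForm.c03, nf, b, Params.b₁, a₃₀, b₀₃, a₁₂,
    b₂₁, a₂₀, b₂₀, a₁₁, b₁₁, hX, hY, G_ζ_η]
  field_simp
  ring

theorem inner_e₃ (v : E3) : (inner ℝ e₃ v : ℝ) = v 2 := by
  rw [inner_eq]; simp

include h in
theorem Dsq_eq : p.Dsq = p.ρ ^ 2 * (p.A ^ 2 + p.ρ ^ 2) / (p.κ ^ 2 * p.s) := by
  have h1 := h.κ_pos.ne'
  have h2 := h.s_pos.ne'
  have hA : p.A = p.e + p.g + p.δ₀ := by rw [A, aCoef_eq]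
  rw [Dsq, h.inner_ξ_ξs, h.inner_ξ_ηs, hA]
  field_simp
  rw [s]
  ring

include h in
theorem projX_e₃ : p.projX e₃ = (p.e + p.g) * p.s / (p.δ₀ * (p.A ^ 2 + p.ρ ^ 2)) := by
  have h1 := h.κ_pos.ne'
  have h2 := h.s_pos.ne'
  have h3 := h.δ₀_pos.ne'
  have h4 := h.ρ_pos.ne'
  have h5 : p.A ^ 2 + p.ρ ^ 2 ≠ 0 := by have := h.A_pos; positivity
  rw [projX, inner_e₃, inner_e₃, h.Dsq_eq, h.inner_ξ_ξs, h.inner_ξ_ηs, h.ξs_eq, h.ηs_eq]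
  simp
  field_simp
  rw [s]
  ring

include h in
theorem projY_e₃ : p.projY e₃ = (p.e + p.g) * p.s * p.A / (p.ρ * p.δ₀ * (p.A ^ 2 + p.ρ ^ 2)) := by
  have h1 := h.κ_pos.ne'
  have h2 := h.s_pos.ne'
  have h3 := h.δ₀_pos.ne'
  have h4 := h.ρ_pos.ne'
  have h5 : p.A ^ 2 + p.ρ ^ 2 ≠ 0 := by have := h.A_pos; positivity
  have hA : p.A = p.e + p.g + p.δ₀ := by rw [A, aCoef_eq]
  rw [projY, inner_e₃, inner_e₃, h.Dsq_eq, h.inner_η_ξs, h.inner_η_ηs, h.ξs_eq, h.ηs_eq]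
  simp
  field_simp
  rw [s, hA]
  ring

theorem nf_κ : (nf h).κ = p.k := by
  have h2 := h.s_pos.ne'
  have h3 := h.δ₀_pos.ne'
  have h4 := h.ρ_pos.ne'
  have h5 : p.A ^ 2 + p.ρ ^ 2 ≠ 0 := by have := h.A_pos; positivity
  have hA : p.A = p.e + p.g + p.δ₀ := by rw [A, aCoef_eq]
  have hc : p.cCoef = (p.e + p.g + p.δ₀) * p.ρ ^ 2 / p.δ₀ := by
    rw [eq_div_iff h3, h.cCoef_eq]
  simp only [Hopf.NormalForm.κ, nf, h.projX_e₃, h.projY_e₃, k, hc, h.ξ_eq, η_eq, aCoef_eq]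
  simp
  field_simp
  rw [s, hA]
  ring

/-- The vector field of the Oregonator in eigencoordinates. -/
theorem field_comb (δ x y z : ℝ) : p.field δ (p.comb x y z) =
    p.comb ((nf h).fieldX (δ - p.δ₀) x y z) ((nf h).fieldY (δ - p.δ₀) x y z)
      ((nf h).fieldZ (δ - p.δ₀) x y z) := by
  have h02 : (p.comb x y z) 0 - (p.comb x y z) 2
      = (p.ξ 0 - p.ξ 2) * x + (p.η 0 - p.η 2) * y + (p.ζ 0 - p.ζ 2) * z := by
    simp [comb]; ring
  rw [h.field_eq, lin_eq_add, h02, G_comb, comb, lin_smul_add, h.lin_ξ, h.lin_η, h.lin_ζ]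
  have e1 := h.comb_proj (p.G p.ξ p.ξ)
  have e2 := h.comb_proj (p.G p.ξ p.η)
  have e3 := h.comb_proj (p.G p.ξ p.ζ)
  have e4 := h.comb_proj e₃
  simp only [Hopf.NormalForm.fieldX, Hopf.NormalForm.fieldY, Hopf.NormalForm.fieldZ, nf]
  generalize p.projX (p.G p.ξ p.ξ) = x₁ at *
  generalize p.projY (p.G p.ξ p.ξ) = y₁ at *
  generalize p.projZ (p.G p.ξ p.ξ) = z₁ at *
  generalize p.projX (p.G p.ξ p.η) = x₂ at *
  generalize p.projY (p.G p.ξ p.η) = y₂ at *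
  generalize p.projZ (p.G p.ξ p.η) = z₂ at *
  generalize p.projX (p.G p.ξ p.ζ) = x₃ at *
  generalize p.projY (p.G p.ξ p.ζ) = y₃ at *
  generalize p.projZ (p.G p.ξ p.ζ) = z₃ at *
  generalize p.projX e₃ = x₄ at *
  generalize p.projY e₃ = y₄ at *
  generalize p.projZ e₃ = z₄ at *
  rw [← e1, ← e2, ← e3, ← e4]
  simp only [comb]
  module

end Admissible

end Params

end Oregonator


/-! ### Polar coordinates in concentration space -/

namespace Hopf

open Real

/-- Points of the plane near a given point have polar coordinates near the given ones. -/
theorem exists_polar_near {x y θ₁ r₁ s : ℝ} (hr : 1 / 2 ≤ r₁) (hs : s ≤ 1 / 4)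
    (hxy : |x - r₁ * cos θ₁| + |y - r₁ * sin θ₁| ≤ s) :
    ∃ θ r, x = r * cos θ ∧ y = r * sin θ ∧ |r - r₁| ≤ 2 * s ∧ |θ - θ₁| ≤ 8 * s := by
  have hcs := cos_sq_add_sin_sq θ₁
  -- the point, rotated by the angle `-θ₁`
  set z : ℂ := ⟨x * cos θ₁ + y * sin θ₁, y * cos θ₁ - x * sin θ₁⟩ with hz
  have hc1 := abs_cos_le_one θ₁
  have hs1 := abs_sin_le_one θ₁
  have hprod : ∀ a b : ℝ, |b| ≤ 1 → |a * b| ≤ |a| := fun a b hb => by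
    rw [abs_mul]; exact mul_le_of_le_one_right (abs_nonneg _) hb
  have hre : |z.re - r₁| ≤ s := by
    have : z.re - r₁ = (x - r₁ * cos θ₁) * cos θ₁ + (y - r₁ * sin θ₁) * sin θ₁ := by
      simp only [hz]; linear_combination r₁ * hcs
    rw [this]
    refine (abs_add_le _ _).trans (le_trans ?_ hxy)
    exact add_le_add (hprod _ _ hc1) (hprod _ _ hs1)
  have him : |z.im| ≤ s := by
    have : z.im = (y - r₁ * sin θ₁) * cos θ₁ + -(x - r₁ * cos θ₁) * sin θ₁ := by
      simp only [hz]; ring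
    rw [this]
    refine (abs_add_le _ _).trans (le_trans ?_ hxy)
    rw [add_comm |x - r₁ * cos θ₁|]
    refine add_le_add (hprod _ _ hc1) ((hprod _ _ hs1).trans (abs_neg _).le)
  have hre4 : 1 / 4 ≤ z.re := by have := (abs_le.1 hre).1; linarith
  have hnorm : 1 / 4 ≤ ‖z‖ := hre4.trans (Complex.re_le_norm z)
  have hnorm0 : 0 < ‖z‖ := by linarith
  have hs0 : 0 ≤ s := (abs_nonneg _).trans hre
  refine ⟨θ₁ + z.arg, ‖z‖, ?_, ?_, ?_, ?_⟩
  · rw [cos_add]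
    have h1 := Complex.norm_mul_cos_arg z
    have h2 := Complex.norm_mul_sin_arg z
    have h3 : x = z.re * cos θ₁ - z.im * sin θ₁ := by
      simp only [hz]; linear_combination -x * hcs
    rw [h3]
    linear_combination -cos θ₁ * h1 + sin θ₁ * h2
  · rw [sin_add]
    have h1 := Complex.norm_mul_cos_arg z
    have h2 := Complex.norm_mul_sin_arg z
    have h3 : y = z.re * sin θ₁ + z.im * cos θ₁ := by
      simp only [hz]; linear_combination -y * hcs
    rw [h3]
    linear_combination -sin θ₁ * h1 - cos θ₁ * h2
  · have h1 : ‖(r₁ : ℂ)‖ = r₁ := by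
      rw [Complex.norm_real, Real.norm_eq_abs, abs_of_nonneg (by linarith)]
    calc |‖z‖ - r₁| = |‖z‖ - ‖(r₁ : ℂ)‖| := by rw [h1]
      _ ≤ ‖z - r₁‖ := abs_norm_sub_norm_le _ _
      _ ≤ |(z - r₁).re| + |(z - r₁).im| := Complex.norm_le_abs_re_add_abs_im _
      _ ≤ s + s := by
          refine add_le_add ?_ ?_
          · simpa using hre
          · simpa using him
      _ = 2 * s := by ring
  · rw [add_sub_cancel_left]
    have h1 : |z.arg| ≤ π / 2 := Complex.abs_arg_le_pi_div_two_iff.2 (by linarith)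
    have h2 := mul_abs_le_abs_sin h1
    rw [Complex.sin_arg, abs_div, abs_of_pos hnorm0, le_div_iff₀ hnorm0] at h2
    have h3 : 2 / π * |z.arg| * (1 / 4) ≤ 2 / π * |z.arg| * ‖z‖ := by gcongr
    have h4 : 2 / π * |z.arg| * (1 / 4) ≤ s := h3.trans (h2.trans him)
    have h5 : 1 / 2 ≤ 2 / π := by
      rw [div_le_div_iff₀ (by norm_num) pi_pos]; linarith [pi_le_four]
    have h6 : 1 / 2 * |z.arg| ≤ 2 / π * |z.arg| := by gcongr
    linarith

namespace NormalForm

theorem abs_hq_sub_le (k : NormalForm) {x y x₁ y₁ s : ℝ} (hpx2 : |x₁| ≤ 3 / 2)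
    (hpy2 : |y₁| ≤ 3 / 2) (hs4 : s ≤ 1 / 4) (hX : |x - x₁| ≤ s / 3) (hY : |y - y₁| ≤ s / 3) :
    |k.hq x y - k.hq x₁ y₁| ≤ 4 * (|k.h₁| + |k.h₂| + |k.h₃|) * s := by
  have hs0 : 0 ≤ s := by linarith [(abs_nonneg _).trans hX]
  have hx2 : |x| ≤ 2 := by
    have := abs_sub_abs_le_abs_sub x x₁
    linarith
  have hy2 : |y| ≤ 2 := by
    have := abs_sub_abs_le_abs_sub y y₁
    linarith
  have e1 : k.hq x y - k.hq x₁ y₁ = k.h₁ * ((x - x₁) * (x + x₁))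
      + k.h₂ * ((x - x₁) * y + x₁ * (y - y₁)) + k.h₃ * ((y - y₁) * (y + y₁)) := by
    simp only [hq]; ring
  have e2 : |(x - x₁) * (x + x₁)| ≤ 4 * s := by
    rw [abs_mul]
    have := abs_add_le x x₁
    calc |x - x₁| * |x + x₁| ≤ s / 3 * 4 := by gcongr; linarith
      _ ≤ 4 * s := by linarith
  have e3 : |(y - y₁) * (y + y₁)| ≤ 4 * s := by
    rw [abs_mul]
    have := abs_add_le y y₁
    calc |y - y₁| * |y + y₁| ≤ s / 3 * 4 := by gcongr; linarith
      _ ≤ 4 * s := by linarith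
  have e4 : |(x - x₁) * y + x₁ * (y - y₁)| ≤ 4 * s := by
    refine (abs_add_le _ _).trans ?_
    rw [abs_mul, abs_mul]
    calc |x - x₁| * |y| + |x₁| * |y - y₁| ≤ s / 3 * 2 + 3 / 2 * (s / 3) := by gcongr
      _ ≤ 4 * s := by linarith
  rw [e1]
  refine (abs_add_three _ _ _).trans ?_
  rw [abs_mul, abs_mul k.h₂, abs_mul k.h₃]
  calc _ ≤ |k.h₁| * (4 * s) + |k.h₂| * (4 * s) + |k.h₃| * (4 * s) := by gcongr
    _ = 4 * (|k.h₁| + |k.h₂| + |k.h₃|) * s := by ring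

end NormalForm

end Hopf

namespace Oregonator

open Flow3 Hopf Hopf.NormalForm

namespace Params

variable {p : Params}

theorem comb_sub (x y z x' y' z' : ℝ) :
    p.comb x y z - p.comb x' y' z' = p.comb (x - x') (y - y') (z - z') := by
  simp only [comb]; module

variable (p) in
theorem norm_comb_le : ∃ N > 0, ∀ x y z, ‖p.comb x y z‖ ≤ N * (|x| + |y| + |z|) := by
  refine ⟨‖p.ξ‖ + ‖p.η‖ + ‖p.ζ‖ + 1, by positivity, fun x y z => ?_⟩
  have h1 : ‖p.comb x y z‖ ≤ |x| * ‖p.ξ‖ + |y| * ‖p.η‖ + |z| * ‖p.ζ‖ := by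
    refine (norm_add₃_le).trans ?_
    simp only [norm_smul, Real.norm_eq_abs, le_refl]
  nlinarith [abs_nonneg x, abs_nonneg y, abs_nonneg z, norm_nonneg p.ξ, norm_nonneg p.η,
    norm_nonneg p.ζ, mul_nonneg (abs_nonneg x) (norm_nonneg p.η),
    mul_nonneg (abs_nonneg x) (norm_nonneg p.ζ), mul_nonneg (abs_nonneg y) (norm_nonneg p.ξ),
    mul_nonneg (abs_nonneg y) (norm_nonneg p.ζ), mul_nonneg (abs_nonneg z) (norm_nonneg p.ξ),
    mul_nonneg (abs_nonneg z) (norm_nonneg p.η)]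

theorem hasDerivAt_comb {x y z : ℝ → ℝ} {x' y' z' t : ℝ} (hx : HasDerivAt x x' t)
    (hy : HasDerivAt y y' t) (hz : HasDerivAt z z' t) :
    HasDerivAt (fun t => p.comb (x t) (y t) (z t)) (p.comb x' y' z') t :=
  ((hx.smul_const p.ξ).add (hy.smul_const p.η)).add (hz.smul_const p.ζ)

variable (p) in
theorem exists_proj_le : ∃ N > 0, ∀ u v, |p.projX u - p.projX v| ≤ N * ‖u - v‖ ∧
    |p.projY u - p.projY v| ≤ N * ‖u - v‖ ∧ |p.projZ u - p.projZ v| ≤ N * ‖u - v‖ := by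
  have hX : ∃ w, ∀ u, p.projX u = inner ℝ u w := by
    refine ⟨(1 / p.Dsq) • ((inner ℝ p.ξ p.ξs : ℝ) • p.ξs + (inner ℝ p.ξ p.ηs : ℝ) • p.ηs),
      fun u => ?_⟩
    simp only [projX, inner_add_right, real_inner_smul_right]
  have hY : ∃ w, ∀ u, p.projY u = inner ℝ u w := by
    refine ⟨(1 / p.Dsq) • ((inner ℝ p.η p.ξs : ℝ) • p.ξs + (inner ℝ p.η p.ηs : ℝ) • p.ηs),
      fun u => ?_⟩
    simp only [projY, inner_add_right, real_inner_smul_right]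
  have hZ : ∃ w, ∀ u, p.projZ u = inner ℝ u w := by
    refine ⟨(1 / p.D₀) • p.ζs, fun u => ?_⟩
    simp only [projZ, real_inner_smul_right]
    ring
  obtain ⟨wX, hX⟩ := hX
  obtain ⟨wY, hY⟩ := hY
  obtain ⟨wZ, hZ⟩ := hZ
  refine ⟨‖wX‖ + ‖wY‖ + ‖wZ‖ + 1, by positivity, fun u v => ?_⟩
  have key : ∀ w : E3, ‖w‖ ≤ ‖wX‖ + ‖wY‖ + ‖wZ‖ + 1 →
      |inner ℝ u w - inner ℝ v w| ≤ (‖wX‖ + ‖wY‖ + ‖wZ‖ + 1) * ‖u - v‖ := fun w hw => by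
    rw [← inner_sub_left, mul_comm]
    exact (abs_real_inner_le_norm _ _).trans (by gcongr)
  have := norm_nonneg wX
  have := norm_nonneg wY
  have := norm_nonneg wZ
  rw [hX, hX, hY, hY, hZ, hZ]
  exact ⟨key _ (by linarith), key _ (by linarith), key _ (by linarith)⟩

namespace Admissible

variable (h : p.Admissible)

/-- The point `ε X ξ + ε Y η + ε² Z ζ` with scaled polar coordinates `(θ, r, w)`, that is,
`X = r cos θ`, `Y = r sin θ`, `Z = h(X, Y) + w`. -/
def polar (ε θ : ℝ) (Y : St) : E3 :=
  p.comb (ε * px (pt ε θ Y)) (ε * py (pt ε θ Y)) (ε ^ 2 * (nf h).pz (pt ε θ Y))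

theorem polar_add_two_pi (ε θ : ℝ) (Y : St) : h.polar ε (θ + 2 * Real.pi) Y = h.polar ε θ Y := by
  simp only [polar, pt_add_two_pi]

theorem hasDerivAt_polar {C ν₀ ε : ℝ} {S : PolarSystem C ((nf h).A / (nf h).ρ) ν₀ ε (nf h).m}
    (hf : S.f = fun θ Y => (nf h).fq (pt ε θ Y)) (hg : S.g = fun θ Y => (nf h).gq (pt ε θ Y))
    {Y : ℝ → St} {φ : ℝ → ℝ} {t : ℝ} (hr : (Y (φ t)).1 ≠ 0)
    (hΘ : (nf h).Θ (pt ε (φ t) (Y (φ t))) ≠ 0)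
    (hY : HasDerivAt Y (S.field (φ t) (Y (φ t))) (φ t))
    (hφ : HasDerivAt φ ((nf h).Θ (pt ε (φ t) (Y (φ t)))) t) :
    HasDerivAt (fun t => h.polar ε (φ t) (Y (φ t)))
      (p.field (p.δ₀ + ε ^ 2 * (Y (φ t)).2.2) (h.polar ε (φ t) (Y (φ t)))) t := by
  rw [PolarSystem.field, hf, hg] at hY
  obtain ⟨h1, h2, h3⟩ := (nf h).hasDerivAt_coords hr hΘ hY hφ
  rw [polar, h.field_comb, add_sub_cancel_left]
  exact hasDerivAt_comb h1 h2 h3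

theorem polar_inj {ε θ θ' : ℝ} {Y Y' : St} (hε : 0 < ε) (hr : 0 < Y.1) (hr' : 0 < Y'.1)
    (heq : h.polar ε θ Y = h.polar ε θ' Y') :
    Real.cos θ = Real.cos θ' ∧ Real.sin θ = Real.sin θ' ∧ Y.1 = Y'.1 ∧ Y.2.1 = Y'.2.1 := by
  have hx := congrArg p.projX heq
  have hy := congrArg p.projY heq
  have hz := congrArg p.projZ heq
  simp only [polar, h.projX_comb, h.projY_comb, h.projZ_comb] at hx hy hz
  have hx := mul_left_cancel₀ hε.ne' hx
  have hy := mul_left_cancel₀ hε.ne' hy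
  have hz := mul_left_cancel₀ (pow_pos hε 2).ne' hz
  have hr2 : Y.1 ^ 2 = Y'.1 ^ 2 := by
    simp only [px, py, pt] at hx hy
    have h1 := Real.cos_sq_add_sin_sq θ
    have h2 := Real.cos_sq_add_sin_sq θ'
    linear_combination (Y.1 * Real.cos θ + Y'.1 * Real.cos θ') * hx
      + (Y.1 * Real.sin θ + Y'.1 * Real.sin θ') * hy - Y.1 ^ 2 * h1 + Y'.1 ^ 2 * h2
  have hrr : Y.1 = Y'.1 := by
    rwa [sq_eq_sq₀ hr.le hr'.le] at hr2
  have hw : Y.2.1 = Y'.2.1 := by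
    simp only [pz, hx, hy] at hz
    exact add_left_cancel hz
  simp only [px, py, pt, hrr] at hx hy
  exact ⟨mul_left_cancel₀ hr'.ne' hx, mul_left_cancel₀ hr'.ne' hy, hrr, hw⟩

/-- In polar coordinates points have size `O(ε)`, depend on the state in a Lipschitz way, and are
`ε (ξ cos ψ + η sin ψ)` to leading order if `r` is close to `1` and `θ` to `ψ`. -/
theorem exists_polar_bounds (ν₀ : ℝ) : ∃ K > 0, ∀ ε, 0 < ε → ε ≤ 1 →
    (∀ θ, ∀ Y ∈ box ν₀, ‖h.polar ε θ Y‖ ≤ K * ε) ∧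
    (∀ θ, ∀ Y ∈ box ν₀, ∀ Z ∈ box ν₀, ‖h.polar ε θ Y - h.polar ε θ Z‖ ≤ K * ε * dist Y Z) ∧
    ∀ θ ψ, ∀ Y ∈ box ν₀, ‖h.polar ε θ Y - ε • (Real.cos ψ • p.ξ + Real.sin ψ • p.η)‖
      ≤ K * ε * (|Y.1 - 1| + |θ - ψ| + ε) := by
  obtain ⟨N, hN, hcomb⟩ := p.norm_comb_le
  have hpx : ContDiff ℝ 1 px := by unfold px; fun_prop
  have hpy : ContDiff ℝ 1 py := by unfold py; fun_prop
  have hpz : ContDiff ℝ 1 (nf h).pz := by unfold pz hq px py; fun_prop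
  obtain ⟨C₁, hC₁⟩ := exists_isTame (ν₀ := ν₀) (ε₀ := 1) fun q _ => hpx.contDiffAt (x := q)
  obtain ⟨C₂, hC₂⟩ := exists_isTame (ν₀ := ν₀) (ε₀ := 1) fun q _ => hpy.contDiffAt (x := q)
  obtain ⟨C₃, hC₃⟩ := exists_isTame (ν₀ := ν₀) (ε₀ := 1) fun q _ => hpz.contDiffAt (x := q)
  set C := |C₁| + |C₂| + |C₃| + 2 with hC
  have hle : C₁ ≤ C ∧ C₂ ≤ C ∧ C₃ ≤ C ∧ 2 ≤ C := by
    have := le_abs_self C₁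
    have := le_abs_self C₂
    have := le_abs_self C₃
    have := abs_nonneg C₁
    have := abs_nonneg C₂
    have := abs_nonneg C₃
    refine ⟨?_, ?_, ?_, ?_⟩ <;> linarith
  have hC0 : 0 < C := by linarith [hle.2.2.2]
  refine ⟨N * (3 * C), by positivity, fun ε hε hε1 => ?_⟩
  have t₁ := hC₁ C hle.1 ε hε.le hε1
  have t₂ := hC₂ C hle.2.1 ε hε.le hε1
  have t₃ := hC₃ C hle.2.2.1 ε hε.le hε1
  have hε2 : ε ^ 2 ≤ ε := by nlinarith
  have hscale : ∀ {a b c d : ℝ}, 0 ≤ d → |a| ≤ d → |b| ≤ d → |c| ≤ d →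
      N * (|ε * a| + |ε * b| + |ε ^ 2 * c|) ≤ N * (3 * (ε * d)) := by
    intro a b c d hd ha hb hc
    rw [abs_mul, abs_mul, abs_mul, abs_of_pos hε, abs_of_pos (pow_pos hε 2)]
    have e1 : ε * |a| ≤ ε * d := by gcongr
    have e2 : ε * |b| ≤ ε * d := by gcongr
    have e3 : ε ^ 2 * |c| ≤ ε * d := by gcongr
    gcongr
    linarith
  refine ⟨fun θ Y hY => ?_, fun θ Y hY Z hZ => ?_, fun θ ψ Y hY => ?_⟩
  · rw [polar]
    refine (hcomb _ _ _).trans ?_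
    refine (hscale hC0.le (t₁.bound θ Y hY) (t₂.bound θ Y hY) (t₃.bound θ Y hY)).trans_eq ?_
    ring
  · rw [polar, polar, comb_sub, ← mul_sub, ← mul_sub, ← mul_sub]
    refine (hcomb _ _ _).trans ?_
    have hd : 0 ≤ dist Y Z := dist_nonneg
    refine (hscale (by positivity) (t₁.lip θ Y hY Z hZ) (t₂.lip θ Y hY Z hZ)
      (t₃.lip θ Y hY Z hZ)).trans_eq ?_
    ring
  · have e1 : ε • (Real.cos ψ • p.ξ + Real.sin ψ • p.η)
        = p.comb (ε * Real.cos ψ) (ε * Real.sin ψ) 0 := by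
      simp only [comb]; module
    rw [polar, e1, comb_sub, ← mul_sub, ← mul_sub, sub_zero]
    refine (hcomb _ _ _).trans ?_
    have hz := t₃.bound θ Y hY
    have hr : |Y.1| ≤ 3 / 2 := by
      have := (Hopf.mem_box.1 hY).1
      rw [abs_le]; constructor <;> linarith
    have hcos : |Real.cos θ - Real.cos ψ| ≤ |θ - ψ| := Real.abs_cos_sub_cos_le θ ψ
    have hsin : |Real.sin θ - Real.sin ψ| ≤ |θ - ψ| := Real.abs_sin_sub_sin_le θ ψ
    have hd : ∀ a b : ℝ, |a - b| ≤ |θ - ψ| → |b| ≤ 1 →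
        |Y.1 * a - b| ≤ |Y.1 - 1| + 3 / 2 * |θ - ψ| := fun a b hab hb => by
      have : Y.1 * a - b = (Y.1 - 1) * b + Y.1 * (a - b) := by ring
      rw [this]
      refine (abs_add_le _ _).trans ?_
      rw [abs_mul, abs_mul]
      have e2 : |Y.1 - 1| * |b| ≤ |Y.1 - 1| * 1 := by gcongr
      have e3 : |Y.1| * |a - b| ≤ 3 / 2 * |θ - ψ| := by gcongr
      linarith
    have e2 := hd _ _ hcos (Real.abs_cos_le_one ψ)
    have e3 := hd _ _ hsin (Real.abs_sin_le_one ψ)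
    rw [abs_mul, abs_mul, abs_mul, abs_of_pos hε, abs_of_pos (pow_pos hε 2)]
    have e4 : ε ^ 2 * |(nf h).pz (pt ε θ Y)| ≤ ε ^ 2 * C := by gcongr
    have h2 := hle.2.2.2
    have n1 := abs_nonneg (Y.1 - 1)
    have n2 := abs_nonneg (θ - ψ)
    have e5 : ε * |px (pt ε θ Y) - Real.cos ψ| ≤ ε * (|Y.1 - 1| + 3 / 2 * |θ - ψ|) :=
      mul_le_mul_of_nonneg_left e2 hε.le
    have e6 : ε * |py (pt ε θ Y) - Real.sin ψ| ≤ ε * (|Y.1 - 1| + 3 / 2 * |θ - ψ|) :=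
      mul_le_mul_of_nonneg_left e3 hε.le
    have e7 : 2 * (|Y.1 - 1| + 3 / 2 * |θ - ψ|) + ε * C
        ≤ 3 * C * (|Y.1 - 1| + |θ - ψ| + ε) := by
      have m1 : 2 * |Y.1 - 1| ≤ C * |Y.1 - 1| := by gcongr
      have m2 : 2 * |θ - ψ| ≤ C * |θ - ψ| := by gcongr
      have m3 : 0 ≤ C * ε := by positivity
      have m4 : 0 ≤ C * |Y.1 - 1| := by positivity
      have m5 : 0 ≤ C * |θ - ψ| := by positivity
      nlinarith
    calc _ ≤ N * (ε * (2 * (|Y.1 - 1| + 3 / 2 * |θ - ψ|) + ε * C)) := by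
          gcongr
          nlinarith
      _ ≤ N * (ε * (3 * C * (|Y.1 - 1| + |θ - ψ| + ε))) := by gcongr
      _ = _ := by ring

/-- Points near a closed curve given in polar coordinates have polar coordinates near the curve. -/
theorem exists_polar_eq {ν₀ ε L : ℝ} (hε : 0 < ε) {Z : ℝ → St} (hZ : ∀ θ, Z θ ∈ box ν₀)
    (hL : ∀ θ θ', dist (Z θ) (Z θ') ≤ L * |θ - θ'|) {η : ℝ} (hη : 0 < η) :
    ∃ d > 0, ∀ v θ₁, ‖v - h.polar ε θ₁ (Z θ₁)‖ < d →
      ∃ θ Y, v = h.polar ε θ Y ∧ Y.2.2 = (Z θ₁).2.2 ∧ dist Y (Z θ) < η := by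
  obtain ⟨N, hN, hproj⟩ := p.exists_proj_le
  have hL0 : 0 ≤ L := by
    have := hL 1 0
    norm_num at this
    exact dist_nonneg.trans this
  set H := |(nf h).h₁| + |(nf h).h₂| + |(nf h).h₃| with hH
  have hH0 : 0 ≤ H := by positivity
  set B := 3 + 4 * H + 8 * L with hB
  have hB0 : 0 < B := by positivity
  set s := min (1 / 4) (η / (2 * B)) with hs
  have hs0 : 0 < s := by positivity
  have hs4 : s ≤ 1 / 4 := min_le_left _ _
  have hsη : B * s < η := by
    calc B * s ≤ B * (η / (2 * B)) := by gcongr; exact min_le_right _ _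
      _ = η / 2 := by field_simp
      _ < η := by linarith
  have hmin : 0 < min ε (ε ^ 2) := by positivity
  refine ⟨s * min ε (ε ^ 2) / (3 * N), by positivity, fun v θ₁ hv => ?_⟩
  obtain ⟨hX, hY, hW⟩ := hproj v (h.polar ε θ₁ (Z θ₁))
  have hbound : N * ‖v - h.polar ε θ₁ (Z θ₁)‖ ≤ s / 3 * min ε (ε ^ 2) := by
    calc N * ‖v - h.polar ε θ₁ (Z θ₁)‖ ≤ N * (s * min ε (ε ^ 2) / (3 * N)) := by gcongr
      _ = _ := by field_simp
  have hdiv : ∀ {c a b : ℝ}, 0 < c → min ε (ε ^ 2) ≤ c → |a - c * b| ≤ s / 3 * min ε (ε ^ 2) →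
      |a / c - b| ≤ s / 3 := fun {c a b} hc hle hab => by
    have : a / c - b = (a - c * b) / c := by field_simp
    rw [this, abs_div, abs_of_pos hc, div_le_iff₀ hc]
    exact hab.trans (by gcongr)
  simp only [polar, h.projX_comb, h.projY_comb, h.projZ_comb] at hX hY hW
  have hX := hdiv hε (min_le_left _ _) (hX.trans hbound)
  have hY := hdiv hε (min_le_left _ _) (hY.trans hbound)
  have hW := hdiv (pow_pos hε 2) (min_le_right _ _) (hW.trans hbound)
  have hbox := Hopf.mem_box.1 (hZ θ₁)
  set x := p.projX v / ε with hx
  set y := p.projY v / ε with hy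
  have hpx : px (pt ε θ₁ (Z θ₁)) = (Z θ₁).1 * Real.cos θ₁ := rfl
  have hpy : py (pt ε θ₁ (Z θ₁)) = (Z θ₁).1 * Real.sin θ₁ := rfl
  have hpz : (nf h).pz (pt ε θ₁ (Z θ₁))
      = (nf h).hq (px (pt ε θ₁ (Z θ₁))) (py (pt ε θ₁ (Z θ₁))) + (Z θ₁).2.1 := rfl
  have hpx2 : |px (pt ε θ₁ (Z θ₁))| ≤ 3 / 2 := by
    rw [hpx, abs_mul, abs_of_pos (by linarith [hbox.1.1])]
    have := Real.abs_cos_le_one θ₁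
    nlinarith [hbox.1.1, hbox.1.2, abs_nonneg (Real.cos θ₁)]
  have hpy2 : |py (pt ε θ₁ (Z θ₁))| ≤ 3 / 2 := by
    rw [hpy, abs_mul, abs_of_pos (by linarith [hbox.1.1])]
    have := Real.abs_sin_le_one θ₁
    nlinarith [hbox.1.1, hbox.1.2, abs_nonneg (Real.sin θ₁)]
  obtain ⟨θ, r, hxr, hyr, hr, hθ⟩ := exists_polar_near (x := x) (y := y) (θ₁ := θ₁) hbox.1.1 hs4
    (by rw [← hpx, ← hpy]; linarith)
  set w := p.projZ v / ε ^ 2 - (nf h).hq x y with hw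
  have hhq : |(nf h).hq x y - (nf h).hq (px (pt ε θ₁ (Z θ₁))) (py (pt ε θ₁ (Z θ₁)))|
      ≤ 4 * H * s := by
    exact (nf h).abs_hq_sub_le hpx2 hpy2 hs4 hX hY
  refine ⟨θ, (r, w, (Z θ₁).2.2), ?_, rfl, ?_⟩
  · have e1 : px (pt ε θ (r, w, (Z θ₁).2.2)) = x := hxr.symm
    have e2 : py (pt ε θ (r, w, (Z θ₁).2.2)) = y := hyr.symm
    have e3 : (nf h).pz (pt ε θ (r, w, (Z θ₁).2.2)) = p.projZ v / ε ^ 2 := by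
      have : (nf h).pz (pt ε θ (r, w, (Z θ₁).2.2)) = (nf h).hq (px (pt ε θ (r, w, (Z θ₁).2.2)))
        (py (pt ε θ (r, w, (Z θ₁).2.2))) + w := rfl
      rw [this, e1, e2, hw]
      ring
    rw [polar, e1, e2, e3, hx, hy, mul_div_cancel₀ _ hε.ne', mul_div_cancel₀ _ hε.ne',
      mul_div_cancel₀ _ (pow_pos hε 2).ne', h.comb_proj]
  · have e1 : dist ((r, w, (Z θ₁).2.2) : St) (Z θ₁) ≤ 2 * s + s + 4 * H * s := by
      rw [Prod.dist_eq, Prod.dist_eq, Real.dist_eq, Real.dist_eq, dist_self]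
      have e2 : |w - (Z θ₁).2.1| ≤ s / 3 + 4 * H * s := by
        have : w - (Z θ₁).2.1 = (p.projZ v / ε ^ 2 - (nf h).pz (pt ε θ₁ (Z θ₁)))
            - ((nf h).hq x y - (nf h).hq (px (pt ε θ₁ (Z θ₁))) (py (pt ε θ₁ (Z θ₁)))) := by
          rw [hw, hpz]; ring
        rw [this]
        exact (abs_sub _ _).trans (add_le_add hW hhq)
      have e3 : 0 ≤ 4 * H * s := by positivity
      refine max_le (by linarith) (max_le (by linarith) (by linarith))
    have e2 := hL θ₁ θ
    rw [abs_sub_comm] at e2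
    have e3 : L * |θ - θ₁| ≤ L * (8 * s) := by gcongr
    have e4 := dist_triangle ((r, w, (Z θ₁).2.2) : St) (Z θ₁) (Z θ)
    have e5 : B * s = 2 * s + s + 4 * H * s + L * (8 * s) := by rw [hB]; ring
    linarith

end Admissible

end Params

end Oregonator


/-! ### From polar coordinates back to the Oregonator -/

namespace Oregonator

open Flow3 Hopf Hopf.NormalForm Hopf.PolarSystem

namespace Params

variable {p : Params}

namespace Admissible

variable (h : p.Admissible)

/-- The polar system `S` is the Oregonator in scaled polar coordinates, with the angle as
independent variable. -/
structure IsPolarForm (C ν₀ ε : ℝ)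
    (S : PolarSystem C ((nf h).A / (nf h).ρ) ν₀ ε (nf h).m) : Prop where
  ε_pos : 0 < ε
  ε_le : ε ≤ 1
  C_pos : 0 < C
  f_eq : S.f = fun θ Y => (nf h).fq (pt ε θ Y)
  g_eq : S.g = fun θ Y => (nf h).gq (pt ε θ Y)
  le_Θ : ∀ θ, ∀ Y ∈ box ν₀, p.ρ / 2 ≤ (nf h).Θ (pt ε θ Y)
  abs_Θ_sub : ∀ θ, ∀ Y ∈ box ν₀, |(nf h).Θ (pt ε θ Y) - p.ρ| ≤ C * ε
  cont_Θ : ∀ Y : ℝ → St, Continuous Y → (∀ θ, Y θ ∈ box ν₀) →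
    Continuous fun θ => (nf h).Θ (pt ε θ (Y θ))

theorem exists_isPolarForm (ν₀ : ℝ) : ∃ C > 0, IsTameRate C ν₀ (nf h).m ∧
    ∀ᶠ ε in 𝓝[>] (0 : ℝ), ∃ S, h.IsPolarForm C ν₀ ε S := by
  obtain ⟨C, hC, ε₀, hε₀, hm, H⟩ := (nf h).exists_polarSystem ν₀
  refine ⟨C, hC, hm, ?_⟩
  filter_upwards [Ioo_mem_nhdsGT hε₀, Ioo_mem_nhdsGT (zero_lt_one (α := ℝ))] with ε hε hε1
  obtain ⟨h1, h2, S, h3, h4⟩ := H ε hε.1 hε.2.le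
  exact ⟨S, hε.1, hε1.2.le, hC, h3, h4, fun θ Y hY => (h1 θ Y hY).1, fun θ Y hY => (h1 θ Y hY).2,
    h2⟩

namespace IsPolarForm

variable {h} {C ν₀ ε : ℝ} {S : PolarSystem C ((nf h).A / (nf h).ρ) ν₀ ε (nf h).m}
  (hS : h.IsPolarForm C ν₀ ε S)
include hS

/-- The angle as a function of time. -/
theorem exists_angle {Y : ℝ → St} (hY : S.IsFlow Y) (θ₀ : ℝ) : ∃ φ : ℝ → ℝ, φ 0 = θ₀ ∧
    ∀ t, HasDerivAt φ ((nf h).Θ (pt ε (φ t) (clamp ν₀ (Y (φ t))))) t := by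
  have hYc : Continuous Y := continuous_iff_continuousAt.2 fun t => (hY t).continuousAt
  have hcl : Continuous (clamp ν₀) := (LipschitzWith.of_dist_le_mul (K := 1) fun Y Z => by
    rw [NNReal.coe_one, one_mul]; exact dist_clamp_le ν₀ Y Z).continuous
  refine exists_time_change (ω := fun θ => (nf h).Θ (pt ε θ (clamp ν₀ (Y θ))))
    (C := p.ρ + C * ε) (hS.cont_Θ _ (hcl.comp hYc) fun θ => clamp_mem _ _)
    (half_pos h.ρ_pos) (fun θ => hS.le_Θ _ _ (clamp_mem _ _)) (fun θ => ?_) θ₀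
  have := (abs_le.1 (hS.abs_Θ_sub θ _ (clamp_mem ν₀ (Y θ)))).2
  linarith

/-- A solution of the clamped polar system, as long as it is in the box, yields a solution of the
Oregonator. -/
theorem hasDerivAt_solution {Y : ℝ → St} (hY : S.IsFlow Y) {φ : ℝ → ℝ} {t : ℝ}
    (hφ : HasDerivAt φ ((nf h).Θ (pt ε (φ t) (clamp ν₀ (Y (φ t))))) t) (hbox : Y (φ t) ∈ box ν₀)
    {n : ℝ} (hn : (Y (φ t)).2.2 = n) :
    HasDerivAt (fun t => h.polar ε (φ t) (Y (φ t)))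
      (p.field (p.δ₀ + ε ^ 2 * n) (h.polar ε (φ t) (Y (φ t)))) t := by
  have hΘ := hS.le_Θ (φ t) _ hbox
  have hρ := h.ρ_pos
  have h1 := hY (φ t)
  rw [clamp_eq_self hbox] at hφ h1
  rw [← hn]
  exact h.hasDerivAt_polar hS.f_eq hS.g_eq
    (by have := (Hopf.mem_box.1 hbox).1.1; exact (by linarith : 0 < (Y (φ t)).1).ne')
    ((half_pos hρ).trans_le hΘ).ne' h1 hφ

/-- A periodic orbit of the polar system yields a periodic solution of the Oregonator. -/
theorem exists_periodicSolution {M n : ℝ} {Z : ℝ → St} (hZ : S.IsPeriodicOrbit M Z)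
    (hn : ∀ θ, (Z θ).2.2 = n) : ∃ (T : ℝ) (u : ℝ → E3) (φ : ℝ → ℝ),
      IsPeriodicSolution (p.field (p.δ₀ + ε ^ 2 * n)) T u ∧
      |T - 2 * Real.pi / p.ρ| ≤ 4 * Real.pi * C / p.ρ ^ 2 * ε ∧
      (∀ t, u t = h.polar ε (φ t) (Z (φ t))) ∧ (∀ t, |φ t - p.ρ * t| ≤ C * ε * |t|) ∧
      ∀ θ, h.polar ε θ (Z θ) ∈ range u := by
  have hρ := h.ρ_pos
  have hpi := Real.pi_pos
  have hflow := hZ.isFlow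
  obtain ⟨φ, hφ0, hφ⟩ := hS.exists_angle hflow 0
  have hZc : Continuous Z := continuous_iff_continuousAt.2 fun t => (hZ.deriv t).continuousAt
  set ω : ℝ → ℝ := fun θ => (nf h).Θ (pt ε θ (Z θ)) with hω
  have hφω : ∀ t, HasDerivAt φ (ω (φ t)) t := fun t => by
    have := hφ t
    rwa [clamp_eq_self (hZ.mem_box _)] at this
  have hωle : ∀ θ, p.ρ / 2 ≤ ω θ := fun θ => hS.le_Θ θ _ (hZ.mem_box θ)
  have hωpos : ∀ θ, 0 < ω θ := fun θ => (half_pos hρ).trans_le (hωle θ)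
  have hωper : ∀ θ, ω (θ - 2 * Real.pi) = ω θ := fun θ => by
    have h1 : ω (θ - 2 * Real.pi + 2 * Real.pi) = ω (θ - 2 * Real.pi) := by
      simp only [hω, pt_add_two_pi, hZ.periodic]
    rw [sub_add_cancel] at h1
    exact h1.symm
  have hmono := strictMono_time_change hωpos hφω
  obtain ⟨T, hT0, hT⟩ := exists_time (half_pos hρ) hωle hφω (θ := 2 * Real.pi)
    (by rw [hφ0]; positivity)
  have hTpos : 0 < T := by
    rcases hT0.lt_or_eq with h1 | h1
    · exact h1
    · rw [← h1, hφ0] at hT; linarith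
  have hφT : ∀ t, φ (t + T) = φ t + 2 * Real.pi := by
    have h1 : (fun t => φ (t + T) - 2 * Real.pi) = φ := by
      refine time_change_unique (hS.cont_Θ Z hZc hZ.mem_box) hωpos (fun t => ?_) hφω ?_
      · have h2 := ((hφω (t + T)).comp_add_const t T).sub_const (2 * Real.pi)
        rwa [← hωper] at h2
      · simp only [zero_add, hT, hφ0, sub_self]
    intro t
    have := congrFun h1 t
    linarith
  have hper : Function.Periodic (fun θ => h.polar ε θ (Z θ)) (2 * Real.pi) := fun θ => by
    simp only [hZ.periodic, polar_add_two_pi]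
  have hclose : ∀ t, |φ t - p.ρ * t| ≤ C * ε * |t| := fun t =>
    abs_time_change_sub_le (ω := ω) (fun θ => hS.abs_Θ_sub θ _ (hZ.mem_box θ)) hφω hφ0 t
  refine ⟨T, fun t => h.polar ε (φ t) (Z (φ t)), φ, ⟨fun t => ?_, hTpos, fun t => ?_, ?_⟩, ?_,
    fun _ => rfl, hclose, fun θ => ?_⟩
  · exact hS.hasDerivAt_solution hflow (hφ t) (hZ.mem_box _) (hn _)
  · change h.polar ε (φ (t + T)) (Z (φ (t + T))) = _
    rw [hφT]
    exact hper (φ t)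
  -- no smaller period: the angle increases from `0` to `2π` on `[0, T]`
  · intro t ht htT hpert
    have h1 := hpert 0
    simp only [zero_add] at h1
    have hr : ∀ θ, 0 < (Z θ).1 := fun θ => by
      have := (Hopf.mem_box.1 (hZ.mem_box θ)).1.1
      linarith
    obtain ⟨h2, -⟩ := h.polar_inj hS.ε_pos (hr _) (hr _) h1
    rw [hφ0, Real.cos_zero] at h2
    have h3 : 0 < φ t := by rw [← hφ0]; exact hmono ht
    have h4 : φ t < 2 * Real.pi := by rw [← hT]; exact hmono htT
    exact h3.ne' ((Real.cos_eq_one_iff_of_lt_of_lt (by linarith) h4).1 h2)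
  · have h1 := hclose T
    have h2 := le_time_change hωle hφω hT0
    rw [hT, hφ0, zero_add] at h2
    rw [hT, abs_of_pos hTpos] at h1
    have h3 : T ≤ 4 * Real.pi / p.ρ := by rw [le_div_iff₀ hρ]; linarith
    have h4 : T - 2 * Real.pi / p.ρ = -((2 * Real.pi - p.ρ * T) / p.ρ) := by field_simp; ring
    rw [h4, abs_neg, abs_div, abs_of_pos hρ, div_le_iff₀ hρ]
    have hCε : 0 ≤ C * ε := (mul_pos hS.C_pos hS.ε_pos).le
    calc |2 * Real.pi - p.ρ * T| ≤ C * ε * T := h1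
      _ ≤ C * ε * (4 * Real.pi / p.ρ) := by gcongr
      _ = _ := by field_simp
  · obtain ⟨θ', hθ', heq⟩ := hper.exists_mem_Ico₀ (by positivity) θ
    obtain ⟨t, -, ht⟩ := exists_time (half_pos hρ) hωle hφω (θ := θ') (by rw [hφ0]; exact hθ'.1)
    refine ⟨t, ?_⟩
    simp only [ht]
    exact heq.symm

omit hS in
theorem lipschitz_periodicOrbit {M : ℝ} {Z : ℝ → St} (hS : h.IsPolarForm C ν₀ ε S)
    (hZ : S.IsPeriodicOrbit M Z) (θ θ' : ℝ) :
    dist (Z θ) (Z θ') ≤ ((nf h).A / (nf h).ρ + C) * |θ - θ'| := by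
  have ha : 0 < (nf h).A / (nf h).ρ := div_pos (nf h).A_pos (nf h).ρ_pos
  have h1 := convex_univ.norm_image_sub_le_of_norm_hasDerivWithin_le
    (C := (nf h).A / (nf h).ρ + C) (fun t _ => (hZ.deriv t).hasDerivWithinAt)
    (fun t _ => S.norm_field_le ha hS.ε_pos hS.ε_le t (hZ.mem_box t)) (mem_univ θ') (mem_univ θ)
  rwa [dist_eq_norm]

end IsPolarForm

variable {h} {C ν₀ ε : ℝ} {S : PolarSystem C ((nf h).A / (nf h).ρ) ν₀ ε (nf h).m}

/-- An exponentially attracting periodic orbit of the polar system is an asymptotically stable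
orbit of the Oregonator. -/
theorem IsPolarForm.isAsymptoticallyStable (hS : h.IsPolarForm C ν₀ ε S) {M : ℝ} {Z : ℝ → St}
    (hZ : S.IsPeriodicOrbit M Z) (hn : ∀ θ, (Z θ).2.2 = ν₀)
    (hatt : ∃ η > 0, ∃ K > 0, ∃ l > 0, ∀ Y, S.IsFlow Y → (∀ θ, (Y θ).2.2 = ν₀) →
        ∀ θ₀, dist (Y θ₀) (Z θ₀) ≤ η → ∀ θ, θ₀ ≤ θ → Y θ ∈ box ν₀ ∧
          dist (Y θ) (Z θ) ≤ K * dist (Y θ₀) (Z θ₀) * Real.exp (-l * (θ - θ₀)))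
    {u : ℝ → E3} {φ : ℝ → ℝ} (hu : ∀ t, u t = h.polar ε (φ t) (Z (φ t)))
    (hrange : ∀ θ, h.polar ε θ (Z θ) ∈ range u) :
    IsAsymptoticallyStable (p.field (p.δ₀ + ε ^ 2 * ν₀)) (range u) := by
  obtain ⟨η, hη, K, hK, l, hl, hatt⟩ := hatt
  obtain ⟨Kp, hKp, hpol⟩ := h.exists_polar_bounds ν₀
  obtain ⟨-, hlip, -⟩ := hpol ε hS.ε_pos hS.ε_le
  have hε := hS.ε_pos
  have hρ := h.ρ_pos
  have ha : 0 < (nf h).A / (nf h).ρ := div_pos (nf h).A_pos (nf h).ρ_pos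
  have hne : (range u).Nonempty := range_nonempty u
  -- solutions that start near the orbit approach it exponentially, the angle being at least `ρ t / 2`
  have key : ∀ η' > 0, η' ≤ η → ∃ d > 0, ∀ v : E3, Metric.infDist v (range u) < d →
      ∃ w, IsForwardSolution (p.field (p.δ₀ + ε ^ 2 * ν₀)) w ∧ w 0 = v ∧ ∀ t, 0 ≤ t →
        Metric.infDist (w t) (range u) ≤ Kp * ε * (K * η') * Real.exp (-(l * (p.ρ / 2)) * t) := by
    intro η' hη' hη'η
    obtain ⟨d, hd, hnear⟩ := h.exists_polar_eq hε hZ.mem_box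
      (hS.lipschitz_periodicOrbit hZ) hη'
    refine ⟨d, hd, fun v hv => ?_⟩
    obtain ⟨_, ⟨t₁, rfl⟩, hv1⟩ := (Metric.infDist_lt_iff hne).1 hv
    rw [hu, dist_eq_norm] at hv1
    obtain ⟨θ₀, Y₀, hvY, hY₀ν, hY₀⟩ := hnear v _ hv1
    obtain ⟨Y, hY0, hY⟩ := S.exists_flow ha hS.C_pos hε hS.ε_le θ₀ Y₀
    have hYν : ∀ θ, (Y θ).2.2 = ν₀ := fun θ => by
      rw [IsFlow.snd_snd hY θ, ← IsFlow.snd_snd hY θ₀, hY0, hY₀ν, hn]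
    obtain ⟨ψ, hψ0, hψ⟩ := hS.exists_angle hY θ₀
    have hd0 : dist (Y θ₀) (Z θ₀) ≤ η' := by rw [hY0]; exact hY₀.le
    have hψle : ∀ t, 0 ≤ t → θ₀ + p.ρ / 2 * t ≤ ψ t := fun t ht => by
      rw [← hψ0]
      exact le_time_change (ω := fun θ => (nf h).Θ (pt ε θ (clamp ν₀ (Y θ))))
        (fun θ => hS.le_Θ θ _ (clamp_mem _ _)) hψ ht
    have hψge : ∀ t, 0 ≤ t → θ₀ ≤ ψ t := fun t ht => by
      have h1 := hψle t ht
      have h2 : 0 ≤ p.ρ / 2 * t := by positivity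
      linarith
    refine ⟨fun t => h.polar ε (ψ t) (Y (ψ t)), isForwardSolution_of_hasDerivAt fun t ht => ?_, ?_,
      fun t ht => ?_⟩
    · exact hS.hasDerivAt_solution hY (hψ t)
        (hatt Y hY hYν θ₀ (hd0.trans hη'η) _ (hψge t ht)).1 (hYν _)
    · change h.polar ε (ψ 0) (Y (ψ 0)) = v
      rw [hψ0, hY0, hvY]
    · obtain ⟨hbox, hdist⟩ := hatt Y hY hYν θ₀ (hd0.trans hη'η) _ (hψge t ht)
      refine (Metric.infDist_le_dist_of_mem (hrange (ψ t))).trans ?_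
      rw [dist_eq_norm]
      refine (hlip _ _ hbox _ (hZ.mem_box _)).trans ?_
      rw [mul_assoc (Kp * ε)]
      gcongr
      refine hdist.trans ?_
      have h1 := hψle t ht
      have h2 : l * (p.ρ / 2 * t) ≤ l * (ψ t - θ₀) :=
        mul_le_mul_of_nonneg_left (by linarith) hl.le
      have h3 : Real.exp (-l * (ψ t - θ₀)) ≤ Real.exp (-(l * (p.ρ / 2)) * t) :=
        Real.exp_le_exp.2 (by linarith)
      exact mul_le_mul (mul_le_mul_of_nonneg_left hd0 hK.le) h3 (Real.exp_pos _).le (by positivity)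
  refine ⟨fun e he => ?_, ?_⟩
  · set η' := min η (e / (2 * (Kp * ε * K))) with hη'
    have hη'0 : 0 < η' := by positivity
    obtain ⟨d, hd, hsol⟩ := key η' hη'0 (min_le_left _ _)
    refine ⟨d, hd, fun v hv => ?_⟩
    obtain ⟨w, hw, hw0, hwt⟩ := hsol v hv
    refine ⟨w, hw, hw0, fun t ht => (hwt t ht).trans_lt ?_⟩
    have h1 : Real.exp (-(l * (p.ρ / 2)) * t) ≤ 1 := Real.exp_le_one_iff.2 (by
      have : 0 ≤ l * (p.ρ / 2) * t := by positivity
      linarith)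
    calc Kp * ε * (K * η') * Real.exp (-(l * (p.ρ / 2)) * t)
        ≤ Kp * ε * (K * (e / (2 * (Kp * ε * K)))) * 1 := by
          gcongr
          exact min_le_right _ _
      _ = e / 2 := by field_simp
      _ < e := by linarith
  · obtain ⟨d, hd, hsol⟩ := key η hη le_rfl
    refine ⟨d, hd, fun v hv => ?_⟩
    obtain ⟨w, hw, hw0, hwt⟩ := hsol v hv
    refine ⟨w, hw, hw0, ?_⟩
    have h1 : Tendsto (fun t => Kp * ε * (K * η) * Real.exp (-(l * (p.ρ / 2)) * t)) atTop (𝓝 0) := by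
      have h2 : Tendsto (fun t : ℝ => -(l * (p.ρ / 2)) * t) atTop atBot :=
        tendsto_id.const_mul_atTop_of_neg (by have : 0 < l * (p.ρ / 2) := by positivity
                                              linarith)
      simpa using (Real.tendsto_exp_atBot.comp h2).const_mul (Kp * ε * (K * η))
    refine squeeze_zero' (Eventually.of_forall fun t => Metric.infDist_nonneg) ?_ h1
    filter_upwards [eventually_ge_atTop 0] with t ht using hwt t ht

/-- A repelling periodic orbit of the polar system is an unstable orbit of the Oregonator. -/
theorem IsPolarForm.not_isStable (hS : h.IsPolarForm C ν₀ ε S) {M : ℝ} {Z : ℝ → St}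
    (hZ : S.IsPeriodicOrbit M Z) (hn : ∀ θ, (Z θ).2.2 = ν₀)
    (hrep : (∀ Y θ, S.IsFlow Y → (Y θ).2.2 = ν₀ → dist (Y θ) (Z θ) ≤ 1 / 16 → Y θ ∈ box ν₀) ∧
      ∀ Y, S.IsFlow Y → (∀ θ, (Y θ).2.2 = ν₀) → (Y 0).2.1 = (Z 0).2.1 → (Y 0).1 ≠ (Z 0).1 →
        ∃ θ, 0 ≤ θ ∧ 1 / 16 < dist (Y θ) (Z θ))
    {u : ℝ → E3} {φ : ℝ → ℝ} (hu : ∀ t, u t = h.polar ε (φ t) (Z (φ t)))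
    (hrange : ∀ θ, h.polar ε θ (Z θ) ∈ range u) :
    ¬ IsStable (p.field (p.δ₀ + ε ^ 2 * ν₀)) (range u) := by
  intro hstab
  obtain ⟨hbox, hrep⟩ := hrep
  obtain ⟨Kp, hKp, hpol⟩ := h.exists_polar_bounds ν₀
  obtain ⟨-, hlip, -⟩ := hpol ε hS.ε_pos hS.ε_le
  have hε := hS.ε_pos
  have hρ := h.ρ_pos
  have ha : 0 < (nf h).A / (nf h).ρ := div_pos (nf h).A_pos (nf h).ρ_pos
  have hZc : Continuous Z := continuous_iff_continuousAt.2 fun t => (hZ.deriv t).continuousAt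
  obtain ⟨d, hd, hnear⟩ := h.exists_polar_eq hε hZ.mem_box
    (hS.lipschitz_periodicOrbit hZ) (by norm_num : (0 : ℝ) < 1 / 16)
  obtain ⟨r, hr, hst⟩ := hstab d hd
  set x := min (1 / 32) (r / (2 * (Kp * ε))) with hx
  have hx0 : 0 < x := by positivity
  obtain ⟨Y, hY0, hY⟩ := S.exists_flow ha hS.C_pos hε hS.ε_le 0 ((Z 0).1 + x, (Z 0).2)
  have hYν : ∀ θ, (Y θ).2.2 = ν₀ := fun θ => by
    rw [IsFlow.snd_snd hY θ, hY0]; exact hn 0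
  have hYc : Continuous Y := continuous_iff_continuousAt.2 fun t => (hY t).continuousAt
  have hd0 : dist (Y 0) (Z 0) = x := by
    rw [hY0, Prod.dist_eq, dist_self, Real.dist_eq, add_sub_cancel_left, abs_of_pos hx0,
      max_eq_left hx0.le]
  have hx32 : x ≤ 1 / 32 := min_le_left _ _
  obtain ⟨ψ, hψ0, hψ⟩ := hS.exists_angle hY 0
  have hψc : Continuous ψ := continuous_iff_continuousAt.2 fun t => (hψ t).continuousAt
  have hinit : Metric.infDist (h.polar ε 0 (Y 0)) (range u) < r := by
    refine (Metric.infDist_le_dist_of_mem (hrange 0)).trans_lt ?_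
    rw [dist_eq_norm]
    refine (hlip _ _ (hbox Y 0 hY (hYν 0) (by rw [hd0]; linarith)) _ (hZ.mem_box 0)).trans_lt ?_
    rw [hd0]
    calc Kp * ε * x ≤ Kp * ε * (r / (2 * (Kp * ε))) := by gcongr; exact min_le_right _ _
      _ = r / 2 := by field_simp
      _ < r := by linarith
  obtain ⟨w, hw, hw0, hwt⟩ := hst _ hinit
  -- by stability the polar solution can never leave the neighbourhood; the polar coordinates near the
  -- orbit that stability provides agree with those of the solution, up to a multiple of `2π` in `θ`
  have hclose : ∀ t, 0 ≤ t → dist (Y (ψ t)) (Z (ψ t)) < 1 / 16 := by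
    refine ODEAux.lt_of_forall_le_imp_lt (h := fun t => dist (Y (ψ t)) (Z (ψ t)))
      ((hYc.comp hψc).dist (hZc.comp hψc)).continuousOn fun T hT hlt => ?_
    have hle : ∀ t ∈ Icc 0 T, dist (Y (ψ t)) (Z (ψ t)) ≤ 1 / 16 := by
      intro t ht
      rcases ht.2.lt_or_eq with h1 | h1
      · exact (hlt t ⟨ht.1, h1⟩).le
      · subst h1
        rcases ht.1.lt_or_eq with h' | h'
        · exact dist_le_of_forall_lt (hYc.comp hψc) (hZc.comp hψc) h' hlt
        · subst h'; rw [hψ0, hd0]; linarith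
    have heq := eqOn_Icc_of_isSolution (contDiff_field _) (T := T)
      (u := fun t => h.polar ε (ψ t) (Y (ψ t))) (v := w)
      (fun t ht => (hS.hasDerivAt_solution hY (hψ t)
        (hbox Y _ hY (hYν _) (hle t ht)) (hYν _)).hasDerivWithinAt)
      (fun t ht => hw t ht.1) (by simp only [hψ0, hw0])
    have hTe := heq ⟨hT, le_rfl⟩
    have h1 := hwt T hT
    rw [← hTe] at h1
    obtain ⟨_, ⟨t₁, rfl⟩, hv1⟩ := (Metric.infDist_lt_iff (range_nonempty u)).1 h1
    rw [hu, dist_eq_norm] at hv1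
    obtain ⟨θ', Y', heq', hY'ν, hY'⟩ := hnear _ _ hv1
    have hYb := hbox Y _ hY (hYν _) (hle T ⟨hT, le_rfl⟩)
    have hr1 : 0 < (Y (ψ T)).1 := by have := (Hopf.mem_box.1 hYb).1.1; linarith
    have hr2 : 0 < Y'.1 := by
      have e1 : |Y'.1 - (Z θ').1| ≤ dist Y' (Z θ') := le_max_left (dist Y'.1 (Z θ').1) _
      have e2 := (abs_le.1 e1).1
      have e3 := (Hopf.mem_box.1 (hZ.mem_box θ')).1.1
      linarith
    obtain ⟨hc, hs, e1, e2⟩ := h.polar_inj hε hr1 hr2 heq'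
    have hYY : Y (ψ T) = Y' :=
      Prod.ext e1 (Prod.ext e2 (by rw [hYν, hY'ν, hn]))
    have hZZ : Z (ψ T) = Z θ' := by
      obtain ⟨k, hk⟩ := Real.Angle.angle_eq_iff_two_pi_dvd_sub.1 (Real.Angle.cos_sin_inj hc hs)
      have hper : Function.Periodic Z (2 * Real.pi) := hZ.periodic
      have h2 : ψ T = θ' + k * (2 * Real.pi) := by linarith
      rw [h2]
      exact hper.int_mul k θ'
    change dist (Y (ψ T)) (Z (ψ T)) < 1 / 16
    rw [hYY, hZZ]
    exact hY'
  obtain ⟨θ, hθ, hlt⟩ := hrep Y hY hYν (by rw [hY0]) (by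
    rw [hY0]; simp only [ne_eq, add_eq_left]; exact hx0.ne')
  obtain ⟨t, ht, rfl⟩ := exists_time (ω := fun θ => (nf h).Θ (pt ε θ (clamp ν₀ (Y θ))))
    (half_pos hρ) (fun θ => hS.le_Θ θ _ (clamp_mem _ _)) hψ (θ := θ) (by rw [hψ0]; exact hθ)
  exact absurd (hclose t ht) (not_lt.2 hlt.le)

end Admissible

end Params

end Oregonator


/-! ### Hopf bifurcation in the Oregonator -/

namespace Oregonator

open Flow3 Hopf Hopf.NormalForm Hopf.PolarSystem

namespace Params

variable {p : Params}

namespace Admissible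

variable (h : p.Admissible)

theorem nf_m_eq (Y : St) :
    (nf h).m Y = 2 / p.ρ * (p.b * Y.1 ^ 4 + p.k * Y.2.2 * Y.1 ^ 2) := by
  rw [m, nf_b, nf_κ]; rfl

/-- The scaled control parameter at which the averaged rate vanishes for `r = 1`. -/
abbrev _root_.Oregonator.Params.ν₀ (p : Params) : ℝ := -p.b / p.k

include h in
theorem k_mul_ν₀ : p.k * p.ν₀ = -p.b := mul_div_cancel₀ _ h.k_neg.ne

/-- For fixed `r = 1`, the averaged rate changes sign as `ν` passes `ν₀`. -/
theorem isTransversePath_parameter :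
    IsTransversePath p.ν₀ (-(2 * p.k) / p.ρ) (nf h).m (fun _ => 1) (fun l => p.ν₀ + l) (-1) where
  R_zero := rfl
  n_zero := add_zero _
  R_lip x y := by simp
  n_lip x y := by simp
  abs_s := by simp
  pos l _ _ w := by
    have h1 := h.k_mul_ν₀
    rw [nf_m_eq]
    refine le_of_eq ?_
    linear_combination (2 / p.ρ) * h1
  neg l _ _ w := by
    have h1 := h.k_mul_ν₀
    rw [nf_m_eq]
    refine le_of_eq ?_
    linear_combination (-(2 / p.ρ)) * h1

theorem nf_m_ν₀ {Y : St} (hY : Y.2.2 = p.ν₀) :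
    (nf h).m Y = 2 * p.b / p.ρ * (Y.1 ^ 2 * (Y.1 ^ 2 - 1)) := by
  rw [nf_m_eq, hY, h.k_mul_ν₀]; ring

/-- For fixed `ν = ν₀`, the averaged rate changes sign as `r` passes `1`. -/
theorem isTransversePath_radius {s : ℝ} (hs : |s| = 1) (hsb : s * p.b = |p.b|) :
    IsTransversePath p.ν₀ (|p.b| / p.ρ) (nf h).m (fun l => 1 + l) (fun _ => p.ν₀) s where
  R_zero := add_zero _
  n_zero := rfl
  R_lip x y := by simp
  n_lip x y := by simp
  abs_s := hs
  pos l hl hl4 w := by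
    have hρ := h.ρ_pos
    rw [h.nf_m_ν₀ rfl]
    have e1 : s * (2 * p.b / p.ρ * ((1 + l) ^ 2 * ((1 + l) ^ 2 - 1)))
        = |p.b| / p.ρ * (2 * ((1 + l) ^ 2 * ((1 + l) ^ 2 - 1))) := by rw [← hsb]; ring
    rw [e1]
    have h0 : 0 ≤ |p.b| / p.ρ := by positivity
    refine mul_le_mul_of_nonneg_left ?_ h0
    have e2 : 2 * ((1 + l) ^ 2 * ((1 + l) ^ 2 - 1)) - l
        = 3 * l + 10 * l ^ 2 + 8 * l ^ 3 + 2 * l ^ 4 := by ring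
    have : 0 ≤ 3 * l + 10 * l ^ 2 + 8 * l ^ 3 + 2 * l ^ 4 := by positivity
    linarith
  neg l hl hl4 w := by
    have hρ := h.ρ_pos
    rw [h.nf_m_ν₀ rfl]
    have e1 : s * (2 * p.b / p.ρ * ((1 + -l) ^ 2 * ((1 + -l) ^ 2 - 1)))
        = -(|p.b| / p.ρ * (2 * ((1 - l) ^ 2 * (l * (2 - l))))) := by rw [← hsb]; ring
    rw [e1, neg_le_neg_iff]
    have h0 : 0 ≤ |p.b| / p.ρ := by positivity
    refine mul_le_mul_of_nonneg_left ?_ h0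
    have e2 : 1 / 2 ≤ (1 - l) ^ 2 := by nlinarith
    have e3 : l * (7 / 4) ≤ l * (2 - l) := mul_le_mul_of_nonneg_left (by linarith) hl
    have e4 : 1 / 2 * (l * (7 / 4)) ≤ (1 - l) ^ 2 * (l * (2 - l)) := by gcongr
    linarith

theorem isMonotoneRate {s : ℝ} (hsb : s * p.b = |p.b|) :
    IsMonotoneRate p.ν₀ (|p.b| / p.ρ) s (nf h).m := by
  intro Y Z hY hZ hYν hZν
  have hρ := h.ρ_pos
  rw [h.nf_m_ν₀ hYν, h.nf_m_ν₀ hZν]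
  have e1 : s * ((2 * p.b / p.ρ * (Y.1 ^ 2 * (Y.1 ^ 2 - 1))
      - 2 * p.b / p.ρ * (Z.1 ^ 2 * (Z.1 ^ 2 - 1))) * (Y.1 ^ 2 - Z.1 ^ 2))
      = |p.b| / p.ρ * (2 * (Y.1 ^ 2 + Z.1 ^ 2 - 1) * (Y.1 ^ 2 - Z.1 ^ 2) ^ 2) := by
    rw [← hsb]; ring
  rw [e1]
  have h0 : 0 ≤ |p.b| / p.ρ := by positivity
  refine mul_le_mul_of_nonneg_left ?_ h0
  have h1 : 3 / 4 ≤ Y.1 ^ 2 := by nlinarith [(abs_le.1 hY).1]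
  have h2 : 3 / 4 ≤ Z.1 ^ 2 := by nlinarith [(abs_le.1 hZ).1]
  exact le_mul_of_one_le_left (sq_nonneg _) (by linarith)

theorem nf_rate_pos : 0 < (nf h).A / (nf h).ρ := div_pos (nf h).A_pos (nf h).ρ_pos

include h in
/-- Periodic solutions exist near `δ₀` whatever the sign of `b`, also for `b = 0`: the initial radius
is fixed, and the control parameter is adjusted. -/
theorem hasPeriodicBifurcation : HasPeriodicBifurcation p.field p.δ₀ p.ρ := by
  intro e he
  have hρ := h.ρ_pos
  have hk := h.k_neg
  obtain ⟨C, hC, hm, hev⟩ := h.exists_isPolarForm p.ν₀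
  have hc : 0 < -(2 * p.k) / p.ρ := div_pos (by linarith) hρ
  obtain ⟨M, hM, horb⟩ := exists_isPeriodicOrbit h.nf_rate_pos hC hc hm
    h.isTransversePath_parameter
  obtain ⟨Kp, hKp, hpol⟩ := h.exists_polar_bounds p.ν₀
  have he2 : 0 < e / 2 := half_pos he
  obtain ⟨ε, ⟨S, hS⟩, horb, h1, h2, h3, h4⟩ := (hev.and (horb.and
    ((eventually_mul_le (|p.ν₀| + 1) he2).and ((eventually_mul_le (4 * Real.pi * C / p.ρ ^ 2)
      he2).and ((eventually_mul_le Kp he2).and (eventually_mul_le M one_pos)))))).exists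
  have hε := hS.ε_pos
  obtain ⟨l, Z, hl, hZ, -, hZn⟩ := horb S
  obtain ⟨T, u, φ, hu, hT, hueq, -, -⟩ := hS.exists_periodicSolution hZ hZn
  refine ⟨p.δ₀ + ε ^ 2 * (p.ν₀ + l), ?_, T, u, hu, by linarith, fun t => ?_⟩
  · rw [add_sub_cancel_left, abs_mul, abs_of_pos (pow_pos hε 2)]
    have e1 : |p.ν₀ + l| ≤ |p.ν₀| + 1 := (abs_add_le _ _).trans (by linarith)
    have e2 : ε ^ 2 ≤ ε := by nlinarith [hS.ε_le]
    calc ε ^ 2 * |p.ν₀ + l| ≤ ε * (|p.ν₀| + 1) := by gcongr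
      _ < e := by linarith
  · rw [hueq]
    have := (hpol ε hε hS.ε_le).1 (φ t) _ (hZ.mem_box (φ t))
    linarith

variable (p) in
/-- A periodic solution at the control parameter `δ` that equals `ε (ξ cos ρt + η sin ρt)` to leading
order, with error bounds given by the constant `K`, and whose orbit has the stability that the sign of
`b` predicts. -/
structure _root_.Oregonator.Params.IsOrbitOfSize (K ε δ T : ℝ) (u : ℝ → E3) : Prop where
  periodic : IsPeriodicSolution (p.field δ) T u
  abs_period_sub_le : |T - 2 * Real.pi / p.ρ| ≤ K * ε
  norm_le : ∀ t, ‖u t‖ ≤ K * ε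
  norm_sub_le : ∀ t, ‖u t - ε • (Real.cos (p.ρ * t) • p.ξ + Real.sin (p.ρ * t) • p.η)‖
    ≤ K * ε ^ 2 * (1 + |t|)
  unstable : 0 < p.b → ¬ IsStable (p.field δ) (range u)
  stable : p.b < 0 → IsAsymptoticallyStable (p.field δ) (range u)

include h in
/-- The periodic solutions at the parameter values `δ₀ + ε² ν₀`: the control parameter is fixed, and
the initial radius is adjusted. -/
theorem eventually_exists_solution (hb : p.b ≠ 0) : ∃ K > 0, ∀ᶠ ε in 𝓝[>] (0 : ℝ),
    ∃ (T : ℝ) (u : ℝ → E3), p.IsOrbitOfSize K ε (p.δ₀ + ε ^ 2 * p.ν₀) T u := by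
  have hρ := h.ρ_pos
  obtain ⟨s, hs, hsb, hs1, hs2⟩ : ∃ s : ℝ, |s| = 1 ∧ s * p.b = |p.b| ∧ (0 < p.b → s = 1) ∧
      (p.b < 0 → s = -1) := by
    rcases hb.lt_or_gt with hlt | hlt
    · exact ⟨-1, by simp, by rw [abs_of_neg hlt]; ring, fun h0 => absurd h0 (not_lt.2 hlt.le),
        fun _ => rfl⟩
    · exact ⟨1, by simp, by rw [abs_of_pos hlt]; ring, fun _ => rfl,
        fun h0 => absurd h0 (not_lt.2 hlt.le)⟩
  obtain ⟨C, hC, hm, hev⟩ := h.exists_isPolarForm p.ν₀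
  have hc : 0 < |p.b| / p.ρ := div_pos (abs_pos.2 hb) hρ
  obtain ⟨M, hM, horb⟩ := exists_isPeriodicOrbit h.nf_rate_pos hC hc hm
    (h.isTransversePath_radius hs hsb)
  obtain ⟨Kp, hKp, hpol⟩ := h.exists_polar_bounds p.ν₀
  have hmono := h.isMonotoneRate hsb
  have hrep : ∀ᶠ ε in 𝓝[>] (0 : ℝ), 0 < p.b → ∀ (S : PolarSystem C ((nf h).A / (nf h).ρ) p.ν₀ ε
      (nf h).m) (Z : ℝ → St), S.IsPeriodicOrbit M Z → (∀ θ, (Z θ).2.2 = p.ν₀) →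
      (∀ Y θ, S.IsFlow Y → (Y θ).2.2 = p.ν₀ → dist (Y θ) (Z θ) ≤ 1 / 16 → Y θ ∈ box p.ν₀) ∧
      ∀ Y, S.IsFlow Y → (∀ θ, (Y θ).2.2 = p.ν₀) → (Y 0).2.1 = (Z 0).2.1 → (Y 0).1 ≠ (Z 0).1 →
        ∃ θ, 0 ≤ θ ∧ 1 / 16 < dist (Y θ) (Z θ) := by
    by_cases hb0 : 0 < p.b
    · rw [hs1 hb0] at hmono
      filter_upwards [eventually_repelling h.nf_rate_pos hC hc hM hm hmono] with ε hε _ using hε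
    · exact Eventually.of_forall fun ε h0 => absurd h0 hb0
  have hatt : ∀ᶠ ε in 𝓝[>] (0 : ℝ), p.b < 0 → ∀ (S : PolarSystem C ((nf h).A / (nf h).ρ) p.ν₀ ε
      (nf h).m) (Z : ℝ → St), S.IsPeriodicOrbit M Z → (∀ θ, (Z θ).2.2 = p.ν₀) →
      ∃ η > 0, ∃ K > 0, ∃ l > 0, ∀ Y, S.IsFlow Y → (∀ θ, (Y θ).2.2 = p.ν₀) →
        ∀ θ₀, dist (Y θ₀) (Z θ₀) ≤ η → ∀ θ, θ₀ ≤ θ → Y θ ∈ box p.ν₀ ∧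
          dist (Y θ) (Z θ) ≤ K * dist (Y θ₀) (Z θ₀) * Real.exp (-l * (θ - θ₀)) := by
    by_cases hb0 : p.b < 0
    · rw [hs2 hb0] at hmono
      filter_upwards [eventually_attracting h.nf_rate_pos hC hc hM hm hmono] with ε hε _ using hε
    · exact Eventually.of_forall fun ε h0 => absurd h0 hb0
  set K := 4 * Real.pi * C / p.ρ ^ 2 + Kp * (M + C + 1) with hK
  have hpi := Real.pi_pos
  have hK1 : 0 < 4 * Real.pi * C / p.ρ ^ 2 := by positivity
  have hK2 : Kp ≤ Kp * (M + C + 1) := le_mul_of_one_le_right hKp.le (by linarith)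
  refine ⟨K, by linarith, ?_⟩
  filter_upwards [hev, horb, hrep, hatt] with ε ⟨S, hS⟩ horb hrep hatt
  have hε := hS.ε_pos
  obtain ⟨l, Z, hl, hZ, -, hZn⟩ := horb S
  obtain ⟨T, u, φ, hu, hT, hueq, hφ, hrange⟩ := hS.exists_periodicSolution hZ hZn
  obtain ⟨hp1, -, hp3⟩ := hpol ε hε hS.ε_le
  refine ⟨T, u, hu, hT.trans ?_, fun t => ?_, fun t => ?_, fun h0 => ?_, fun h0 => ?_⟩
  · gcongr; linarith
  · rw [hueq]
    refine (hp1 (φ t) _ (hZ.mem_box (φ t))).trans ?_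
    gcongr
    linarith
  · rw [hueq]
    refine (hp3 (φ t) (p.ρ * t) _ (hZ.mem_box (φ t))).trans ?_
    have e1 := hZ.abs_fst (φ t)
    have e2 := hφ t
    have ht := abs_nonneg t
    calc Kp * ε * (|(Z (φ t)).1 - 1| + |φ t - p.ρ * t| + ε)
        ≤ Kp * ε * (M * ε + C * ε * |t| + ε) := by gcongr
      _ = Kp * (M + 1 + C * |t|) * ε ^ 2 := by ring
      _ ≤ Kp * ((M + C + 1) * (1 + |t|)) * ε ^ 2 := by
          gcongr
          nlinarith [mul_nonneg hM.le ht]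
      _ = Kp * (M + C + 1) * (ε ^ 2 * (1 + |t|)) := by ring
      _ ≤ K * (ε ^ 2 * (1 + |t|)) := by gcongr; linarith
      _ = _ := by ring
  · exact hS.not_isStable hZ hZn (hrep h0 S Z hZ hZn) hueq hrange
  · exact hS.isAsymptoticallyStable hZ hZn (hatt h0 S Z hZ hZn) hueq hrange

include h in
/-- For `δ = δ₀ + ε² ν₀` close to `δ₀`, the amplitude `√(-b⁻¹ Re β₁₁(δ))` is `ε + o(ε)`, because
`Re β₁₁` has the derivative `k = -b / ν₀` at `δ₀`. -/
theorem eventually_amplitude (hb : p.b ≠ 0) {e : ℝ} (he : 0 < e) : ∀ᶠ δ in 𝓝 p.δ₀,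
    ∀ ε : ℝ, 0 < ε → p.δ₀ + ε ^ 2 * p.ν₀ = δ →
      |√(-(p.b)⁻¹ * (p.β₁₁ δ).re) - ε| ≤ e * ε ∧ √|p.b| / 2 * ε ≤ √|(p.β₁₁ δ).re| := by
  obtain ⟨h0, -, hder, -⟩ := h.crossing
  have hk := h.k_neg
  have hb' : 0 < |p.b| := abs_pos.2 hb
  have hk' : 0 < |p.k| := abs_pos.2 hk.ne
  have he' : 0 < min (3 / 4) e := by positivity
  have hre : (p.β₁₁ p.δ₀).re = 0 := by rw [h0]; simp
  have hlit := (hasDerivAt_iff_isLittleO.1 hder).def (mul_pos he' hk')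
  filter_upwards [hlit] with δ hδ ε hε hεδ
  have hμ : δ - p.δ₀ = ε ^ 2 * p.ν₀ := by rw [← hεδ]; ring
  have hkμ : (δ - p.δ₀) * p.k = -(p.b * ε ^ 2) := by
    rw [hμ]
    linear_combination ε ^ 2 * h.k_mul_ν₀
  have hν : |p.ν₀| * |p.k| = |p.b| := by
    rw [← abs_mul, mul_comm, h.k_mul_ν₀, abs_neg]
  rw [hre, sub_zero, smul_eq_mul, hkμ, hμ, Real.norm_eq_abs, Real.norm_eq_abs, abs_mul (ε ^ 2),
    abs_of_pos (pow_pos hε 2)] at hδ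
  have hδ : |(p.β₁₁ δ).re + p.b * ε ^ 2| ≤ min (3 / 4) e * |p.b| * ε ^ 2 := by
    rw [sub_neg_eq_add] at hδ
    refine hδ.trans_eq ?_
    rw [← hν]; ring
  generalize (p.β₁₁ δ).re = β at *
  constructor
  · have h1 : |-(p.b)⁻¹ * β - ε ^ 2| ≤ e * ε ^ 2 := by
      have e1 : -(p.b)⁻¹ * β - ε ^ 2 = -((β + p.b * ε ^ 2) / p.b) := by field_simp; ring
      rw [e1, abs_neg, abs_div, div_le_iff₀ hb']
      refine hδ.trans ?_
      have : min (3 / 4) e ≤ e := min_le_right _ _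
      calc min (3 / 4) e * |p.b| * ε ^ 2 ≤ e * |p.b| * ε ^ 2 := by gcongr
        _ = _ := by ring
    generalize -(p.b)⁻¹ * β = a at *
    refine le_of_mul_le_mul_right ?_ hε
    have h2 : |√a - ε| * ε ≤ |a - ε ^ 2| := by
      rcases le_total 0 a with ha | ha
      · have e1 : a - ε ^ 2 = (√a - ε) * (√a + ε) := by
          have := Real.sq_sqrt ha
          linear_combination -this
        have e2 := Real.sqrt_nonneg a
        rw [e1, abs_mul, abs_of_nonneg (by linarith : 0 ≤ √a + ε)]
        gcongr
        linarith
      · rw [Real.sqrt_eq_zero_of_nonpos ha, zero_sub, abs_neg, abs_of_pos hε,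
          abs_of_nonpos (by nlinarith)]
        nlinarith
    refine h2.trans (h1.trans_eq (by ring))
  · have h1 : |p.b| / 4 * ε ^ 2 ≤ |β| := by
      have e1 : |p.b * ε ^ 2| - |β| ≤ |β + p.b * ε ^ 2| := by
        have := abs_sub_abs_le_abs_sub (p.b * ε ^ 2) (-β)
        rwa [abs_neg, sub_neg_eq_add, add_comm _ β] at this
      rw [abs_mul, abs_of_pos (pow_pos hε 2)] at e1
      have e2 : min (3 / 4) e * |p.b| * ε ^ 2 ≤ 3 / 4 * |p.b| * ε ^ 2 := by
        gcongr; exact min_le_left _ _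
      linarith
    refine Real.le_sqrt_of_sq_le ?_
    rw [mul_pow, div_pow, Real.sq_sqrt hb'.le]
    linarith

include h in
/-- The bifurcating family of periodic solutions, on the side of `δ₀` on which
`-k (δ - δ₀) / b > 0`. -/
theorem exists_bifurcatingFamily (hb : p.b ≠ 0) {l : Filter ℝ} (hl : l ≤ 𝓝 p.δ₀)
    (hside : ∀ᶠ δ in l, 0 < (δ - p.δ₀) / p.ν₀) :
    ∃ (T : ℝ → ℝ) (u : ℝ → ℝ → E3), p.IsBifurcatingFamily l T u ∧
      ∀ᶠ δ in l, (0 < p.b → ¬ IsStable (p.field δ) (range (u δ))) ∧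
        (p.b < 0 → IsAsymptoticallyStable (p.field δ) (range (u δ))) := by
  have hν : p.ν₀ ≠ 0 := div_ne_zero (neg_ne_zero.2 hb) h.k_neg.ne
  have hb' : 0 < √|p.b| := Real.sqrt_pos.2 (abs_pos.2 hb)
  obtain ⟨K, hK, hev⟩ := h.eventually_exists_solution hb
  have hex : ∀ ε : ℝ, ∃ (T : ℝ) (u : ℝ → E3),
      (∃ (T : ℝ) (u : ℝ → E3), p.IsOrbitOfSize K ε (p.δ₀ + ε ^ 2 * p.ν₀) T u) →
      p.IsOrbitOfSize K ε (p.δ₀ + ε ^ 2 * p.ν₀) T u := by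
    intro ε
    by_cases hε : ∃ (T : ℝ) (u : ℝ → E3), p.IsOrbitOfSize K ε (p.δ₀ + ε ^ 2 * p.ν₀) T u
    · obtain ⟨T, u, H⟩ := hε
      exact ⟨T, u, fun _ => H⟩
    · exact ⟨0, fun _ => 0, fun H => absurd H hε⟩
  choose T u hTu using hex
  replace hev := hev.mono fun ε hε => hTu ε hε
  clear hTu
  set E : ℝ → ℝ := fun δ => √((δ - p.δ₀) / p.ν₀) with hE
  have hE0 : ∀ᶠ δ in l, 0 < E δ := hside.mono fun δ hδ => Real.sqrt_pos.2 hδ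
  have hEeq : ∀ᶠ δ in l, p.δ₀ + E δ ^ 2 * p.ν₀ = δ := hside.mono fun δ hδ => by
    simp only [hE]
    rw [Real.sq_sqrt hδ.le, div_mul_cancel₀ _ hν]
    ring
  have hE0' : Tendsto E l (𝓝 0) := by
    have h1 : ContinuousAt E p.δ₀ := by
      simp only [hE]; fun_prop
    have h2 : E p.δ₀ = 0 := by simp [hE]
    have h3 : Tendsto E (𝓝 p.δ₀) (𝓝 (E p.δ₀)) := h1
    rw [h2] at h3
    exact h3.mono_left hl
  have hEt : Tendsto E l (𝓝[>] 0) := tendsto_nhdsWithin_iff.2 ⟨hE0', hE0⟩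
  have hevl := hEt.eventually hev
  have hKE : Tendsto (fun δ => K * E δ) l (𝓝 0) := by simpa using hE0'.const_mul K
  refine ⟨fun δ => T (E δ), fun δ => u (E δ), ⟨?_, ?_, ?_, ?_⟩, ?_⟩
  · filter_upwards [hevl, hEeq] with δ hδ heq
    rw [heq] at hδ
    exact hδ.periodic
  · intro e he
    filter_upwards [hevl, hKE.eventually (gt_mem_nhds he)] with δ hδ hlt t
    exact (hδ.norm_le t).trans_lt hlt
  · refine tendsto_iff_dist_tendsto_zero.2 (squeeze_zero' (Eventually.of_forall fun _ =>
      dist_nonneg) ?_ hKE)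
    filter_upwards [hevl] with δ hδ
    exact hδ.abs_period_sub_le
  · intro R hR e he
    set N := ‖p.ξ‖ + ‖p.η‖ + 1 with hN
    have hN0 : 0 < N := by positivity
    have he1 : 0 < e * √|p.b| / (4 * N) := by positivity
    have hK2 : Tendsto (fun δ => K * (1 + R) * E δ) l (𝓝 0) := by
      simpa using hE0'.const_mul (K * (1 + R))
    filter_upwards [hevl, hE0, hEeq, hl (h.eventually_amplitude hb he1),
      hK2.eventually (gt_mem_nhds (by positivity : 0 < e * √|p.b| / 4))]
      with δ hδ hE0 heq hamp hlt t ht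
    obtain ⟨ha1, ha2⟩ := hamp (E δ) hE0 heq
    have h1 := hδ.norm_sub_le t
    set W := Real.cos (p.ρ * t) • p.ξ + Real.sin (p.ρ * t) • p.η with hW
    have hWN : ‖W‖ ≤ N := by
      refine (norm_add_le _ _).trans ?_
      rw [norm_smul, norm_smul, Real.norm_eq_abs, Real.norm_eq_abs]
      have e1 : |Real.cos (p.ρ * t)| * ‖p.ξ‖ ≤ 1 * ‖p.ξ‖ := by
        gcongr; exact Real.abs_cos_le_one _
      have e2 : |Real.sin (p.ρ * t)| * ‖p.η‖ ≤ 1 * ‖p.η‖ := by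
        gcongr; exact Real.abs_sin_le_one _
      linarith
    set a := √(-(p.b)⁻¹ * (p.β₁₁ δ).re) with ha
    have h2 : u (E δ) t - a • W = (u (E δ) t - E δ • W) - (a - E δ) • W := by
      rw [sub_smul]; abel
    rw [h2]
    refine (norm_sub_le _ _).trans ?_
    rw [norm_smul, Real.norm_eq_abs]
    have h3 : K * E δ ^ 2 * (1 + |t|) ≤ e * √|p.b| / 4 * E δ := by
      calc K * E δ ^ 2 * (1 + |t|) ≤ K * E δ ^ 2 * (1 + R) := by gcongr
        _ = K * (1 + R) * E δ * E δ := by ring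
        _ ≤ e * √|p.b| / 4 * E δ := by gcongr
    have h4 : |a - E δ| * ‖W‖ ≤ e * √|p.b| / 4 * E δ := by
      calc |a - E δ| * ‖W‖ ≤ e * √|p.b| / (4 * N) * E δ * N := by gcongr
        _ = _ := by field_simp
    have h5 : e * (√|p.b| / 2 * E δ) ≤ e * √|(p.β₁₁ δ).re| := by gcongr
    linarith
  · filter_upwards [hevl, hEeq] with δ hδ heq
    rw [heq] at hδ
    exact ⟨hδ.unstable, hδ.stable⟩

end Admissible

end Params

end Oregonator

end

theorem theorem3p5 (p : Oregonator.Params) (hα : 0 < p.α) (hβ : 0 < p.β) (hγ : 0 < p.γ)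
    (hδ₀ : 0 < p.δ₀) :
    -- a pair of complex eigenvalues crosses the imaginary axis at `δ₀`
    (0 < p.ρ ∧ p.β₁₁ p.δ₀ = p.ρ * Complex.I ∧ ContinuousAt p.β₁₁ p.δ₀ ∧
      ∀ᶠ δ in 𝓝 p.δ₀, p.IsEigenvalue δ (p.β₁₁ δ) ∧ 0 < (p.β₁₁ δ).im ∧
        (p.δ₀ < δ → (p.β₁₁ δ).re < 0) ∧ (δ < p.δ₀ → 0 < (p.β₁₁ δ).re)) ∧
    -- dynamic transition to periodic solutions at `δ₀`
    Flow3.HasDynamicTransition p.field p.δ₀ ∧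
    Flow3.HasPeriodicBifurcation p.field p.δ₀ p.ρ ∧
    -- `b > 0`: an unstable periodic orbit bifurcates on `δ > δ₀`
    (0 < p.b → ∃ (T : ℝ → ℝ) (u : ℝ → ℝ → Flow3.E3),
      p.IsBifurcatingFamily (𝓝[>] p.δ₀) T u ∧
      ∀ᶠ δ in 𝓝[>] p.δ₀, ¬ Flow3.IsStable (p.field δ) (range (u δ))) ∧
    -- `b < 0`: a stable periodic orbit bifurcates on `δ < δ₀`
    (p.b < 0 → ∃ (T : ℝ → ℝ) (u : ℝ → ℝ → Flow3.E3),
      p.IsBifurcatingFamily (𝓝[<] p.δ₀) T u ∧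
      ∀ᶠ δ in 𝓝[<] p.δ₀, Flow3.IsAsymptoticallyStable (p.field δ) (range (u δ))) := by
  have h : p.Admissible := ⟨hα, hβ, hγ, hδ₀⟩
  obtain ⟨h1, h2, -, h3⟩ := h.crossing
  refine ⟨⟨h.ρ_pos, h1, h2, h3⟩, h.hasDynamicTransition, h.hasPeriodicBifurcation,
    fun hb => ?_, fun hb => ?_⟩
  · obtain ⟨T, u, hTu, hst⟩ := h.exists_bifurcatingFamily hb.ne' (l := 𝓝[>] p.δ₀)
      nhdsWithin_le_nhds (by
        filter_upwards [self_mem_nhdsWithin] with δ hδ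
        exact div_pos (sub_pos.2 hδ) (div_pos_of_neg_of_neg (by linarith) h.k_neg))
    exact ⟨T, u, hTu, hst.mono fun δ hδ => hδ.1 hb⟩
  · obtain ⟨T, u, hTu, hst⟩ := h.exists_bifurcatingFamily hb.ne (l := 𝓝[<] p.δ₀)
      nhdsWithin_le_nhds (by
        filter_upwards [self_mem_nhdsWithin] with δ hδ
        exact div_pos_of_neg_of_neg (sub_neg.2 hδ)
          (div_neg_of_pos_of_neg (by linarith) h.k_neg))
    exact ⟨T, u, hTu, hst.mono fun δ hδ => hδ.2 hb⟩
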